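/- **Setting.** Let $M$ be a smooth oriented four-manifold with boundary $\mathscr I$, with a smooth Lorentzian metric $g_{ab}$ (signature $-+++$), volume form $\varepsilon_{abcd}$, and a smooth conformal factor $\Omega\ge 0$ with $\Omega=0$ exactly on $\mathscr I$ and $n_a:=\nabla_a\Omega\neq0$ there. The physical spacetime is the interior, with $\hat g_{ab}=\Omega^{-2}g_{ab}$, $\hat\varepsilon_{abcd}=\Omega^{-4}\varepsilon_{abcd}$. Assume the Bondi condition: $\nabla_an_b=0$ on $\mathscr I$ and $n_an^a=O(\Omega^2)$. Let $u$ be a smooth function with $n^a\nabla_au=1$ on $\mathscr I$, and suppose $\mathscr I\cong\mathbb R\times S^2$ by a diffeomorphism under which $u$ is the first coordinate. Write $S_t=\{u=t\}\subset\mathscr I$, let $l^a$ be the null vector field on $\mathscr I$ orthogonal to the $S_t$ with $l^an_a=-1$, and put $q^{ab}=g^{ab}+2n^{(a}l^{b)}$, $\varepsilon_{abc}=l^d\varepsilon_{dabc}$ (form $\boldsymbol\varepsilon_3$), $\varepsilon_{ab}=-n^c\varepsilon_{cab}$ (form $\boldsymbol\varepsilon_2$). The form $\boldsymbol\varepsilon_3$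 orients $\mathscr I$ and $\boldsymbol\varepsilon_2$ orients the $S_t$; $\mathscr D_a$ is the covariant derivative of the $S_t$. Let $A_a$ be a $1$-form, smooth up to $\mathscr I$, with $n^aA_a=0$ on $\mathscr I$, whose field strength $F=dA$ satisfies the source-free Maxwell equations $\hat\nabla_b\hat F^{ba}=0$ of $\hat g$ in the physical spacetime near $\mathscr I$. Let $\xi=(X^a,\lambda)$ be a symmetry: $X^a$ is smooth up to $\mathscr I$, tangent to $\mathscr I$, and on $\mathscr I$ satisfies $\mathcal L_Xn^a=-\alpha n^a$, $\mathcal L_Xq_{ab}=2\alpha q_{ab}$ ($q_{ab}$ the pullback of $g_{ab}$) for a smooth $\alpha$ with $\mathcal L_n\alpha=0$; $\lambda$ is smooth with $\mathcal L_n\lambda=0$ on $\mathscr I$. On $\mathscr I$ write $X^a=\beta n^a+Y^a$ with $Y^a$ tangent to the $S_t$, $E_a=F_{ab}n^b$, and $\mathrm{Re}[\varphi_1]=\tfrac12F_{ab}l^an^b$. In the physical spacetime let $J_{abc}=\hat\varepsilon_{dabc}\hat\jmath^d$, where (indices raised with $\hat g$) $$\hat\jmath_C^a=-\tfrac1{4\pi}\big[F^{ab}(\mathcal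 L_XA_b+\nabla_b\lambda)-\hat g^{ac}\hat g^{bd}A_b\mathcal L_XF_{cd}\big],\quad \hat\jmath_N^a=-\tfrac1{4\pi}F^{ab}(\mathcal L_XA_b+\nabla_b\lambda)+\tfrac1{16\pi}X^aF^2,\quad \hat\jmath_T^a=\tfrac1{4\pi}\big(F^{ac}F_{bc}X^b-\tfrac14X^aF^2\big)$$ define the canonical, Noether and stress-energy currents $J_C,J_N,J_T$, and let $$(Q_C)_{ab}=-\tfrac1{8\pi}\hat\varepsilon_{cdab}\big(2X^cF^{de}A_e-\lambda F^{cd}\big),\qquad (Q_N)_{ab}=-\tfrac1{8\pi}\hat\varepsilon_{cdab}F^{cd}\big(X^eA_e+\lambda\big).$$ **Claim.** These five forms extend smoothly to $\mathscr I$, and their extensions satisfy the following. 1. Pulled back to $\mathscr I$: $J_N=\tfrac12(J_C-dQ_C)$ and $J_T=-J_N+dQ_N$. 2. The pullbacks to $\mathscr I$ are $$J_C=-\tfrac1{4\pi}q^{ab}\big[E_a(\mathcal L_XA_b+\mathscr D_b\lambda)-A_a\mathcal L_XE_b-\tfrac12E_aA_b\mathscr D_cY^c\big]\boldsymbol\varepsilon_3,$$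 $$J_N=-\tfrac1{4\pi}q^{ab}E_a(\mathcal L_XA_b+\mathscr D_b\lambda)\,\boldsymbol\varepsilon_3,\qquad J_T=-\tfrac1{4\pi}E_a\big(q^{ab}F_{bc}X^c+2\,\mathrm{Re}[\varphi_1]Y^a\big)\boldsymbol\varepsilon_3,$$ and the fluxes $\mathcal F_C,\mathcal F_N,\mathcal F_T$ (integrals of $J_C$, $J_N$, $J_T$) through a region $\Delta\mathscr I=\{t_1\le u\le t_2\}$ are the integrals of these expressions. 3. For $t_1\le t_2$, $S_1=S_{t_1}$ and $S_2=S_{t_2}$: $$\mathcal F_N=\tfrac12\mathcal F_C+\tfrac12\Big[\int_{S_2}Q_C-\int_{S_1}Q_C\Big],\qquad \mathcal F_T=-\mathcal F_N-\Big[\int_{S_2}Q_N-\int_{S_1}Q_N\Big],$$ where on every cross-section $S=S_t$ $$\int_SQ_C=-\tfrac1{4\pi}\int_S\boldsymbol\varepsilon_2\big(\beta E^aA_a-2\lambda\,\mathrm{Re}[\varphi_1]\big),\qquad\int_SQ_N=-\tfrac1{2\pi}\int_S\boldsymbol\varepsilon_2\,\mathrm{Re}[\varphi_1]\big(Y^aA_a+\lambda\big),$$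 with $E^aA_a=q^{ab}E_aA_b$, and $$\tfrac1{4\pi}\int_{S_2}\boldsymbol\varepsilon_2\,2\lambda\,\mathrm{Re}[\varphi_1]-\tfrac1{4\pi}\int_{S_1}\boldsymbol\varepsilon_2\,2\lambda\,\mathrm{Re}[\varphi_1]=-\tfrac1{4\pi}\int_{\Delta\mathscr I}\boldsymbol\varepsilon_3\,q^{ab}E_a\mathscr D_b\lambda.$$ 4. The canonical and Noether currents at $\mathscr I$ are purely radiative, the stress-energy current is not: if $A'$ is another such potential with the same pullback to $\mathscr I$ as $A$, then $J'_C=J_C$ and $J'_N=J_N$ on $\mathscr I$ (as pulled-back forms, hence for the fluxes), whereas $$J'_T-J_T=-\tfrac1{2\pi}\big(\mathrm{Re}[\varphi_1']-\mathrm{Re}[\varphi_1]\big)E_aY^a\,\boldsymbol\varepsilon_3 .$$ -/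

import Mathlib

open Set Filter Topology Asymptotics
open scoped Manifold ContDiff Interval

noncomputable section

namespace ScriMaxwell

/-! ## Differential forms, vector fields and metrics on a manifold (possibly with boundary) -/

section Calculus

variable {E : Type*} [NormedAddCommGroup E] [NormedSpace ℝ E]
  {H : Type*} [TopologicalSpace H] (I : ModelWithCorners ℝ E H)
  (M : Type*) [TopologicalSpace M] [ChartedSpace H M]

/-- A (not necessarily smooth) differential `k`-form on `M`. -/
abbrev DForm (k : ℕ) := ∀ x : M, (TangentSpace I x) [⋀^Fin k]→L[ℝ] ℝ

/-- A (not necessarily smooth) vector field on `M`. -/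
abbrev VField := ∀ x : M, TangentSpace I x

/-- A (not necessarily smooth) covariant tensor field of rank two on `M`. -/
abbrev BilinField := ∀ x : M, TangentSpace I x →L[ℝ] TangentSpace I x →L[ℝ] ℝ

variable {M}

/-- The coordinate expression of a form in the chart at `x₀`: its pullback under the inverse of the
chart, a form on the model vector space `E`. -/
def chartForm {k : ℕ} (η : DForm I M k) (x₀ : M) : E → E [⋀^Fin k]→L[ℝ] ℝ := fun y =>
  (η ((extChartAt I x₀).symm y)).compContinuousLinearMap
    (mfderivWithin 𝓘(ℝ, E) I (extChartAt I x₀).symm (range I) y)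

/-- The coordinate expression of a rank two covariant tensor in the chart at `x₀`. -/
def chartBilin (g : BilinField I M) (x₀ : M) : E → E →L[ℝ] E →L[ℝ] ℝ := fun y =>
  ContinuousLinearMap.bilinearComp (E := E) (F := E) (E' := E) (F' := E) (g ((extChartAt I x₀).symm y))
    (mfderivWithin 𝓘(ℝ, E) I (extChartAt I x₀).symm (range I) y)
    (mfderivWithin 𝓘(ℝ, E) I (extChartAt I x₀).symm (range I) y)

/-- The coordinate expression of a vector field in the chart at `x₀`. -/
def chartVField (X : VField I M) (x₀ : M) : E → E :=
  VectorField.mpullbackWithin 𝓘(ℝ, E) I (extChartAt I x₀).symm X (range I)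

/-- Smoothness (up to and including the boundary) of a form: its components in charts are smooth. -/
def SmoothForm {k : ℕ} (η : DForm I M k) : Prop :=
  ∀ x₀ : M, ContDiffOn ℝ ∞ (chartForm I η x₀) (extChartAt I x₀).target

/-- Smoothness (up to and including the boundary) of a rank two covariant tensor. -/
def SmoothBilin (g : BilinField I M) : Prop :=
  ∀ x₀ : M, ContDiffOn ℝ ∞ (chartBilin I g x₀) (extChartAt I x₀).target

/-- Smoothness (up to and including the boundary) of a vector field. -/
def SmoothVField (X : VField I M) : Prop :=
  ∀ x₀ : M, ContDiffOn ℝ ∞ (chartVField I X x₀) (extChartAt I x₀).target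

/-- The exterior derivative `dη`, computed at `x` in the chart at `x`. -/
def extD {k : ℕ} (η : DForm I M k) : DForm I M (k + 1) := fun x =>
  (extDerivWithin (chartForm I η x) (range I) (extChartAt I x x)).compContinuousLinearMap
    (mfderiv I 𝓘(ℝ, E) (extChartAt I x) x)

variable {I}

/-- Contraction of a vector into the first slot of a form: `(v ⌟ η)_{b…} = v^a η_{ab…}`. -/
def contract {x : M} {k : ℕ} (v : TangentSpace I x)
    (η : (TangentSpace I x) [⋀^Fin (k + 1)]→L[ℝ] ℝ) : (TangentSpace I x) [⋀^Fin k]→L[ℝ] ℝ :=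
  ContinuousAlternatingMap.curryLeft (E := E) η v

/-- A `1`-form at a point regarded as a covector. -/
def covector {x : M} (α : (TangentSpace I x) [⋀^Fin 1]→L[ℝ] ℝ) : TangentSpace I x →L[ℝ] ℝ :=
  (ContinuousAlternatingMap.ofSubsingleton ℝ (TangentSpace I x) ℝ (0 : Fin 1)).symm α

/-- A covector regarded as a `1`-form at a point. -/
def oneForm {x : M} (α : TangentSpace I x →L[ℝ] ℝ) : (TangentSpace I x) [⋀^Fin 1]→L[ℝ] ℝ :=
  ContinuousAlternatingMap.ofSubsingleton ℝ (TangentSpace I x) ℝ (0 : Fin 1) α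

variable (I)

/-- The differential of a function, as a covector field. -/
def dFun (f : M → ℝ) (x : M) : TangentSpace I x →L[ℝ] ℝ := mfderiv I 𝓘(ℝ, ℝ) f x

variable {I}

/-- The Lie derivative of a form of positive degree, `L_X η = X ⌟ dη + d (X ⌟ η)`. -/
def lieForm {k : ℕ} (X : VField I M) (η : DForm I M (k + 1)) : DForm I M (k + 1) := fun x =>
  contract (X x) (extD I η x) + extD I (fun y => contract (X y) (η y)) x

/-- The Lie derivative of a covariant rank two tensor, computed at `x` in the chart at `x`:
`(L_X g)_{ab} = X^c ∂_c g_{ab} + g_{cb} ∂_a X^c + g_{ac} ∂_b X^c`. -/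
def lieBilin (X : VField I M) (g : BilinField I M) : BilinField I M := fun x =>
  let y : E := extChartAt I x x
  let G : E →L[ℝ] E →L[ℝ] ℝ := chartBilin I g x y
  let DX : E →L[ℝ] E := fderivWithin ℝ (chartVField I X x) (range I) y
  let DG : E →L[ℝ] E →L[ℝ] E →L[ℝ] ℝ := fderivWithin ℝ (chartBilin I g x) (range I) y
  let L : E →L[ℝ] E →L[ℝ] ℝ :=
    DG (chartVField I X x y) + G.comp DX + (G.flip.comp DX).flip
  ContinuousLinearMap.bilinearComp (E' := E) (F' := E) L
    (mfderiv I 𝓘(ℝ, E) (extChartAt I x) x) (mfderiv I 𝓘(ℝ, E) (extChartAt I x) x)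

/-- The Levi-Civita covariant derivative `∇_a Y_b` of a vector field `Y` with its index lowered, as
a bilinear form `(v, w) ↦ v^a w^b ∇_a Y_b = g(∇_v Y, w)`. In the chart at `x`, with the Christoffel
symbols written out, it is
`g(∂_v Y, w) + ½ (∂_v g(Y, w) + ∂_Y g(v, w) - ∂_w g(Y, v))`. -/
def nablaLow (g : BilinField I M) (Y : VField I M) : BilinField I M := fun x =>
  let y : E := extChartAt I x x
  let G : E →L[ℝ] E →L[ℝ] ℝ := chartBilin I g x y
  let DY : E →L[ℝ] E := fderivWithin ℝ (chartVField I Y x) (range I) y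
  let DG : E →L[ℝ] E →L[ℝ] E →L[ℝ] ℝ := fderivWithin ℝ (chartBilin I g x) (range I) y
  let B : E →L[ℝ] E →L[ℝ] ℝ := DG.flip (chartVField I Y x y)
  let L : E →L[ℝ] E →L[ℝ] ℝ :=
    G.comp DY + (1 / 2 : ℝ) • (B + DG (chartVField I Y x y) - B.flip)
  ContinuousLinearMap.bilinearComp (E' := E) (F' := E) L
    (mfderiv I 𝓘(ℝ, E) (extChartAt I x) x) (mfderiv I 𝓘(ℝ, E) (extChartAt I x) x)

/-- Raising an index: `(sharp g x α)^a = g^{ab} α_b`. -/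
def sharp (g : BilinField I M) (x : M) :
    (TangentSpace I x →L[ℝ] ℝ) →L[ℝ] TangentSpace I x :=
  ContinuousLinearMap.inverse (g x)

/-- The pullback of a form under a map. -/
def pullForm {E' : Type*} [NormedAddCommGroup E'] [NormedSpace ℝ E']
    {H' : Type*} [TopologicalSpace H'] (I' : ModelWithCorners ℝ E' H')
    {N : Type*} [TopologicalSpace N] [ChartedSpace H' N] (Φ : N → M) {k : ℕ}
    (η : DForm I M k) : DForm I' N k := fun z =>
  (η (Φ z)).compContinuousLinearMap (mfderiv I' I Φ z)

end Calculus

/-! ## Maxwell currents on a four-dimensional spacetime -/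

section Currents

/-- The model vector space of a four-dimensional manifold. -/
abbrev E4 := EuclideanSpace ℝ (Fin 4)

variable {M : Type*} [TopologicalSpace M] [ChartedSpace (EuclideanHalfSpace 4) M]

/-- The vectors `e_i` of a basis of the tangent space at `x`. -/
def frame (x : M) (i : Fin 4) : TangentSpace (𝓡∂ 4) x := (EuclideanSpace.single i (1 : ℝ) : E4)

/-- The covectors `e^i` of the dual basis. -/
def coframe (x : M) (i : Fin 4) : TangentSpace (𝓡∂ 4) x →L[ℝ] ℝ :=
  (EuclideanSpace.proj i : E4 →L[ℝ] ℝ)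

/-- The Lorentzian signature condition `(-,+,+,+)` at every point. -/
def IsLorentzian (g : BilinField (𝓡∂ 4) M) : Prop :=
  (∀ x v w, g x v w = g x w v) ∧
  ∀ x : M, ∃ b : Module.Basis (Fin 4) ℝ (TangentSpace (𝓡∂ 4) x),
    ∀ i j, g x (b i) (b j) = if i = j then (if i = 0 then -1 else 1) else 0

/-- A volume form of `g`: in an orthonormal basis its only component is `±1`. -/
def IsVolumeForm (g : BilinField (𝓡∂ 4) M) (ε : DForm (𝓡∂ 4) M 4) : Prop :=
  ∀ x (v : Fin 4 → TangentSpace (𝓡∂ 4) x),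
    (ε x v) ^ 2 = - (Matrix.of fun i j => g x (v i) (v j)).det

/-- The field strength `F = dA`, i.e. `F_{ab} = 2 ∇_{[a} A_{b]}`. -/
def fieldStrength (A : DForm (𝓡∂ 4) M 1) : DForm (𝓡∂ 4) M 2 := extD (𝓡∂ 4) A

/-- For a `2`-form `F`, the vector `F^{ab} β_b`. -/
def raiseF (g : BilinField (𝓡∂ 4) M) (F : DForm (𝓡∂ 4) M 2) (x : M)
    (β : TangentSpace (𝓡∂ 4) x →L[ℝ] ℝ) : TangentSpace (𝓡∂ 4) x :=
  sharp g x (covector (-contract (sharp g x β) (F x)))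

/-- The Hodge dual of a `2`-form, `(⋆F)_{ab} = ½ ε_{cdab} F^{cd}`. The vector with components
`F^{id}` is `sharp (F(sharp e^i, ·))`. -/
def hodge (g : BilinField (𝓡∂ 4) M) (ε : DForm (𝓡∂ 4) M 4) (F : DForm (𝓡∂ 4) M 2) :
    DForm (𝓡∂ 4) M 2 := fun x =>
  (1 / 2 : ℝ) • ∑ i : Fin 4,
    contract (sharp g x (covector (contract (sharp g x (coframe x i)) (F x))))
      (contract (frame x i) (ε x))

/-- The scalar `F² = g^{ac} g^{bd} F_{ab} F_{cd}`. -/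
def sqF (g : BilinField (𝓡∂ 4) M) (F : DForm (𝓡∂ 4) M 2) (x : M) : ℝ :=
  ∑ i : Fin 4, ∑ j : Fin 4, F x ![frame x i, frame x j] *
    F x ![sharp g x (coframe x i), sharp g x (coframe x j)]

/-- The source-free Maxwell equation `∇_b F^{ba} = 0` at `x`, in the form `d ⋆F = 0`. -/
def MaxwellAt (g : BilinField (𝓡∂ 4) M) (ε : DForm (𝓡∂ 4) M 4) (A : DForm (𝓡∂ 4) M 1)
    (x : M) : Prop :=
  extD (𝓡∂ 4) (hodge g ε (fieldStrength A)) x = 0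

/-- The variation `δ_ξ A = L_X A + dλ` of the potential under `ξ = (X, λ)`. -/
def deltaA (A : DForm (𝓡∂ 4) M 1) (X : VField (𝓡∂ 4) M) (lam : M → ℝ) : DForm (𝓡∂ 4) M 1 :=
  fun x => lieForm X A x + oneForm (dFun (𝓡∂ 4) lam x)

variable (g : BilinField (𝓡∂ 4) M) (ε : DForm (𝓡∂ 4) M 4) (A : DForm (𝓡∂ 4) M 1)
  (X : VField (𝓡∂ 4) M) (lam : M → ℝ)

/-- The canonical current vector
`j_C^a = -(1/4π) [F^{ab} (L_X A_b + ∇_b λ) - g^{ac} g^{bd} A_b (L_X F)_{cd}]`. -/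
def canonicalVec : VField (𝓡∂ 4) M := fun x =>
  -(1 / (4 * Real.pi)) •
    (raiseF g (fieldStrength A) x (covector (deltaA A X lam x))
      - raiseF g (lieForm X (fieldStrength A)) x (covector (A x)))

/-- The Noether current vector `j_N^a = -(1/4π) F^{ab} (L_X A_b + ∇_b λ) + (1/16π) X^a F²`. -/
def noetherVec : VField (𝓡∂ 4) M := fun x =>
  -(1 / (4 * Real.pi)) • raiseF g (fieldStrength A) x (covector (deltaA A X lam x))
    + (1 / (16 * Real.pi) * sqF g (fieldStrength A) x) • X x

/-- The stress-energy current vector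
`j_T^a = T^{ab} X_b = (1/4π) (F^{ac} F_{bc} X^b - ¼ X^a F²)`. -/
def stressVec : VField (𝓡∂ 4) M := fun x =>
  (1 / (4 * Real.pi)) •
    (raiseF g (fieldStrength A) x (covector (contract (X x) (fieldStrength A x)))
      - (1 / 4 * sqF g (fieldStrength A) x) • X x)

/-- The current `3`-form `J_{abc} = ε_{dabc} j^d` of a vector field `j`. -/
def currentForm (j : VField (𝓡∂ 4) M) : DForm (𝓡∂ 4) M 3 := fun x => contract (j x) (ε x)

/-- The Noether boundary form `Q_N = -(1/8π) ε_{cdab} F^{cd} (X^e A_e + λ)`. -/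
def boundaryN : DForm (𝓡∂ 4) M 2 := fun x =>
  (-(1 / (8 * Real.pi)) * (covector (A x) (X x) + lam x)) •
    ((2 : ℝ) • hodge g ε (fieldStrength A) x)

/-- The canonical boundary form `Q_C = -(1/8π) ε_{cdab} (2 X^c F^{de} A_e - λ F^{cd})`. -/
def boundaryC : DForm (𝓡∂ 4) M 2 := fun x =>
  -(1 / (8 * Real.pi)) •
    ((2 : ℝ) • contract (raiseF g (fieldStrength A) x (covector (A x))) (contract (X x) (ε x))
      - lam x • ((2 : ℝ) • hodge g ε (fieldStrength A) x))

end Currents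

/-! ## Null infinity -/

section Scri

/-- The two-sphere. -/
abbrev S2 := Metric.sphere (0 : EuclideanSpace ℝ (Fin 3)) 1

/-- The model of `ℝ × S²`. -/
abbrev IN := (𝓘(ℝ, ℝ)).prod (𝓡 2)

/-- The abstract null infinity `ℝ × S²`. -/
abbrev Scri := ℝ × S2

/-- The point of the unit sphere with polar angle `θ` and azimuth `φ`. -/
def sph (θ φ : ℝ) : S2 :=
  ⟨!₂[Real.sin θ * Real.cos φ, Real.sin θ * Real.sin φ, Real.cos θ], by
    have h1 := Real.sin_sq_add_cos_sq θ
    have h2 := Real.sin_sq_add_cos_sq φ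
    simp only [mem_sphere_iff_norm, sub_zero, EuclideanSpace.norm_eq, Fin.sum_univ_three,
      Real.norm_eq_abs, sq_abs]
    rw [Real.sqrt_eq_one]
    simp
    nlinarith⟩

/-- The coordinate vector `∂_u` at the point `(t, sph θ φ)` of `ℝ × S²`. -/
def partialU (t θ φ : ℝ) : TangentSpace IN ((t, sph θ φ) : Scri) :=
  mfderiv 𝓘(ℝ, ℝ) IN (fun s : ℝ => ((s, sph θ φ) : Scri)) t (1 : ℝ)

/-- The coordinate vector `∂_θ`. -/
def partialTheta (t θ φ : ℝ) : TangentSpace IN ((t, sph θ φ) : Scri) :=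
  mfderiv 𝓘(ℝ, ℝ) IN (fun s : ℝ => ((t, sph s φ) : Scri)) θ (1 : ℝ)

/-- The coordinate vector `∂_φ`. -/
def partialPhi (t θ φ : ℝ) : TangentSpace IN ((t, sph θ φ) : Scri) :=
  mfderiv 𝓘(ℝ, ℝ) IN (fun s : ℝ => ((t, sph θ s) : Scri)) φ (1 : ℝ)

/-- The integral of a `2`-form over the cross-section `{t} × S²`, oriented by `(∂_θ, ∂_φ)`. -/
def crossInt (t : ℝ) (η : DForm IN Scri 2) : ℝ :=
  ∫ θ in (0 : ℝ)..Real.pi, ∫ φ in (0 : ℝ)..(2 * Real.pi),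
    η (t, sph θ φ) ![partialTheta t θ φ, partialPhi t θ φ]

/-- The integral of a `3`-form over the region `t₁ ≤ u ≤ t₂`, with the orientation for which
`(∂_u, ∂_θ, ∂_φ)` is negative (this is the orientation of `ε₃ = -du ∧ ε₂`). -/
def scriInt (t₁ t₂ : ℝ) (η : DForm IN Scri 3) : ℝ :=
  -∫ t in t₁..t₂, ∫ θ in (0 : ℝ)..Real.pi, ∫ φ in (0 : ℝ)..(2 * Real.pi),
    η (t, sph θ φ) ![partialU t θ φ, partialTheta t θ φ, partialPhi t θ φ]

variable (M : Type*) [TopologicalSpace M] [ChartedSpace (EuclideanHalfSpace 4) M]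

/-- A conformal completion: the unphysical spacetime `M` is a four-manifold with boundary, with a
smooth Lorentzian metric `g`, a volume form `vol` of `g` (an orientation), and a conformal factor
`Ω` which is positive in the interior (the physical spacetime, with metric `Ω⁻² g`), vanishes with
nonzero differential on the boundary (null infinity), and satisfies the Bondi condition. -/
structure Completion where
  g : BilinField (𝓡∂ 4) M
  g_smooth : SmoothBilin (𝓡∂ 4) g
  g_lorentzian : IsLorentzian g
  vol : DForm (𝓡∂ 4) M 4
  vol_smooth : SmoothForm (𝓡∂ 4) vol
  vol_isVolumeForm : IsVolumeForm g vol
  Ω : M → ℝ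
  Ω_smooth : ContMDiff (𝓡∂ 4) 𝓘(ℝ, ℝ) ∞ Ω
  Ω_nonneg : ∀ x, 0 ≤ Ω x
  Ω_eq_zero_iff : ∀ x, Ω x = 0 ↔ x ∈ (𝓡∂ 4).boundary M
  dΩ_ne_zero : ∀ x ∈ (𝓡∂ 4).boundary M, dFun (𝓡∂ 4) Ω x ≠ 0
  bondi : ∀ x ∈ (𝓡∂ 4).boundary M,
    nablaLow g (fun y => sharp g y (dFun (𝓡∂ 4) Ω y)) x = 0
  bondi_norm : ∀ x ∈ (𝓡∂ 4).boundary M,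
    (fun y => dFun (𝓡∂ 4) Ω y (sharp g y (dFun (𝓡∂ 4) Ω y))) =O[𝓝 x] fun y => Ω y ^ 2

variable {M}

namespace Completion

variable (C : Completion M)

/-- The normal `n^a = g^{ab} ∇_b Ω`. -/
def n : VField (𝓡∂ 4) M := fun x => sharp C.g x (dFun (𝓡∂ 4) C.Ω x)

/-- The physical metric `Ω⁻² g` (meaningful in the interior, where `Ω > 0`). -/
def physG : BilinField (𝓡∂ 4) M := fun x => (C.Ω x ^ 2)⁻¹ • C.g x

/-- The physical volume form `Ω⁻⁴ ε` (meaningful in the interior, where `Ω > 0`). -/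
def physVol : DForm (𝓡∂ 4) M 4 := fun x => (C.Ω x ^ 4)⁻¹ • C.vol x

/-- `η` is a smooth form on all of `M` that agrees with the form `ηPhys` in the physical
spacetime. -/
def IsSmoothExtension {k : ℕ} (η ηPhys : DForm (𝓡∂ 4) M k) : Prop :=
  SmoothForm (𝓡∂ 4) η ∧ ∀ x, 0 < C.Ω x → η x = ηPhys x

/-- A potential `A`, smooth up to null infinity and in the outgoing radiation gauge
`n^a A_a = 0` on null infinity, that satisfies the physical source-free Maxwell equations near null
infinity. -/
def IsMaxwellPotential (A : DForm (𝓡∂ 4) M 1) : Prop :=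
  SmoothForm (𝓡∂ 4) A ∧
  (∀ x ∈ (𝓡∂ 4).boundary M, covector (A x) (C.n x) = 0) ∧
  ∀ x ∈ (𝓡∂ 4).boundary M, ∀ᶠ y in 𝓝 x, 0 < C.Ω y → MaxwellAt C.physG C.physVol A y

/-- `X` is a BMS vector field: it is smooth, tangent to null infinity, and there
`L_X n = -α n` and `L_X q = 2 α q` (`q` being the pullback of `g`) for a smooth `α` with
`L_n α = 0`. -/
def IsBMS (X : VField (𝓡∂ 4) M) : Prop :=
  SmoothVField (𝓡∂ 4) X ∧
  (∀ x ∈ (𝓡∂ 4).boundary M, dFun (𝓡∂ 4) C.Ω x (X x) = 0) ∧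
  ∃ α : M → ℝ, ContMDiff (𝓡∂ 4) 𝓘(ℝ, ℝ) ∞ α ∧ ∀ x ∈ (𝓡∂ 4).boundary M,
    dFun (𝓡∂ 4) α x (C.n x) = 0 ∧
    VectorField.mlieBracket (𝓡∂ 4) X C.n x = -α x • C.n x ∧
    ∀ v w, dFun (𝓡∂ 4) C.Ω x v = 0 → dFun (𝓡∂ 4) C.Ω x w = 0 →
      lieBilin X C.g x v w = 2 * α x * C.g x v w

/-- `ξ = (X, λ)` is an asymptotic symmetry: `X` is a BMS vector field and `λ` is a smooth function
with `L_n λ = 0` on null infinity. -/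
def IsSymmetry (X : VField (𝓡∂ 4) M) (lam : M → ℝ) : Prop :=
  C.IsBMS X ∧ ContMDiff (𝓡∂ 4) 𝓘(ℝ, ℝ) ∞ lam ∧
  ∀ x ∈ (𝓡∂ 4).boundary M, dFun (𝓡∂ 4) lam x (C.n x) = 0

/-- The electric field `E_a = F_{ab} n^b`. -/
def electric (A : DForm (𝓡∂ 4) M 1) : DForm (𝓡∂ 4) M 1 := fun x =>
  -contract (C.n x) (fieldStrength A x)

/-- Smooth extensions to null infinity of the physical currents and boundary forms. -/
structure Currents (A : DForm (𝓡∂ 4) M 1) (X : VField (𝓡∂ 4) M) (lam : M → ℝ) where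
  JC : DForm (𝓡∂ 4) M 3
  JN : DForm (𝓡∂ 4) M 3
  JT : DForm (𝓡∂ 4) M 3
  QC : DForm (𝓡∂ 4) M 2
  QN : DForm (𝓡∂ 4) M 2
  isExt_JC : C.IsSmoothExtension JC (currentForm C.physVol (canonicalVec C.physG A X lam))
  isExt_JN : C.IsSmoothExtension JN (currentForm C.physVol (noetherVec C.physG A X lam))
  isExt_JT : C.IsSmoothExtension JT (currentForm C.physVol (stressVec C.physG A X))
  isExt_QC : C.IsSmoothExtension QC (boundaryC C.physG C.physVol A X lam)
  isExt_QN : C.IsSmoothExtension QN (boundaryN C.physG C.physVol A X lam)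

/-- A foliation of null infinity by cross-sections: a smooth function `u` with `n^a ∇_a u = 1` on
null infinity, the auxiliary normal `l` it determines there (null, `l^a n_a = -1`, orthogonal to
the cross-sections `u = const`), and a diffeomorphism `Φ` of `ℝ × S²` onto null infinity that
takes the spheres `{t} × S²` to the cross-sections `u = t`, with `(∂_θ, ∂_φ)` positive for `ε₂`.
Only the values of `u` and `l` on null infinity matter. -/
structure Foliation where
  u : M → ℝ
  u_smooth : ContMDiff (𝓡∂ 4) 𝓘(ℝ, ℝ) ∞ u
  u_normal : ∀ x ∈ (𝓡∂ 4).boundary M, dFun (𝓡∂ 4) u x (C.n x) = 1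
  l : VField (𝓡∂ 4) M
  l_null : ∀ x ∈ (𝓡∂ 4).boundary M, C.g x (l x) (l x) = 0
  l_normal : ∀ x ∈ (𝓡∂ 4).boundary M, C.g x (l x) (C.n x) = -1
  l_orth : ∀ x ∈ (𝓡∂ 4).boundary M, ∀ v, dFun (𝓡∂ 4) C.Ω x v = 0 → dFun (𝓡∂ 4) u x v = 0 →
    C.g x (l x) v = 0
  Φ : Scri → M
  Φ_smooth : ContMDiff IN (𝓡∂ 4) ∞ Φ
  Φ_embedding : IsEmbedding Φ
  Φ_immersion : ∀ z, Function.Injective (mfderiv IN (𝓡∂ 4) Φ z)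
  Φ_range : range Φ = (𝓡∂ 4).boundary M
  u_Φ : ∀ z : Scri, u (Φ z) = z.1
  /-- `ε₂(∂_θ, ∂_φ) > 0`, where `ε_{ab} = -n^c ε_{cab}` and `ε_{abc} = l^d ε_{dabc}`. -/
  Φ_oriented : ∀ t θ φ : ℝ, 0 < θ → θ < Real.pi →
    0 < pullForm IN Φ (fun x => -contract (C.n x) (contract (l x) (C.vol x)))
      (t, sph θ φ) ![partialTheta t θ φ, partialPhi t θ φ]

namespace Foliation

variable {C} (S : C.Foliation)

/-- Pullback of a form on `M` to null infinity. -/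
def pull {k : ℕ} (η : DForm (𝓡∂ 4) M k) : DForm IN Scri k := pullForm IN S.Φ η

/-- The volume element `ε_{abc} = l^d ε_{dabc}` of null infinity, multiplied by a function `f`. -/
def vol3 (f : M → ℝ) : DForm IN Scri 3 := S.pull fun x => f x • contract (S.l x) (C.vol x)

/-- The area element `ε_{ab} = -n^c ε_{cab}` of the cross-sections, multiplied by a function. -/
def vol2 (f : M → ℝ) : DForm IN Scri 2 :=
  S.pull fun x => f x • -contract (C.n x) (contract (S.l x) (C.vol x))

/-- The contraction `q^{ab} α_a β_b`, where `q^{ab} = g^{ab} + 2 n^{(a} l^{b)}`. -/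
def qInv {x : M} (α β : (TangentSpace (𝓡∂ 4) x) [⋀^Fin 1]→L[ℝ] ℝ) : ℝ :=
  covector α (sharp C.g x (covector β))
    + covector α (C.n x) * covector β (S.l x) + covector α (S.l x) * covector β (C.n x)

/-- The coefficient `β` in the decomposition `X^a = β n^a + Y^a` on null infinity, where `Y` is
tangent to the cross-sections `u = const`. -/
def beta (X : VField (𝓡∂ 4) M) (x : M) : ℝ := dFun (𝓡∂ 4) S.u x (X x)

/-- The part `Y` of `X = β n + Y` tangent to the cross-sections. -/
def Y (X : VField (𝓡∂ 4) M) : VField (𝓡∂ 4) M := fun x => X x - S.beta X x • C.n x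

/-- The divergence `𝒟_c Y^c = q^{ab} ∇_a Y_b` on the cross-sections. -/
def divY (X : VField (𝓡∂ 4) M) (x : M) : ℝ :=
  ∑ i : Fin 4, nablaLow C.g (S.Y X) x (frame x i) (sharp C.g x (coframe x i))
    + nablaLow C.g (S.Y X) x (C.n x) (S.l x) + nablaLow C.g (S.Y X) x (S.l x) (C.n x)

/-- The Coulombic part `Re φ₁ = ½ F_{ab} l^a n^b`. -/
def rePhi1 (A : DForm (𝓡∂ 4) M 1) (x : M) : ℝ :=
  1 / 2 * fieldStrength A x ![S.l x, C.n x]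

/-- The density `q^{ab} E_a (L_X A_b + 𝒟_b λ)`. -/
def densN (A : DForm (𝓡∂ 4) M 1) (X : VField (𝓡∂ 4) M) (lam : M → ℝ) (x : M) : ℝ :=
  S.qInv (C.electric A x) (deltaA A X lam x)

/-- The density `q^{ab} [E_a (L_X A_b + 𝒟_b λ) - A_a L_X E_b - ½ E_a A_b 𝒟_c Y^c]`. -/
def densC (A : DForm (𝓡∂ 4) M 1) (X : VField (𝓡∂ 4) M) (lam : M → ℝ) (x : M) : ℝ :=
  S.qInv (C.electric A x) (deltaA A X lam x)
    - S.qInv (A x) (lieForm X (C.electric A) x)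
    - 1 / 2 * S.qInv (C.electric A x) (A x) * S.divY X x

/-- The density `E_a (q^{ab} F_{bc} X^c + 2 Re φ₁ Y^a)`. -/
def densT (A : DForm (𝓡∂ 4) M 1) (X : VField (𝓡∂ 4) M) (x : M) : ℝ :=
  S.qInv (C.electric A x) (-contract (X x) (fieldStrength A x))
    + 2 * S.rePhi1 A x * covector (C.electric A x) (S.Y X x)

/-- The flux `∫_{Δℐ} J` of a current through the region `t₁ ≤ u ≤ t₂` of null infinity. -/
def flux (t₁ t₂ : ℝ) (J : DForm (𝓡∂ 4) M 3) : ℝ := scriInt t₁ t₂ (S.pull J)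

/-- The integral `∫_S Q` over the cross-section `u = t`. -/
def charge (t : ℝ) (Q : DForm (𝓡∂ 4) M 2) : ℝ := crossInt t (S.pull Q)

end Foliation

end Completion

end Scri

end ScriMaxwell

end

noncomputable section
namespace ScriMaxwell

section FlatCalculus

variable {E : Type*} [NormedAddCommGroup E] [NormedSpace ℝ E]
  {E' : Type*} [NormedAddCommGroup E'] [NormedSpace ℝ E']

variable (E) in
/-- Currying in the first slot, as a continuous linear map. -/
def curryLeftCLM (k : ℕ) : E [⋀^Fin (k + 1)]→L[ℝ] ℝ →L[ℝ] E →L[ℝ] E [⋀^Fin k]→L[ℝ] ℝ :=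
  (ContinuousAlternatingMap.curryLeftLI (𝕜 := ℝ) (E := E) (F := ℝ) (n := k)).toContinuousLinearMap

theorem contDiffOn_curryLeft {k : ℕ} {r : WithTop ℕ∞} {η : E' → E [⋀^Fin (k + 1)]→L[ℝ] ℝ}
    {s : Set E'} (h : ContDiffOn ℝ r η s) : ContDiffOn ℝ r (fun y => (η y).curryLeft) s := by
  have h1 : ContDiff ℝ r (curryLeftCLM E k) := ContinuousLinearMap.contDiff (𝕜 := ℝ)
    (E := E [⋀^Fin (k + 1)]→L[ℝ] ℝ) (F := E →L[ℝ] E [⋀^Fin k]→L[ℝ] ℝ) (curryLeftCLM E k)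
  exact h1.comp_contDiffOn h

theorem contDiffOn_contract {k : ℕ} {r : WithTop ℕ∞} {η : E' → E [⋀^Fin (k + 1)]→L[ℝ] ℝ}
    {V : E' → E} {s : Set E'} (h : ContDiffOn ℝ r η s) (hV : ContDiffOn ℝ r V s) :
    ContDiffOn ℝ r (fun y => (η y).curryLeft (V y)) s :=
  (contDiffOn_curryLeft h).clm_apply hV

/-- Evaluating a smooth form on smooth vector fields gives a smooth function. -/
theorem contDiffOn_eval {k : ℕ} {r : WithTop ℕ∞} {η : E' → E [⋀^Fin k]→L[ℝ] ℝ}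
    {V : Fin k → E' → E} {s : Set E'} (h : ContDiffOn ℝ r η s)
    (hV : ∀ i, ContDiffOn ℝ r (V i) s) : ContDiffOn ℝ r (fun y => η y fun i => V i y) s := by
  induction k with
  | zero =>
    have : ContDiffOn ℝ r
        (fun y => (ContinuousAlternatingMap.constOfIsEmptyLIE ℝ E ℝ (Fin 0)).symm (η y)) s :=
      (ContinuousAlternatingMap.constOfIsEmptyLIE ℝ E ℝ (Fin 0)).symm.contDiff.comp_contDiffOn h
    refine this.congr fun y _ => ?_
    change η y _ = η y _
    congr 1
    exact Subsingleton.elim _ _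
  | succ k ih =>
    refine (ih (contDiffOn_contract h (hV 0)) fun i => hV i.succ).congr fun y _ => ?_
    rw [ContinuousAlternatingMap.curryLeft_apply_apply]
    congr 1
    exact (Fin.cons_self_tail _).symm

/-- A form is smooth as soon as its values on constant vectors are. -/
theorem contDiffOn_of_eval [FiniteDimensional ℝ E] {k : ℕ} {r : WithTop ℕ∞}
    {η : E' → E [⋀^Fin k]→L[ℝ] ℝ} {s : Set E'}
    (h : ∀ v : Fin k → E, ContDiffOn ℝ r (fun y => η y v) s) : ContDiffOn ℝ r η s := by
  induction k with
  | zero =>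
    refine ((ContinuousAlternatingMap.constOfIsEmptyLIE ℝ E ℝ (Fin 0)).contDiff.comp_contDiffOn
      (h 0)).congr fun y _ => ?_
    ext v
    change η y v = η y 0
    congr 1
    exact Subsingleton.elim _ _
  | succ k ih =>
    have h1 : ContDiffOn ℝ r (fun y => (η y).curryLeft) s :=
      contDiffOn_clm_apply.2 fun v => ih fun w => (h (Matrix.vecCons v w)).congr fun y _ => by
        rw [ContinuousAlternatingMap.curryLeft_apply_apply]
    have h2 := ((ContinuousAlternatingMap.alternatizeUncurryFinCLM ℝ E ℝ
      (n := k)).contDiff.comp_contDiffOn h1).const_smul ((k + 1 : ℝ)⁻¹)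
    refine h2.congr fun y _ => ?_
    simp only [Function.comp_apply, ContinuousAlternatingMap.alternatizeUncurryFinCLM_apply,
      ContinuousAlternatingMap.alternatizeUncurryFin_curryLeft]
    have : (k + 1 : ℝ) ≠ 0 := by positivity
    rw [← Nat.cast_smul_eq_nsmul ℝ, smul_smul]
    push_cast
    rw [inv_mul_cancel₀ this, one_smul]

theorem contDiffOn_compContinuousLinearMap [FiniteDimensional ℝ E] {E'' : Type*}
    [NormedAddCommGroup E''] [NormedSpace ℝ E''] {k : ℕ} {r : WithTop ℕ∞}
    {η : E'' → E' [⋀^Fin k]→L[ℝ] ℝ} {f : E'' → E →L[ℝ] E'} {s : Set E''}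
    (h : ContDiffOn ℝ r η s) (hf : ContDiffOn ℝ r f s) :
    ContDiffOn ℝ r (fun y => (η y).compContinuousLinearMap (f y)) s :=
  contDiffOn_of_eval fun v => contDiffOn_eval (V := fun i y => f y (v i)) h
    fun _ => hf.clm_apply contDiffOn_const

theorem contDiffOn_extDerivWithin {k : ℕ} {η : E → E [⋀^Fin k]→L[ℝ] ℝ} {s t : Set E}
    (h : ContDiffOn ℝ ∞ η s) (hs : UniqueDiffOn ℝ s)
    (ht : ∀ y ∈ s, fderivWithin ℝ η t y = fderivWithin ℝ η s y) :
    ContDiffOn ℝ ∞ (extDerivWithin η t) s := by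
  have := (ContinuousAlternatingMap.alternatizeUncurryFinCLM ℝ E ℝ
    (n := k)).contDiff.comp_contDiffOn (h.fderivWithin hs (m := ∞) le_rfl)
  exact this.congr fun y hy => by
    simp only [extDerivWithin, Function.comp_apply, ht y hy]
    rfl

variable {s : Set E} {x : E}

theorem fderivWithin_contract_apply {k : ℕ} {η : E → E [⋀^Fin (k + 1)]→L[ℝ] ℝ} {V : E → E}
    (hη : DifferentiableWithinAt ℝ η s x) (hV : DifferentiableWithinAt ℝ V s x)
    (hs : UniqueDiffWithinAt ℝ s x) (u : E) :
    fderivWithin ℝ (fun y => (η y).curryLeft (V y)) s x u =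
      (fderivWithin ℝ η s x u).curryLeft (V x) + (η x).curryLeft (fderivWithin ℝ V s x u) := by
  have h1 : HasFDerivWithinAt (fun y => (η y).curryLeft)
      ((curryLeftCLM E k).comp (fderivWithin ℝ η s x)) s x := by
    have h2 : HasFDerivAt (curryLeftCLM E k) (curryLeftCLM E k) (η x) :=
      ContinuousLinearMap.hasFDerivAt (𝕜 := ℝ) (E := E [⋀^Fin (k + 1)]→L[ℝ] ℝ)
        (F := E →L[ℝ] E [⋀^Fin k]→L[ℝ] ℝ) (curryLeftCLM E k)
    exact HasFDerivAt.comp_hasFDerivWithinAt (F := E [⋀^Fin (k + 1)]→L[ℝ] ℝ)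
      (G := E →L[ℝ] E [⋀^Fin k]→L[ℝ] ℝ) (g := curryLeftCLM E k) x h2 hη.hasFDerivWithinAt
  rw [(h1.clm_apply hV.hasFDerivWithinAt).fderivWithin hs, add_comm]
  rfl

/-- The coordinate expression of the Lie derivative of a form. -/
theorem cartan_formula {k : ℕ} {η : E → E [⋀^Fin (k + 1)]→L[ℝ] ℝ} {X : E → E}
    (hη : DifferentiableWithinAt ℝ η s x) (hX : DifferentiableWithinAt ℝ X s x)
    (hs : UniqueDiffWithinAt ℝ s x) (v : Fin (k + 1) → E) :
    (extDerivWithin η s x).curryLeft (X x) v +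
        extDerivWithin (fun y => (η y).curryLeft (X y)) s x v =
      fderivWithin ℝ η s x (X x) v +
        ∑ i, η x (Function.update v i (fderivWithin ℝ X s x (v i))) := by
  simp only [extDerivWithin, ContinuousAlternatingMap.curryLeft_apply_apply,
    ContinuousAlternatingMap.alternatizeUncurryFin_apply, fderivWithin_contract_apply hη hX hs]
  rw [Fin.sum_univ_succ, add_assoc]
  simp only [Fin.val_zero, pow_zero, one_smul, Matrix.cons_val_zero, Fin.val_succ]
  have h0 : Fin.removeNth 0 (Matrix.vecCons (X x) v) = v := by
    ext i; rfl
  rw [h0, ← Finset.sum_add_distrib]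
  congr 1
  refine Finset.sum_congr rfl fun i _ => ?_
  have h1 : Fin.removeNth i.succ (Matrix.vecCons (X x) v) =
      Matrix.vecCons (X x) (Fin.removeNth i v) := by
    ext j
    refine Fin.cases ?_ (fun j => ?_) j
    · simp [Fin.removeNth]
    · simp [Fin.removeNth, Fin.succ_succAbove_succ]
  rw [h1]
  simp only [Matrix.cons_val_succ, ContinuousAlternatingMap.add_apply,
    ContinuousAlternatingMap.curryLeft_apply_apply, smul_add]
  have h2 := (η x).map_insertNth i (fderivWithin ℝ X s x (v i)) (i.removeNth v)
  rw [Fin.insertNth_removeNth] at h2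
  rw [h2, ← add_assoc, pow_succ, mul_neg, mul_one, neg_smul, neg_add_cancel, zero_add]

end FlatCalculus

section ManifoldForms

variable {E : Type*} [NormedAddCommGroup E] [NormedSpace ℝ E]
  {H : Type*} [TopologicalSpace H] {I : ModelWithCorners ℝ E H}
  {M : Type*} [TopologicalSpace M] [ChartedSpace H M]
  {E' : Type*} [NormedAddCommGroup E'] [NormedSpace ℝ E']
  {H' : Type*} [TopologicalSpace H'] {I' : ModelWithCorners ℝ E' H'}
  {N : Type*} [TopologicalSpace N] [ChartedSpace H' N]

/-- The value of a form at a point, as a form on the model space. -/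
def formAt {k : ℕ} (η : DForm I M k) (p : M) : E [⋀^Fin k]→L[ℝ] ℝ := η p

/-- The value of a bilinear field at a point, as a bilinear form on the model space. -/
def bilinAt (g : BilinField I M) (p : M) : E →L[ℝ] E →L[ℝ] ℝ := g p

/-- The value of a vector field at a point, as a vector of the model space. -/
def vecAt (X : VField I M) (p : M) : E := X p

variable (I) in
/-- The derivative of the inverse of a chart. -/
def symmD (x₀ : M) (y : E) : E →L[ℝ] E :=
  mfderivWithin 𝓘(ℝ, E) I (extChartAt I x₀).symm (range I) y

variable (I) in
/-- The derivative of a chart. -/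
def chartD (x₀ p : M) : E →L[ℝ] E := mfderiv I 𝓘(ℝ, E) (extChartAt I x₀) p

variable (I I') in
/-- The derivative of a map, as a map between the model spaces. -/
def mapD (f : N → M) (z : N) : E' →L[ℝ] E := mfderiv I' I f z

theorem chartForm_apply {k : ℕ} (η : DForm I M k) (x₀ : M) (y : E) (v : Fin k → E) :
    chartForm I η x₀ y v = formAt η ((extChartAt I x₀).symm y) fun i => symmD I x₀ y (v i) := rfl

theorem chartBilin_apply (g : BilinField I M) (x₀ : M) (y v w : E) :
    chartBilin I g x₀ y v w =
      bilinAt g ((extChartAt I x₀).symm y) (symmD I x₀ y v) (symmD I x₀ y w) := rfl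

theorem chartVField_eq (X : VField I M) (x₀ : M) (y : E) :
    chartVField I X x₀ y = (symmD I x₀ y).inverse (vecAt X ((extChartAt I x₀).symm y)) := rfl

theorem formAt_pullForm_apply {k : ℕ} (η : DForm I M k) (f : N → M) (z : N) (v : Fin k → E') :
    formAt (pullForm I' f η) z v = formAt η (f z) fun i => mapD I I' f z (v i) := rfl

section Charts

variable [IsManifold I 1 M]

theorem symmD_self (x : M) : symmD I x (extChartAt I x x) = ContinuousLinearMap.id ℝ E :=
  mfderivWithin_range_extChartAt_symm

theorem chartD_self (x : M) : chartD I x x = ContinuousLinearMap.id ℝ E := mfderiv_extChartAt_self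

theorem chartForm_self {k : ℕ} (η : DForm I M k) (x : M) :
    chartForm I η x (extChartAt I x x) = formAt η x := by
  ext v
  rw [chartForm_apply, symmD_self, extChartAt_to_inv]
  rfl

theorem chartBilin_self (g : BilinField I M) (x : M) :
    chartBilin I g x (extChartAt I x x) = bilinAt g x := by
  ext v w
  rw [chartBilin_apply, symmD_self, extChartAt_to_inv]
  rfl

theorem chartVField_self (X : VField I M) (x : M) :
    chartVField I X x (extChartAt I x x) = vecAt X x := by
  rw [chartVField_eq, symmD_self, extChartAt_to_inv, ContinuousLinearMap.inverse_id]
  rfl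

theorem formAt_extD {k : ℕ} (η : DForm I M k) (x : M) :
    formAt (extD I η) x = extDerivWithin (chartForm I η x) (range I) (extChartAt I x x) := by
  ext v
  change extDerivWithin (chartForm I η x) (range I) (extChartAt I x x)
    (fun i => chartD I x x (v i)) = _
  rw [chartD_self]
  rfl

theorem symmD_chartD {x₀ p : M} (hp : p ∈ (chartAt H x₀).source) (v : E) :
    symmD I x₀ (extChartAt I x₀ p) (chartD I x₀ p v) = v := by
  have := mfderivWithin_extChartAt_symm_comp_mfderiv_extChartAt' (I := I) (x := x₀) (y := p)
    (by rwa [extChartAt_source])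
  exact congrArg (fun L : E →L[ℝ] E => L v) this

theorem chartD_symmD {x₀ : M} {y : E} (hy : y ∈ (extChartAt I x₀).target) (v : E) :
    chartD I x₀ ((extChartAt I x₀).symm y) (symmD I x₀ y v) = v := by
  have := mfderiv_extChartAt_comp_mfderivWithin_extChartAt_symm (I := I) hy
  exact congrArg (fun L : E →L[ℝ] E => L v) this

end Charts

section Pullback

variable [IsManifold I 1 M] [IsManifold I' 1 N]

/-- The derivative of the coordinate expression of a map. -/
theorem fderivWithin_chart_map {f : N → M} {x₀ : M} {z₀ : N} {y : E'}
    (hy : y ∈ (extChartAt I' z₀).target)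
    (hf : MDifferentiableAt I' I f ((extChartAt I' z₀).symm y))
    (hx : f ((extChartAt I' z₀).symm y) ∈ (chartAt H x₀).source) (v : E') :
    fderivWithin ℝ (extChartAt I x₀ ∘ f ∘ (extChartAt I' z₀).symm) (range I') y v =
      chartD I x₀ (f ((extChartAt I' z₀).symm y))
        (mapD I I' f ((extChartAt I' z₀).symm y) (symmD I' z₀ y v)) := by
  have hU : UniqueMDiffWithinAt 𝓘(ℝ, E') (range I') y :=
    I'.uniqueMDiffOn y (extChartAt_target_subset_range z₀ hy)
  have h1 := mdifferentiableWithinAt_extChartAt_symm (I := I') hy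
  have h2 := (mdifferentiableAt_extChartAt (I := I) hx)
  have e1 := mfderiv_comp_mfderivWithin (I := 𝓘(ℝ, E')) (I' := I') (I'' := I) y hf h1 hU
  have e2 := mfderiv_comp_mfderivWithin (I := 𝓘(ℝ, E')) (I' := I) (I'' := 𝓘(ℝ, E)) y
    (g := extChartAt I x₀) (f := f ∘ (extChartAt I' z₀).symm) h2
    (hf.comp_mdifferentiableWithinAt y h1) hU
  rw [← mfderivWithin_eq_fderivWithin, e2, e1]
  rfl

theorem chartForm_pullForm {k : ℕ} (η : DForm I M k) {f : N → M} {x₀ : M} {z₀ : N} {y : E'}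
    (hy : y ∈ (extChartAt I' z₀).target)
    (hf : MDifferentiableAt I' I f ((extChartAt I' z₀).symm y))
    (hx : f ((extChartAt I' z₀).symm y) ∈ (chartAt H x₀).source) :
    chartForm I' (pullForm I' f η) z₀ y =
      (chartForm I η x₀ ((extChartAt I x₀ ∘ f ∘ (extChartAt I' z₀).symm) y)).compContinuousLinearMap
        (fderivWithin ℝ (extChartAt I x₀ ∘ f ∘ (extChartAt I' z₀).symm) (range I') y) := by
  ext v
  have h3 : (extChartAt I x₀).symm ((extChartAt I x₀ ∘ f ∘ (extChartAt I' z₀).symm) y) =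
      f ((extChartAt I' z₀).symm y) := (extChartAt I x₀).left_inv (by rwa [extChartAt_source])
  rw [ContinuousAlternatingMap.compContinuousLinearMap_apply, chartForm_apply, chartForm_apply, h3,
    formAt_pullForm_apply]
  refine congrArg _ (funext fun i => ?_)
  exact (symmD_chartD hx _).symm.trans
    (congrArg _ (fderivWithin_chart_map (x₀ := x₀) hy hf hx (v i)).symm)

end Pullback

section Naturality

theorem chart_map_nhds {f : N → M} (hf : Continuous f) {x₀ : M} {z₀ : N} {y : E'}
    (hy : y ∈ (extChartAt I' z₀).target)
    (hx : f ((extChartAt I' z₀).symm y) ∈ (chartAt H x₀).source) :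
    (extChartAt I' z₀).target ∩ (extChartAt I' z₀).symm ⁻¹' (f ⁻¹' (extChartAt I x₀).source) ∈
      𝓝[range I'] y := by
  refine inter_mem (extChartAt_target_mem_nhdsWithin_of_mem hy) ?_
  have h1 : ContinuousWithinAt (extChartAt I' z₀).symm (range I') y :=
    (continuousAt_extChartAt_symm'' hy).continuousWithinAt
  refine h1 ((hf.continuousAt).preimage_mem_nhds ?_)
  exact (isOpen_extChartAt_source x₀).mem_nhds (by rwa [extChartAt_source])

theorem SmoothForm.contDiffWithinAt {k : ℕ} {η : DForm I M k} (h : SmoothForm I η) {x₀ : M} {y : E}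
    (hy : y ∈ (extChartAt I x₀).target) :
    ContDiffWithinAt ℝ ∞ (chartForm I η x₀) (range I) y :=
  (h x₀ y hy).mono_of_mem_nhdsWithin (extChartAt_target_mem_nhdsWithin_of_mem hy)

variable [IsManifold I ∞ M] [IsManifold I' ∞ N]

theorem contDiffWithinAt_chart_map {f : N → M} (hf : ContMDiff I' I ∞ f) {x₀ : M} {z₀ : N} {y : E'}
    (hy : y ∈ (extChartAt I' z₀).target)
    (hx : f ((extChartAt I' z₀).symm y) ∈ (chartAt H x₀).source) :
    ContDiffWithinAt ℝ ∞ (extChartAt I x₀ ∘ f ∘ (extChartAt I' z₀).symm) (range I') y := by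
  have h := (contMDiff_iff.1 hf).2 z₀ x₀ y ⟨hy, by
    simpa only [mem_preimage, extChartAt_source] using hx⟩
  exact h.mono_of_mem_nhdsWithin (chart_map_nhds hf.continuous hy hx)

theorem extDerivWithin_chart_pullForm {k : ℕ} {η : DForm I M k} (hη : SmoothForm I η) {f : N → M}
    (hf : ContMDiff I' I ∞ f) {x₀ : M} {z₀ : N} {y : E'} (hy : y ∈ (extChartAt I' z₀).target)
    (hx : f ((extChartAt I' z₀).symm y) ∈ (chartAt H x₀).source) :
    extDerivWithin (chartForm I' (pullForm I' f η) z₀) (range I') y =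
      (extDerivWithin (chartForm I η x₀) (range I)
        ((extChartAt I x₀ ∘ f ∘ (extChartAt I' z₀).symm) y)).compContinuousLinearMap
        (fderivWithin ℝ (extChartAt I x₀ ∘ f ∘ (extChartAt I' z₀).symm) (range I') y) := by
  have hyr := extChartAt_target_subset_range z₀ hy
  have hmd : MDifferentiable I' I f := hf.mdifferentiable (by simp)
  have hev : chartForm I' (pullForm I' f η) z₀ =ᶠ[𝓝[range I'] y] fun y' =>
      (chartForm I η x₀ ((extChartAt I x₀ ∘ f ∘ (extChartAt I' z₀).symm) y')).compContinuousLinearMap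
        (fderivWithin ℝ (extChartAt I x₀ ∘ f ∘ (extChartAt I' z₀).symm) (range I') y') := by
    filter_upwards [chart_map_nhds (I := I) hf.continuous hy hx] with y' hy'
    exact chartForm_pullForm η hy'.1 (hmd _) (by simpa only [mem_preimage, extChartAt_source] using hy'.2)
  rw [hev.extDerivWithin_eq_of_mem hyr]
  have hq : extChartAt I x₀ (f ((extChartAt I' z₀).symm y)) ∈ (extChartAt I x₀).target :=
    (extChartAt I x₀).map_source (by rwa [extChartAt_source])
  refine extDerivWithin_pullback (r := ∞) ?_ (contDiffWithinAt_chart_map hf hy hx) ?_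
    I'.uniqueDiffOn ?_ hyr ?_
  · exact (hη.contDiffWithinAt hq).differentiableWithinAt (by simp)
  · rw [minSmoothness_of_isRCLikeNormedField]
    exact ENat.LEInfty.out
  · exact I'.range_subset_closure_interior hyr
  · exact fun _ _ => mem_range_self _

/-- The exterior derivative commutes with pullbacks. -/
theorem extD_pullForm {k : ℕ} {η : DForm I M k} (hη : SmoothForm I η) {f : N → M}
    (hf : ContMDiff I' I ∞ f) : extD I' (pullForm I' f η) = pullForm I' f (extD I η) := by
  funext z
  change formAt (extD I' (pullForm I' f η)) z = formAt (pullForm I' f (extD I η)) z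
  have hz : (extChartAt I' z).symm (extChartAt I' z z) = z := extChartAt_to_inv z
  have hy := mem_extChartAt_target (I := I') z
  have hx : f ((extChartAt I' z).symm (extChartAt I' z z)) ∈ (chartAt H (f z)).source := by
    rw [hz]; exact mem_chart_source H (f z)
  ext v
  rw [formAt_pullForm_apply, formAt_extD, formAt_extD, extDerivWithin_chart_pullForm hη hf hy hx,
    ContinuousAlternatingMap.compContinuousLinearMap_apply, Function.comp_apply,
    Function.comp_apply, hz]
  refine congrArg _ (funext fun i => ?_)
  rw [Function.comp_apply, fderivWithin_chart_map hy (hf.mdifferentiable (by simp) _) hx,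
    symmD_self, hz, chartD_self]
  rfl

/-- The exterior derivative can be computed in any chart. -/
theorem chartForm_extD {k : ℕ} {η : DForm I M k} (hη : SmoothForm I η) {x₀ : M} {y : E}
    (hy : y ∈ (extChartAt I x₀).target) :
    chartForm I (extD I η) x₀ y = extDerivWithin (chartForm I η x₀) (range I) y := by
  obtain ⟨p, hp⟩ : ∃ p, p = (extChartAt I x₀).symm y := ⟨_, rfl⟩
  have hps : p ∈ (chartAt H x₀).source := by
    rw [← extChartAt_source I, hp]; exact (extChartAt I x₀).map_target hy
  have hφ : extChartAt I x₀ p = y := by rw [hp]; exact (extChartAt I x₀).right_inv hy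
  have hid : pullForm I (id : M → M) η = η := by
    funext z
    rw [pullForm, mfderiv_id]
    rfl
  have hz : (extChartAt I p).symm (extChartAt I p p) = p := extChartAt_to_inv p
  have hx : id ((extChartAt I p).symm (extChartAt I p p)) ∈ (chartAt H x₀).source := by
    rw [hz]; exact hps
  have hyp := mem_extChartAt_target (I := I) p
  have key := extDerivWithin_chart_pullForm hη (contMDiff_id (I := I) (M := M)) (x₀ := x₀) hyp hx
  rw [hid] at key
  have hD : mapD I I (id : M → M) p = ContinuousLinearMap.id ℝ E := mfderiv_id
  ext v
  rw [chartForm_apply, ← hp, formAt_extD, key,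
    ContinuousAlternatingMap.compContinuousLinearMap_apply, Function.comp_apply,
    Function.comp_apply, hz, id, hφ]
  refine congrArg _ (funext fun i => ?_)
  rw [Function.comp_apply, fderivWithin_chart_map hyp mdifferentiableAt_id hx, symmD_self, hz, hD,
    id]
  exact (congrArg (fun q => chartD I x₀ q (symmD I x₀ y (v i))) hp).trans (chartD_symmD hy (v i))

theorem SmoothForm.extD {k : ℕ} {η : DForm I M k} (hη : SmoothForm I η) :
    SmoothForm I (extD I η) := fun x₀ => by
  have hU : UniqueDiffOn ℝ (extChartAt I x₀).target := uniqueDiffOn_extChartAt_target x₀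
  refine (contDiffOn_extDerivWithin (hη x₀) hU (t := range I) fun y hy => ?_).congr
    fun y hy => chartForm_extD hη hy
  exact (fderivWithin_of_mem_nhdsWithin (extChartAt_target_mem_nhdsWithin_of_mem hy)
    (I.uniqueDiffOn y (extChartAt_target_subset_range x₀ hy))
    ((hη x₀ y hy).differentiableWithinAt (by simp)))

theorem SmoothForm.pullForm [FiniteDimensional ℝ E'] {k : ℕ} {η : DForm I M k}
    (hη : SmoothForm I η) {f : N → M} (hf : ContMDiff I' I ∞ f) :
    SmoothForm I' (pullForm I' f η) := fun z₀ y hy => by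
  set x₀ := f ((extChartAt I' z₀).symm y)
  have hx : f ((extChartAt I' z₀).symm y) ∈ (chartAt H x₀).source := mem_chart_source H x₀
  set U := (extChartAt I' z₀).target ∩ (extChartAt I' z₀).symm ⁻¹' (f ⁻¹' (extChartAt I x₀).source)
  have hmem (y' : E') (hy' : y' ∈ U) : f ((extChartAt I' z₀).symm y') ∈ (chartAt H x₀).source := by
    simpa only [mem_preimage, extChartAt_source] using hy'.2
  have hτ : ContDiffOn ℝ ∞ (extChartAt I x₀ ∘ f ∘ (extChartAt I' z₀).symm) U :=
    fun y' hy' => (contDiffWithinAt_chart_map hf hy'.1 (hmem y' hy')).mono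
      fun _ h => extChartAt_target_subset_range z₀ h.1
  have hdτ : ContDiffOn ℝ ∞
      (fderivWithin ℝ (extChartAt I x₀ ∘ f ∘ (extChartAt I' z₀).symm) (range I')) U :=
    fun y' hy' => ((contDiffWithinAt_chart_map hf hy'.1 (hmem y' hy')).fderivWithin_right
      (m := ∞) I'.uniqueDiffOn le_rfl (extChartAt_target_subset_range z₀ hy'.1)).mono
      fun _ h => extChartAt_target_subset_range z₀ h.1
  have h1 : ContDiffOn ℝ ∞ (fun y' => chartForm I η x₀
      ((extChartAt I x₀ ∘ f ∘ (extChartAt I' z₀).symm) y')) U :=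
    (hη x₀).comp hτ fun y' hy' => (extChartAt I x₀).map_source hy'.2
  have h2 := contDiffOn_compContinuousLinearMap h1 hdτ
  have h3 : ContDiffOn ℝ ∞ (chartForm I' (ScriMaxwell.pullForm I' f η) z₀) U := h2.congr
    fun y' hy' => chartForm_pullForm η hy'.1 (hf.mdifferentiable (by simp) _) (hmem y' hy')
  have hyU : y ∈ U := ⟨hy, by simpa only [mem_preimage, extChartAt_source] using hx⟩
  refine (h3 y hyU).mono_of_mem_nhdsWithin ?_
  exact nhdsWithin_mono y (extChartAt_target_subset_range z₀)
    (chart_map_nhds (I := I) hf.continuous hy hx)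

end Naturality

end ManifoldForms

section SmoothFields

variable {E : Type*} [NormedAddCommGroup E] [NormedSpace ℝ E]
  {H : Type*} [TopologicalSpace H] {I : ModelWithCorners ℝ E H}
  {M : Type*} [TopologicalSpace M] [ChartedSpace H M]

/-- The covector underlying a `1`-form on a normed space. -/
def flatCov (α : E [⋀^Fin 1]→L[ℝ] ℝ) : E →L[ℝ] ℝ :=
  (ContinuousAlternatingMap.ofSubsingleton ℝ E ℝ (0 : Fin 1)).symm α

theorem flatCov_apply (α : E [⋀^Fin 1]→L[ℝ] ℝ) (v : E) : flatCov α v = α ![v] := by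
  change α (fun _ => v) = α ![v]
  congr 1
  ext i
  fin_cases i
  rfl

theorem formAt_contract {k : ℕ} (X : VField I M) (η : DForm I M (k + 1)) (x : M) :
    formAt (fun x => contract (X x) (η x)) x = (formAt η x).curryLeft (vecAt X x) := rfl

theorem chartForm_contract [IsManifold I 1 M] {k : ℕ} (X : VField I M) (η : DForm I M (k + 1))
    {x₀ : M} {y : E} (hy : y ∈ (extChartAt I x₀).target) :
    chartForm I (fun x => contract (X x) (η x)) x₀ y =
      (chartForm I η x₀ y).curryLeft (chartVField I X x₀ y) := by
  have hinv : (symmD I x₀ y).IsInvertible := isInvertible_mfderivWithin_extChartAt_symm hy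
  have hX : symmD I x₀ y (chartVField I X x₀ y) = vecAt X ((extChartAt I x₀).symm y) := by
    rw [chartVField_eq]; exact hinv.self_apply_inverse _
  ext v
  rw [chartForm_apply, formAt_contract, ContinuousAlternatingMap.curryLeft_apply_apply,
    ContinuousAlternatingMap.curryLeft_apply_apply, chartForm_apply, ← hX]
  refine congrArg _ (funext fun i => ?_)
  refine Fin.cases rfl (fun j => rfl) i

theorem SmoothForm.contract [IsManifold I 1 M] {k : ℕ} {X : VField I M} {η : DForm I M (k + 1)}
    (hη : SmoothForm I η) (hX : SmoothVField I X) :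
    SmoothForm I (fun x => contract (X x) (η x)) := fun x₀ =>
  (contDiffOn_contract (hη x₀) (hX x₀)).congr fun _ hy => chartForm_contract X η hy

theorem SmoothForm.add {k : ℕ} {η ζ : DForm I M k} (hη : SmoothForm I η) (hζ : SmoothForm I ζ) :
    SmoothForm I (fun x => η x + ζ x) := fun x₀ => (hη x₀).add (hζ x₀)

theorem contDiffOn_chart_fun [IsManifold I ∞ M] {f : M → ℝ} (hf : ContMDiff I 𝓘(ℝ, ℝ) ∞ f)
    (x₀ : M) : ContDiffOn ℝ ∞ (f ∘ (extChartAt I x₀).symm) (extChartAt I x₀).target :=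
  contMDiffOn_iff_contDiffOn.1 (hf.comp_contMDiffOn (contMDiffOn_extChartAt_symm x₀))

theorem SmoothForm.fsmul [IsManifold I ∞ M] {k : ℕ} {f : M → ℝ} {η : DForm I M k}
    (hη : SmoothForm I η) (hf : ContMDiff I 𝓘(ℝ, ℝ) ∞ f) : SmoothForm I (fun x => f x • η x) :=
  fun x₀ => ContDiffOn.smul (contDiffOn_chart_fun hf x₀) (hη x₀)

theorem SmoothForm.const_smul {k : ℕ} {η : DForm I M k} (hη : SmoothForm I η) (c : ℝ) :
    SmoothForm I (fun x => c • η x) := fun x₀ => ContDiffOn.const_smul c (hη x₀)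

theorem SmoothForm.neg {k : ℕ} {η : DForm I M k} (hη : SmoothForm I η) :
    SmoothForm I (fun x => -η x) := fun x₀ => ContDiffOn.neg (hη x₀)

theorem SmoothForm.sub {k : ℕ} {η ζ : DForm I M k} (hη : SmoothForm I η) (hζ : SmoothForm I ζ) :
    SmoothForm I (fun x => η x - ζ x) := fun x₀ => (hη x₀).sub (hζ x₀)

theorem chartVField_fsmul (f : M → ℝ) (X : VField I M) (x₀ : M) (y : E) :
    chartVField I (fun x => f x • X x) x₀ y =
      (f ∘ (extChartAt I x₀).symm) y • chartVField I X x₀ y := by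
  simp only [chartVField_eq, ← map_smul]
  rfl

theorem SmoothVField.contDiffWithinAt {X : VField I M} (h : SmoothVField I X) {x₀ : M} {y : E}
    (hy : y ∈ (extChartAt I x₀).target) :
    ContDiffWithinAt ℝ ∞ (chartVField I X x₀) (range I) y :=
  (h x₀ y hy).mono_of_mem_nhdsWithin (extChartAt_target_mem_nhdsWithin_of_mem hy)

theorem SmoothBilin.contDiffWithinAt {g : BilinField I M} (h : SmoothBilin I g) {x₀ : M} {y : E}
    (hy : y ∈ (extChartAt I x₀).target) :
    ContDiffWithinAt ℝ ∞ (chartBilin I g x₀) (range I) y :=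
  (h x₀ y hy).mono_of_mem_nhdsWithin (extChartAt_target_mem_nhdsWithin_of_mem hy)

theorem contDiffWithinAt_chart_fun [IsManifold I ∞ M] {f : M → ℝ} (hf : ContMDiff I 𝓘(ℝ, ℝ) ∞ f)
    {x₀ : M} {y : E} (hy : y ∈ (extChartAt I x₀).target) :
    ContDiffWithinAt ℝ ∞ (f ∘ (extChartAt I x₀).symm) (range I) y :=
  (contDiffOn_chart_fun hf x₀ y hy).mono_of_mem_nhdsWithin
    (extChartAt_target_mem_nhdsWithin_of_mem hy)

/-- The differential of a function at a point, as a covector on the model space. -/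
def dAt (I : ModelWithCorners ℝ E H) (f : M → ℝ) (x : M) : E →L[ℝ] ℝ := dFun I f x

theorem fderivWithin_chart_fun [IsManifold I 1 M] {f : M → ℝ} {x₀ : M} {y : E}
    (hy : y ∈ (extChartAt I x₀).target)
    (hf : MDifferentiableAt I 𝓘(ℝ, ℝ) f ((extChartAt I x₀).symm y)) (v : E) :
    fderivWithin ℝ (f ∘ (extChartAt I x₀).symm) (range I) y v =
      dAt I f ((extChartAt I x₀).symm y) (symmD I x₀ y v) := by
  have hU : UniqueMDiffWithinAt 𝓘(ℝ, E) (range I) y :=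
    I.uniqueMDiffOn y (extChartAt_target_subset_range x₀ hy)
  have h1 := mdifferentiableWithinAt_extChartAt_symm (I := I) hy
  have e1 := mfderiv_comp_mfderivWithin (I := 𝓘(ℝ, E)) (I' := I) (I'' := 𝓘(ℝ, ℝ)) y hf h1 hU
  rw [← mfderivWithin_eq_fderivWithin, e1]
  rfl

theorem dAt_eq [IsManifold I 1 M] {f : M → ℝ} {x : M} (hf : MDifferentiableAt I 𝓘(ℝ, ℝ) f x) :
    dAt I f x = fderivWithin ℝ (f ∘ (extChartAt I x).symm) (range I) (extChartAt I x x) := by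
  ext v
  rw [fderivWithin_chart_fun (mem_extChartAt_target x) (by rwa [extChartAt_to_inv]), symmD_self,
    extChartAt_to_inv]
  rfl

theorem chartForm_dFun [IsManifold I 1 M] {f : M → ℝ} (hf : MDifferentiable I 𝓘(ℝ, ℝ) f)
    {x₀ : M} {y : E} (hy : y ∈ (extChartAt I x₀).target) :
    chartForm I (fun x => oneForm (dFun I f x)) x₀ y =
      ContinuousAlternatingMap.ofSubsingleton ℝ E ℝ (0 : Fin 1)
        (fderivWithin ℝ (f ∘ (extChartAt I x₀).symm) (range I) y) := by
  ext v
  exact (fderivWithin_chart_fun hy (hf _) (v 0)).symm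

theorem SmoothForm.dFun [IsManifold I ∞ M] {f : M → ℝ} (hf : ContMDiff I 𝓘(ℝ, ℝ) ∞ f) :
    SmoothForm I (fun x => oneForm (dFun I f x)) := fun x₀ => by
  have h : ContDiffOn ℝ ∞ (fderivWithin ℝ (f ∘ (extChartAt I x₀).symm) (range I))
      (extChartAt I x₀).target := fun y hy =>
    ((contDiffWithinAt_chart_fun hf hy).fderivWithin_right (m := ∞) I.uniqueDiffOn le_rfl
      (extChartAt_target_subset_range x₀ hy)).mono (extChartAt_target_subset_range x₀)
  have h2 := ((ContinuousAlternatingMap.ofSubsingletonLIE (𝕜 := ℝ) (E := E) (F := ℝ)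
    (0 : Fin 1)).contDiff (n := ∞)).comp_contDiffOn h
  exact h2.congr fun y hy => chartForm_dFun (hf.mdifferentiable (by simp)) hy

theorem SmoothForm.lieForm [IsManifold I ∞ M] {k : ℕ} {X : VField I M} {η : DForm I M (k + 1)}
    (hη : SmoothForm I η) (hX : SmoothVField I X) : SmoothForm I (lieForm X η) :=
  (hη.extD.contract hX).add (hη.contract hX).extD

section Metric

theorem chartBilin_isInvertible [IsManifold I 1 M] {g : BilinField I M}
    (hg : ∀ x, (bilinAt g x).IsInvertible) {x₀ : M} {y : E}
    (hy : y ∈ (extChartAt I x₀).target) : (chartBilin I g x₀ y).IsInvertible := by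
  obtain ⟨D, hD⟩ : (symmD I x₀ y).IsInvertible := isInvertible_mfderivWithin_extChartAt_symm hy
  obtain ⟨G, hG⟩ := hg ((extChartAt I x₀).symm y)
  refine ⟨(D.trans G).trans (D.symm.arrowCongr (ContinuousLinearEquiv.refl ℝ ℝ)), ?_⟩
  ext v w
  rw [chartBilin_apply, ← hG, ← hD]
  simp

theorem inverse_bilin_comp {G : E →L[ℝ] E →L[ℝ] ℝ} (hG : G.IsInvertible)
    {G' : E →L[ℝ] E →L[ℝ] ℝ} (hG' : G'.IsInvertible) {D : E →L[ℝ] E} (hD : D.IsInvertible)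
    (h : ∀ v w, G' v w = G (D v) (D w)) (α : E →L[ℝ] ℝ) :
    G'.inverse (α.comp D) = D.inverse (G.inverse α) := by
  have h1 : G' (D.inverse (G.inverse α)) = α.comp D := by
    ext w
    rw [h, hD.self_apply_inverse, hG.self_apply_inverse]
    rfl
  rw [← h1, hG'.inverse_apply_self]

theorem chartVField_sharp [IsManifold I 1 M] {g : BilinField I M}
    (hg : ∀ x, (bilinAt g x).IsInvertible) (α : DForm I M 1) {x₀ : M} {y : E}
    (hy : y ∈ (extChartAt I x₀).target) :
    chartVField I (fun x => sharp g x (covector (α x))) x₀ y =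
      (chartBilin I g x₀ y).inverse (flatCov (chartForm I α x₀ y)) := by
  have hinv : (symmD I x₀ y).IsInvertible := isInvertible_mfderivWithin_extChartAt_symm hy
  exact (inverse_bilin_comp (hg _) (chartBilin_isInvertible hg hy) hinv
    (fun v w => chartBilin_apply g x₀ y v w) (flatCov (formAt α ((extChartAt I x₀).symm y)))).symm

variable [FiniteDimensional ℝ E]

theorem contDiffOn_flatCov {E' : Type*} [NormedAddCommGroup E'] [NormedSpace ℝ E']
    {r : WithTop ℕ∞} {α : E' → E [⋀^Fin 1]→L[ℝ] ℝ} {s : Set E'} (h : ContDiffOn ℝ r α s) :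
    ContDiffOn ℝ r (fun y => flatCov (α y)) s :=
  contDiffOn_clm_apply.2 fun v => (contDiffOn_eval (V := fun _ _ => v) h
    fun _ => contDiffOn_const).congr fun _ _ => rfl

theorem contDiffOn_inverse {E' : Type*} [NormedAddCommGroup E'] [NormedSpace ℝ E']
    {G : E' → E →L[ℝ] E →L[ℝ] ℝ} {s : Set E'} (h : ContDiffOn ℝ ∞ G s)
    (hG : ∀ y ∈ s, (G y).IsInvertible) : ContDiffOn ℝ ∞ (fun y => (G y).inverse) s :=
  fun y hy => by
    have : CompleteSpace E := FiniteDimensional.complete ℝ E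
    exact (hG y hy).contDiffAt_map_inverse.comp_contDiffWithinAt y (h y hy)

theorem SmoothVField.sharp [IsManifold I 1 M] {g : BilinField I M} (hgs : SmoothBilin I g)
    (hg : ∀ x, (bilinAt g x).IsInvertible) {α : DForm I M 1} (hα : SmoothForm I α) :
    SmoothVField I (fun x => sharp g x (covector (α x))) := fun x₀ =>
  ((contDiffOn_inverse (hgs x₀) fun _ hy => chartBilin_isInvertible hg hy).clm_apply
    (contDiffOn_flatCov (hα x₀))).congr fun _ hy => chartVField_sharp hg α hy

end Metric

end SmoothFields

section PointwiseAlgebra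

/-- The standard basis vectors of the model space. -/
def stdVec (i : Fin 4) : E4 := EuclideanSpace.single i (1 : ℝ)

/-- The dual standard basis of the model space. -/
def stdCov (i : Fin 4) : E4 →L[ℝ] ℝ := EuclideanSpace.proj i

theorem sum_stdCov_smul (v : E4) : ∑ i, stdCov i v • stdVec i = v := by
  ext j
  simp [stdCov, stdVec, Pi.single_apply]

theorem sum_apply_smul_stdCov (α : E4 →L[ℝ] ℝ) : ∑ i, α (stdVec i) • stdCov i = α := by
  ext v
  conv_rhs => rw [← sum_stdCov_smul v]
  simp [mul_comm]

/-- The full contraction of a bilinear map with the identity does not depend on the basis. -/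
theorem sum_frame_equiv {W : Type*} [AddCommGroup W] [Module ℝ W]
    (B : E4 →ₗ[ℝ] (E4 →L[ℝ] ℝ) →ₗ[ℝ] W) (D : E4 ≃L[ℝ] E4) :
    ∑ i, B (D (stdVec i)) ((stdCov i).comp (D.symm : E4 →L[ℝ] E4)) =
      ∑ i, B (stdVec i) (stdCov i) := by
  have h1 (i : Fin 4) : B (D (stdVec i)) ((stdCov i).comp (D.symm : E4 →L[ℝ] E4)) =
      ∑ j, B (stdVec j) (stdCov j (D (stdVec i)) • (stdCov i).comp (D.symm : E4 →L[ℝ] E4)) := by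
    conv_lhs => rw [← sum_stdCov_smul (D (stdVec i))]
    simp
  simp_rw [h1]
  rw [Finset.sum_comm]
  refine Finset.sum_congr rfl fun j _ => ?_
  rw [← map_sum]
  congr 1
  have h2 := sum_apply_smul_stdCov ((stdCov j).comp (D : E4 →L[ℝ] E4))
  ext v
  have h3 := congrArg (fun L : E4 →L[ℝ] ℝ => L (D.symm v)) h2
  simpa using h3

theorem isInvertible_of_nondegenerate {E : Type*} [NormedAddCommGroup E] [NormedSpace ℝ E]
    [FiniteDimensional ℝ E] {G : E →L[ℝ] E →L[ℝ] ℝ}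
    (h : ∀ v, (∀ w, G v w = 0) → v = 0) : G.IsInvertible := by
  let L : E →ₗ[ℝ] Module.Dual ℝ E := (ContinuousLinearMap.coeLM ℝ).comp (G : E →ₗ[ℝ] E →L[ℝ] ℝ)
  have hL : Function.Injective L := by
    rw [← LinearMap.ker_eq_bot, LinearMap.ker_eq_bot']
    intro v hv
    exact h v fun w => congrArg (fun l : Module.Dual ℝ E => l w) hv
  have hs : Function.Surjective L := by
    refine (LinearMap.injective_iff_surjective_of_finrank_eq_finrank ?_).1 hL
    exact (Subspace.dual_finrank_eq).symm
  have hGi : Function.Injective (G : E →ₗ[ℝ] E →L[ℝ] ℝ) := fun v w hvw => hL (by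
    change (ContinuousLinearMap.coeLM ℝ) ((G : E →ₗ[ℝ] E →L[ℝ] ℝ) v) = _
    rw [hvw]; rfl)
  have hGs : Function.Surjective (G : E →ₗ[ℝ] E →L[ℝ] ℝ) := fun α => by
    obtain ⟨v, hv⟩ := hs (α : E →ₗ[ℝ] ℝ)
    exact ⟨v, ContinuousLinearMap.coe_injective hv⟩
  refine ⟨(LinearEquiv.ofBijective (G : E →ₗ[ℝ] E →L[ℝ] ℝ) ⟨hGi, hGs⟩).toContinuousLinearEquiv, ?_⟩
  ext v w
  rfl

/-- `F^{ab} β_b` at a point. -/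
def raiseP (G : E4 →L[ℝ] E4 →L[ℝ] ℝ) (F : E4 [⋀^Fin 2]→L[ℝ] ℝ) (β : E4 →L[ℝ] ℝ) : E4 :=
  G.inverse (flatCov (-F.curryLeft (G.inverse β)))

/-- `½ ε_{cdab} F^{cd}` at a point. -/
def hodgeP (G : E4 →L[ℝ] E4 →L[ℝ] ℝ) (ε : E4 [⋀^Fin 4]→L[ℝ] ℝ) (F : E4 [⋀^Fin 2]→L[ℝ] ℝ) :
    E4 [⋀^Fin 2]→L[ℝ] ℝ :=
  (1 / 2 : ℝ) • ∑ i : Fin 4, (ε.curryLeft (stdVec i)).curryLeft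
    (G.inverse (flatCov (F.curryLeft (G.inverse (stdCov i)))))

/-- `F_{ab} F^{ab}` at a point. -/
def sqP (G : E4 →L[ℝ] E4 →L[ℝ] ℝ) (F : E4 [⋀^Fin 2]→L[ℝ] ℝ) : ℝ :=
  ∑ i : Fin 4, ∑ j : Fin 4, F ![stdVec i, stdVec j] *
    F ![G.inverse (stdCov i), G.inverse (stdCov j)]

theorem inverse_comp_symm {G G' : E4 →L[ℝ] E4 →L[ℝ] ℝ} (hG : G.IsInvertible)
    (hG' : G'.IsInvertible) (D : E4 ≃L[ℝ] E4) (h : ∀ v w, G' v w = G (D v) (D w))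
    (α : E4 →L[ℝ] ℝ) :
    G'.inverse α = D.symm (G.inverse (α.comp (D.symm : E4 →L[ℝ] E4))) := by
  have := inverse_bilin_comp hG hG' (D := (D : E4 →L[ℝ] E4)) ⟨D, rfl⟩ h
    (α.comp (D.symm : E4 →L[ℝ] E4))
  rw [ContinuousLinearMap.inverse_equiv] at this
  have h2 : (α.comp (D.symm : E4 →L[ℝ] E4)).comp (D : E4 →L[ℝ] E4) = α := by ext v; simp
  rw [h2] at this
  exact this

theorem flatCov_add (α β : E4 [⋀^Fin 1]→L[ℝ] ℝ) : flatCov (α + β) = flatCov α + flatCov β := rfl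
theorem flatCov_smul (c : ℝ) (α : E4 [⋀^Fin 1]→L[ℝ] ℝ) : flatCov (c • α) = c • flatCov α := rfl
theorem flatCov_neg (α : E4 [⋀^Fin 1]→L[ℝ] ℝ) : flatCov (-α) = -flatCov α := rfl

theorem hodgeP_comp {G G' : E4 →L[ℝ] E4 →L[ℝ] ℝ} (hG : G.IsInvertible)
    (hG' : G'.IsInvertible) (D : E4 ≃L[ℝ] E4) (h : ∀ v w, G' v w = G (D v) (D w))
    (ε : E4 [⋀^Fin 4]→L[ℝ] ℝ) (F : E4 [⋀^Fin 2]→L[ℝ] ℝ) :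
    hodgeP G' (ε.compContinuousLinearMap (D : E4 →L[ℝ] E4))
      (F.compContinuousLinearMap (D : E4 →L[ℝ] E4)) =
      (hodgeP G ε F).compContinuousLinearMap (D : E4 →L[ℝ] E4) := by
  ext v
  let B : E4 →ₗ[ℝ] (E4 →L[ℝ] ℝ) →ₗ[ℝ] ℝ := LinearMap.mk₂ ℝ
    (fun u γ => (ε.curryLeft u).curryLeft (G.inverse (flatCov (F.curryLeft (G.inverse γ))))
      (fun i => D (v i)))
    (fun u u' γ => by simp) (fun c u γ => by simp)
    (fun u γ γ' => by simp [flatCov_add]) (fun c u γ => by simp [flatCov_smul])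
  have key := sum_frame_equiv B D
  simp only [hodgeP, ContinuousAlternatingMap.smul_apply, ContinuousAlternatingMap.sum_apply,
    ContinuousAlternatingMap.compContinuousLinearMap_apply]
  congr 1
  refine Eq.trans ?_ key
  refine Finset.sum_congr rfl fun i _ => ?_
  change _ = (ε.curryLeft (D (stdVec i))).curryLeft (G.inverse (flatCov (F.curryLeft (G.inverse
    ((stdCov i).comp (D.symm : E4 →L[ℝ] E4)))))) fun i => D (v i)
  rw [inverse_comp_symm hG hG' D h, inverse_comp_symm hG hG' D h (stdCov i)]
  set u := G.inverse ((stdCov i).comp (D.symm : E4 →L[ℝ] E4))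
  have h1 : (flatCov ((F.compContinuousLinearMap (D : E4 →L[ℝ] E4)).curryLeft (D.symm u))).comp
      (D.symm : E4 →L[ℝ] E4) = flatCov (F.curryLeft u) := by
    ext w
    simp only [ContinuousLinearMap.comp_apply, flatCov_apply,
      ContinuousAlternatingMap.curryLeft_apply_apply,
      ContinuousAlternatingMap.compContinuousLinearMap_apply]
    refine congrArg F (funext fun j => ?_)
    fin_cases j <;> simp
  rw [h1]
  simp only [ContinuousAlternatingMap.curryLeft_apply_apply,
    ContinuousAlternatingMap.compContinuousLinearMap_apply]
  refine congrArg ε (funext fun j => ?_)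
  fin_cases j <;> simp

theorem sqP_comp {G G' : E4 →L[ℝ] E4 →L[ℝ] ℝ} (hG : G.IsInvertible)
    (hG' : G'.IsInvertible) (D : E4 ≃L[ℝ] E4) (h : ∀ v w, G' v w = G (D v) (D w))
    (F : E4 [⋀^Fin 2]→L[ℝ] ℝ) :
    sqP G' (F.compContinuousLinearMap (D : E4 →L[ℝ] E4)) = sqP G F := by
  have hadd (a b c : E4) : F ![a + b, c] = F ![a, c] + F ![b, c] := F.toAlternatingMap.map_vecCons_add _ _ _
  have hsmul (r : ℝ) (a c : E4) : F ![r • a, c] = r * F ![a, c] := F.toAlternatingMap.map_vecCons_smul _ _ _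
  have hadd' (a b c : E4) : F ![c, a + b] = F ![c, a] + F ![c, b] := by
    simpa only [flatCov_apply, ContinuousAlternatingMap.curryLeft_apply_apply] using
      (flatCov (F.curryLeft c)).map_add a b
  have hsmul' (r : ℝ) (a c : E4) : F ![c, r • a] = r * F ![c, a] := by
    simpa only [flatCov_apply, ContinuousAlternatingMap.curryLeft_apply_apply, smul_eq_mul] using
      (flatCov (F.curryLeft c)).map_smul r a
  let B (u : E4) (γ : E4 →L[ℝ] ℝ) : E4 →ₗ[ℝ] (E4 →L[ℝ] ℝ) →ₗ[ℝ] ℝ := LinearMap.mk₂ ℝ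
    (fun u' γ' => F ![u, u'] * F ![G.inverse γ, G.inverse γ'])
    (fun _ _ _ => by rw [hadd']; ring) (fun _ _ _ => by rw [hsmul']; simp [mul_assoc])
    (fun _ _ _ => by rw [map_add, hadd']; ring)
    (fun _ _ _ => by rw [map_smul, hsmul']; simp; ring)
  let B' : E4 →ₗ[ℝ] (E4 →L[ℝ] ℝ) →ₗ[ℝ] ℝ := LinearMap.mk₂ ℝ
    (fun u γ => ∑ j, B u γ (stdVec j) (stdCov j))
    (fun _ _ _ => by simp only [B, LinearMap.mk₂_apply, hadd, ← Finset.sum_add_distrib]; simp only [add_mul])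
    (fun _ _ _ => by simp only [B, LinearMap.mk₂_apply, hsmul, smul_eq_mul, Finset.mul_sum, mul_assoc])
    (fun _ _ _ => by
      simp only [B, LinearMap.mk₂_apply, map_add, hadd, ← Finset.sum_add_distrib]; simp only [mul_add])
    (fun _ _ _ => by
      simp only [B, LinearMap.mk₂_apply, map_smul, hsmul, smul_eq_mul, Finset.mul_sum]
      exact Finset.sum_congr rfl fun _ _ => by ring)
  refine Eq.trans ?_ (sum_frame_equiv B' D)
  refine Finset.sum_congr rfl fun i _ => ?_
  simp only [B', LinearMap.mk₂_apply]
  refine Eq.trans ?_ (sum_frame_equiv (B (D (stdVec i)) _) D)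
  refine Finset.sum_congr rfl fun j _ => ?_
  simp only [B, LinearMap.mk₂_apply]
  rw [inverse_comp_symm hG hG' D h (stdCov i), inverse_comp_symm hG hG' D h (stdCov j)]
  simp only [ContinuousAlternatingMap.compContinuousLinearMap_apply]
  congr 1
  · refine congrArg F (funext fun k => ?_)
    fin_cases k <;> rfl
  · refine congrArg F (funext fun k => ?_)
    fin_cases k <;> simp

theorem inverse_smul_bilin {G : E4 →L[ℝ] E4 →L[ℝ] ℝ} (hG : G.IsInvertible) {c : ℝ} (hc : c ≠ 0)
    (α : E4 →L[ℝ] ℝ) : (c⁻¹ • G).inverse α = c • G.inverse α := by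
  have hG' : (c⁻¹ • G).IsInvertible := by
    obtain ⟨G, rfl⟩ := hG
    refine isInvertible_of_nondegenerate fun v hv => ?_
    have : G v = 0 := by
      ext w
      simpa [hc] using hv w
    simpa using this
  have : (c⁻¹ • G) (c • G.inverse α) = α := by
    ext w
    simp [hG.self_apply_inverse, hc]
  conv_lhs => rw [← this]
  rw [hG'.inverse_apply_self]

theorem raiseP_conformal {G : E4 →L[ℝ] E4 →L[ℝ] ℝ} (hG : G.IsInvertible) {c : ℝ} (hc : c ≠ 0)
    (F : E4 [⋀^Fin 2]→L[ℝ] ℝ) (β : E4 →L[ℝ] ℝ) :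
    raiseP (c⁻¹ • G) F β = c ^ 2 • raiseP G F β := by
  simp only [raiseP, inverse_smul_bilin hG hc, map_smul, flatCov_neg, flatCov_smul, map_neg,
    smul_neg, smul_smul, sq]

theorem hodgeP_conformal {G : E4 →L[ℝ] E4 →L[ℝ] ℝ} (hG : G.IsInvertible) {c : ℝ} (hc : c ≠ 0)
    (ε : E4 [⋀^Fin 4]→L[ℝ] ℝ) (F : E4 [⋀^Fin 2]→L[ℝ] ℝ) :
    hodgeP (c⁻¹ • G) ((c ^ 2)⁻¹ • ε) F = hodgeP G ε F := by
  have hε (u w : E4) : (((c ^ 2)⁻¹ • ε).curryLeft u).curryLeft w =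
      (c ^ 2)⁻¹ • (ε.curryLeft u).curryLeft w := rfl
  simp only [hodgeP, inverse_smul_bilin hG hc, map_smul, flatCov_smul, hε, smul_smul]
  refine congrArg _ (Finset.sum_congr rfl fun i _ => ?_)
  rw [← sq, inv_mul_cancel₀ (pow_ne_zero 2 hc), one_smul]

theorem sqP_conformal {G : E4 →L[ℝ] E4 →L[ℝ] ℝ} (hG : G.IsInvertible) {c : ℝ} (hc : c ≠ 0)
    (F : E4 [⋀^Fin 2]→L[ℝ] ℝ) : sqP (c⁻¹ • G) F = c ^ 2 * sqP G F := by
  have hsmul (r : ℝ) (a b : E4) : F ![r • a, r • b] = r ^ 2 * F ![a, b] := by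
    have := F.toAlternatingMap.map_smul_univ (fun _ => r) ![a, b]
    simp at this
    convert! this using 2
    ext1 k
    fin_cases k <;> rfl
  simp only [sqP, inverse_smul_bilin hG hc, Finset.mul_sum, hsmul]
  exact Finset.sum_congr rfl fun i _ => Finset.sum_congr rfl fun j _ => by ring

end PointwiseAlgebra

section SmoothCurrents

variable {M : Type*} [TopologicalSpace M] [ChartedSpace (EuclideanHalfSpace 4) M]

theorem formAt_hodge (g : BilinField (𝓡∂ 4) M) (ε : DForm (𝓡∂ 4) M 4) (F : DForm (𝓡∂ 4) M 2)
    (x : M) : formAt (hodge g ε F) x = hodgeP (bilinAt g x) (formAt ε x) (formAt F x) := rfl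

theorem sqF_eq (g : BilinField (𝓡∂ 4) M) (F : DForm (𝓡∂ 4) M 2) (x : M) :
    sqF g F x = sqP (bilinAt g x) (formAt F x) := rfl

theorem bilinAt_isInvertible {g : BilinField (𝓡∂ 4) M} (hg : IsLorentzian g) (x : M) :
    (bilinAt g x).IsInvertible := by
  obtain ⟨b, hb⟩ := hg.2 x
  refine isInvertible_of_nondegenerate fun v hv => ?_
  let b' : Module.Basis (Fin 4) ℝ E4 := b
  have hb' (i j : Fin 4) : bilinAt g x (b' i) (b' j) = if i = j then (if i = 0 then -1 else 1) else 0 :=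
    hb i j
  refine b'.ext_elem fun i => ?_
  have h := hv (b' i)
  rw [← b'.sum_repr v] at h
  simp only [map_sum, map_smul, sum_apply, smul_apply, hb'] at h
  rw [Finset.sum_eq_single i (fun j _ hj => by simp [hj]) (by simp)] at h
  simp only [if_true, smul_eq_mul, mul_eq_zero] at h
  rcases h with h | h
  · simpa using h
  · split_ifs at h <;> norm_num at h

theorem chartForm_eq_comp {k : ℕ} (η : DForm (𝓡∂ 4) M k) {x₀ : M} {y : E4} {D : E4 ≃L[ℝ] E4}
    (hD : (D : E4 →L[ℝ] E4) = symmD (𝓡∂ 4) x₀ y) :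
    chartForm (𝓡∂ 4) η x₀ y = (formAt η ((extChartAt (𝓡∂ 4) x₀).symm y)).compContinuousLinearMap
      (D : E4 →L[ℝ] E4) := by
  rw [hD]; rfl

variable [IsManifold (𝓡∂ 4) ∞ M]

theorem contMDiff_of_chart {E : Type*} [NormedAddCommGroup E] [NormedSpace ℝ E]
    {H : Type*} [TopologicalSpace H] {I : ModelWithCorners ℝ E H}
    {M : Type*} [TopologicalSpace M] [ChartedSpace H M] [IsManifold I ∞ M] {f : M → ℝ}
    (h : ∀ x₀ : M, ContDiffOn ℝ ∞ (f ∘ (extChartAt I x₀).symm) (extChartAt I x₀).target) :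
    ContMDiff I 𝓘(ℝ, ℝ) ∞ f := fun x => by
  have h1 := (contMDiffOn_iff_contDiffOn.2 (h x)).comp (contMDiffOn_extChartAt (x := x)) (by
    intro y hy
    rw [← extChartAt_source I] at hy
    exact (extChartAt I x).map_source hy)
  refine (h1.congr (f₁ := f) fun y hy => ?_).contMDiffAt
    ((chartAt H x).open_source.mem_nhds (mem_chart_source H x))
  rw [← extChartAt_source I] at hy
  simp only [Function.comp_apply, (extChartAt I x).left_inv hy]

theorem chart_equiv {x₀ : M} {y : E4} (hy : y ∈ (extChartAt (𝓡∂ 4) x₀).target) :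
    ∃ D : E4 ≃L[ℝ] E4, (D : E4 →L[ℝ] E4) = symmD (𝓡∂ 4) x₀ y :=
  isInvertible_mfderivWithin_extChartAt_symm (I := 𝓡∂ 4) hy

variable {g : BilinField (𝓡∂ 4) M} (hg : IsLorentzian g)
include hg

theorem chartForm_hodge (ε : DForm (𝓡∂ 4) M 4) (F : DForm (𝓡∂ 4) M 2) {x₀ : M} {y : E4}
    (hy : y ∈ (extChartAt (𝓡∂ 4) x₀).target) :
    chartForm (𝓡∂ 4) (hodge g ε F) x₀ y =
      hodgeP (chartBilin (𝓡∂ 4) g x₀ y) (chartForm (𝓡∂ 4) ε x₀ y) (chartForm (𝓡∂ 4) F x₀ y) := by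
  obtain ⟨D, hD⟩ := chart_equiv hy
  rw [chartForm_eq_comp _ hD, chartForm_eq_comp _ hD, chartForm_eq_comp _ hD, formAt_hodge]
  refine (hodgeP_comp (bilinAt_isInvertible hg _)
    (chartBilin_isInvertible (bilinAt_isInvertible hg) hy) D (fun v w => ?_) _ _).symm
  rw [chartBilin_apply, ← hD]
  rfl

theorem sqF_chart (F : DForm (𝓡∂ 4) M 2) {x₀ : M} {y : E4}
    (hy : y ∈ (extChartAt (𝓡∂ 4) x₀).target) :
    sqF g F ((extChartAt (𝓡∂ 4) x₀).symm y) =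
      sqP (chartBilin (𝓡∂ 4) g x₀ y) (chartForm (𝓡∂ 4) F x₀ y) := by
  obtain ⟨D, hD⟩ := chart_equiv hy
  rw [chartForm_eq_comp _ hD, sqF_eq]
  refine (sqP_comp (bilinAt_isInvertible hg _)
    (chartBilin_isInvertible (bilinAt_isInvertible hg) hy) D (fun v w => ?_) _).symm
  rw [chartBilin_apply, ← hD]
  rfl

variable (hgs : SmoothBilin (𝓡∂ 4) g)
include hgs

theorem contDiffOn_chart_inverse (x₀ : M) : ContDiffOn ℝ ∞
    (fun y => (chartBilin (𝓡∂ 4) g x₀ y).inverse) (extChartAt (𝓡∂ 4) x₀).target :=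
  contDiffOn_inverse (hgs x₀) fun _ hy => chartBilin_isInvertible (bilinAt_isInvertible hg) hy

theorem SmoothForm.hodge {ε : DForm (𝓡∂ 4) M 4} {F : DForm (𝓡∂ 4) M 2}
    (hε : SmoothForm (𝓡∂ 4) ε) (hF : SmoothForm (𝓡∂ 4) F) :
    SmoothForm (𝓡∂ 4) (hodge g ε F) := fun x₀ => by
  have hi := contDiffOn_chart_inverse hg hgs x₀
  have h : ContDiffOn ℝ ∞ (fun y => hodgeP (chartBilin (𝓡∂ 4) g x₀ y) (chartForm (𝓡∂ 4) ε x₀ y)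
      (chartForm (𝓡∂ 4) F x₀ y)) (extChartAt (𝓡∂ 4) x₀).target := by
    refine ContDiffOn.const_smul _ (ContDiffOn.sum fun i _ => ?_)
    exact contDiffOn_contract (contDiffOn_contract (hε x₀) contDiffOn_const)
      (hi.clm_apply (contDiffOn_flatCov (contDiffOn_contract (hF x₀)
        (hi.clm_apply contDiffOn_const))))
  exact h.congr fun y hy => chartForm_hodge hg ε F hy

theorem contMDiff_sqF {F : DForm (𝓡∂ 4) M 2} (hF : SmoothForm (𝓡∂ 4) F) :
    ContMDiff (𝓡∂ 4) 𝓘(ℝ, ℝ) ∞ (sqF g F) := contMDiff_of_chart fun x₀ => by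
  have hi := contDiffOn_chart_inverse hg hgs x₀
  have h : ContDiffOn ℝ ∞ (fun y => sqP (chartBilin (𝓡∂ 4) g x₀ y)
      (chartForm (𝓡∂ 4) F x₀ y)) (extChartAt (𝓡∂ 4) x₀).target := by
    refine ContDiffOn.sum fun i _ => ContDiffOn.sum fun j _ => ContDiffOn.mul ?_ ?_
    · exact contDiffOn_eval (V := fun k _ => ![stdVec i, stdVec j] k) (hF x₀)
        fun _ => contDiffOn_const
    · have := contDiffOn_eval (V := fun k y => (chartBilin (𝓡∂ 4) g x₀ y).inverse
        (![stdCov i, stdCov j] k)) (hF x₀) fun k => hi.clm_apply contDiffOn_const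
      refine this.congr fun y _ => congrArg _ (funext fun k => ?_)
      fin_cases k <;> rfl
  exact h.congr fun y hy => sqF_chart hg F hy

theorem SmoothVField.raiseF {F : DForm (𝓡∂ 4) M 2} {β : DForm (𝓡∂ 4) M 1}
    (hF : SmoothForm (𝓡∂ 4) F) (hβ : SmoothForm (𝓡∂ 4) β) :
    SmoothVField (𝓡∂ 4) (fun x => raiseF g F x (covector (β x))) :=
  SmoothVField.sharp hgs (bilinAt_isInvertible hg)
    (hF.contract (SmoothVField.sharp hgs (bilinAt_isInvertible hg) hβ)).neg

omit hg hgs in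
theorem contMDiff_covector_apply {A : DForm (𝓡∂ 4) M 1} {X : VField (𝓡∂ 4) M}
    (hA : SmoothForm (𝓡∂ 4) A) (hX : SmoothVField (𝓡∂ 4) X) :
    ContMDiff (𝓡∂ 4) 𝓘(ℝ, ℝ) ∞ (fun x => covector (A x) (X x)) := contMDiff_of_chart fun x₀ => by
  have h := contDiffOn_eval (V := fun _ : Fin 0 => fun _ => (0 : E4))
    (contDiffOn_contract (hA x₀) (hX x₀)) fun _ => contDiffOn_const
  refine h.congr fun y hy => ?_
  have h2 := congrArg (fun η => η (fun _ : Fin 0 => (0 : E4))) (chartForm_contract X A hy)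
  refine Eq.trans ?_ h2
  rw [chartForm_apply, formAt_contract, ContinuousAlternatingMap.curryLeft_apply_apply]
  refine congrArg (formAt A _) (funext fun i => ?_)
  fin_cases i
  rfl

variable {ε : DForm (𝓡∂ 4) M 4} {A : DForm (𝓡∂ 4) M 1} {X : VField (𝓡∂ 4) M} {lam : M → ℝ}
  (hε : SmoothForm (𝓡∂ 4) ε) (hA : SmoothForm (𝓡∂ 4) A)

omit hg hgs in
include hA in
theorem smooth_deltaA (hX : SmoothVField (𝓡∂ 4) X) (hlam : ContMDiff (𝓡∂ 4) 𝓘(ℝ, ℝ) ∞ lam) :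
    SmoothForm (𝓡∂ 4) (deltaA A X lam) :=
  (hA.lieForm hX).add (SmoothForm.dFun hlam)

include hε hA

theorem smooth_canonicalForm (hX : SmoothVField (𝓡∂ 4) X)
    (hlam : ContMDiff (𝓡∂ 4) 𝓘(ℝ, ℝ) ∞ lam) :
    SmoothForm (𝓡∂ 4) (currentForm ε (canonicalVec g A X lam)) := by
  have h1 := hε.contract (SmoothVField.raiseF hg hgs hA.extD (smooth_deltaA hA hX hlam))
  have h2 := hε.contract (SmoothVField.raiseF hg hgs (hA.extD.lieForm hX) hA)
  have h3 := (h1.sub h2).const_smul (-(1 / (4 * Real.pi)))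
  convert! h3 using 2 with x
  change (formAt ε x).curryLeft (vecAt (canonicalVec g A X lam) x) = -(1 / (4 * Real.pi)) •
    ((formAt ε x).curryLeft (raiseP (bilinAt g x) (formAt (fieldStrength A) x)
        (flatCov (formAt (deltaA A X lam) x))) -
      (formAt ε x).curryLeft (raiseP (bilinAt g x) (formAt (lieForm X (fieldStrength A)) x)
        (flatCov (formAt A x))))
  rw [← map_sub, ← map_smul]
  rfl

theorem smooth_noetherForm (hX : SmoothVField (𝓡∂ 4) X)
    (hlam : ContMDiff (𝓡∂ 4) 𝓘(ℝ, ℝ) ∞ lam) :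
    SmoothForm (𝓡∂ 4) (currentForm ε (noetherVec g A X lam)) := by
  have h1 := hε.contract (SmoothVField.raiseF hg hgs hA.extD (smooth_deltaA hA hX hlam))
  have h2 := ((hε.contract hX).fsmul (contMDiff_sqF hg hgs hA.extD)).const_smul (1 / (16 * Real.pi))
  have h3 := (h1.const_smul (-(1 / (4 * Real.pi)))).add h2
  convert! h3 using 2 with x
  change (formAt ε x).curryLeft (vecAt (noetherVec g A X lam) x) = -(1 / (4 * Real.pi)) •
    ((formAt ε x).curryLeft (raiseP (bilinAt g x) (formAt (fieldStrength A) x)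
        (flatCov (formAt (deltaA A X lam) x)))) +
      (1 / (16 * Real.pi)) • sqF g (fieldStrength A) x • (formAt ε x).curryLeft (vecAt X x)
  rw [smul_smul, ← map_smul, ← map_smul, ← map_add]
  rfl

theorem smooth_stressForm (hX : SmoothVField (𝓡∂ 4) X) :
    SmoothForm (𝓡∂ 4) (currentForm ε (stressVec g A X)) := by
  have h1 := hε.contract (SmoothVField.raiseF hg hgs hA.extD (hA.extD.contract hX))
  have h2 := ((hε.contract hX).fsmul (contMDiff_sqF hg hgs hA.extD)).const_smul (1 / 4)
  have h3 := (h1.sub h2).const_smul (1 / (4 * Real.pi))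
  convert! h3 using 2 with x
  change (formAt ε x).curryLeft (vecAt (stressVec g A X) x) = (1 / (4 * Real.pi)) •
    ((formAt ε x).curryLeft (raiseP (bilinAt g x) (formAt (fieldStrength A) x)
        (flatCov ((formAt (fieldStrength A) x).curryLeft (vecAt X x)))) -
      (1 / 4 : ℝ) • sqF g (fieldStrength A) x • (formAt ε x).curryLeft (vecAt X x))
  rw [smul_smul, ← map_smul, ← map_sub, ← map_smul]
  rfl

theorem smooth_boundaryN (hX : SmoothVField (𝓡∂ 4) X)
    (hlam : ContMDiff (𝓡∂ 4) 𝓘(ℝ, ℝ) ∞ lam) :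
    SmoothForm (𝓡∂ 4) (boundaryN g ε A X lam) :=
  ((SmoothForm.hodge hg hgs hε hA.extD).const_smul 2).fsmul
    (contMDiff_const.mul ((contMDiff_covector_apply hA hX).add hlam))

theorem smooth_boundaryC (hX : SmoothVField (𝓡∂ 4) X)
    (hlam : ContMDiff (𝓡∂ 4) 𝓘(ℝ, ℝ) ∞ lam) :
    SmoothForm (𝓡∂ 4) (boundaryC g ε A X lam) :=
  ((((hε.contract hX).contract (SmoothVField.raiseF hg hgs hA.extD hA)).const_smul 2).sub
    (((SmoothForm.hodge hg hgs hε hA.extD).const_smul 2).fsmul hlam)).const_smul _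

end SmoothCurrents

section Extension

variable {E : Type*} [NormedAddCommGroup E] [NormedSpace ℝ E]
  {H : Type*} [TopologicalSpace H] {I : ModelWithCorners ℝ E H}
  {M : Type*} [TopologicalSpace M] [ChartedSpace H M]

theorem extD_congr_of_eventuallyEq [IsManifold I 1 M] {k : ℕ} {η ζ : DForm I M k} {x : M}
    (h : ∀ᶠ p in 𝓝 x, η p = ζ p) : extD I η x = extD I ζ x := by
  change formAt (extD I η) x = formAt (extD I ζ) x
  rw [formAt_extD, formAt_extD]
  have hc : Tendsto (extChartAt I x).symm (𝓝[range I] (extChartAt I x x)) (𝓝 x) := by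
    have := (continuousAt_extChartAt_symm (I := I) x).tendsto
    rw [extChartAt_to_inv] at this
    exact this.mono_left nhdsWithin_le_nhds
  refine Filter.EventuallyEq.extDerivWithin_eq_of_mem ?_ (mem_range_self _)
  filter_upwards [hc.eventually h] with y hy
  rw [chartForm, chartForm, hy]

theorem SmoothForm.eq_of_frequently [IsManifold I 1 M] {k : ℕ} {η ζ : DForm I M k}
    (hη : SmoothForm I η) (hζ : SmoothForm I ζ) {x : M} (h : ∃ᶠ p in 𝓝 x, η p = ζ p) :
    η x = ζ x := by
  have key {θ : DForm I M k} (hθ : SmoothForm I θ) :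
      Tendsto (fun p => chartForm I θ x (extChartAt I x p)) (𝓝 x) (𝓝 (formAt θ x)) := by
    rw [← chartForm_self]
    have h1 : ContinuousOn (chartForm I θ x) (extChartAt I x).target := (hθ x).continuousOn
    have h2 := h1.comp (continuousOn_extChartAt (I := I) x) (fun p hp => (extChartAt I x).map_source hp)
    exact h2.continuousAt (extChartAt_source_mem_nhds x)
  have hmem : ∃ᶠ p in 𝓝 x,
      chartForm I η x (extChartAt I x p) = chartForm I ζ x (extChartAt I x p) := by
    refine (h.and_eventually (extChartAt_source_mem_nhds (I := I) x)).mono fun p hp => ?_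
    ext v
    rw [chartForm_apply, chartForm_apply, (extChartAt I x).left_inv hp.2]
    exact congrArg (fun L : E [⋀^Fin k]→L[ℝ] ℝ => L fun i => symmD I x (extChartAt I x p) (v i)) hp.1
  have := tendsto_nhds_unique_of_frequently_eq (key hη) (key hζ) hmem
  exact this

end Extension

namespace Completion

variable {M : Type*} [TopologicalSpace M] [ChartedSpace (EuclideanHalfSpace 4) M]
  (C : Completion M)

theorem g_isInvertible (x : M) : (bilinAt C.g x).IsInvertible :=
  bilinAt_isInvertible C.g_lorentzian x

theorem Ω_boundary {x : M} (hx : x ∈ (𝓡∂ 4).boundary M) : C.Ω x = 0 := (C.Ω_eq_zero_iff x).2 hx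

/-- The physical spacetime is dense. -/
theorem frequently_Ω_pos (x : M) : ∃ᶠ p in 𝓝 x, 0 < C.Ω p := by
  by_contra h
  rw [not_frequently] at h
  have h0 : C.Ω =ᶠ[𝓝 x] fun _ => 0 := h.mono fun p hp => le_antisymm (not_lt.1 hp) (C.Ω_nonneg p)
  refine C.dΩ_ne_zero x ((C.Ω_eq_zero_iff x).1 h0.self_of_nhds) ?_
  rw [dFun, h0.mfderiv_eq, mfderiv_const]
  rfl

theorem formAt_hodge_phys (F : DForm (𝓡∂ 4) M 2) {x : M} (hx : 0 < C.Ω x) :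
    formAt (hodge C.physG C.physVol F) x = formAt (hodge C.g C.vol F) x := by
  have h := hodgeP_conformal (C.g_isInvertible x) (pow_ne_zero 2 hx.ne') (formAt C.vol x) (formAt F x)
  rw [← pow_mul] at h
  exact h

theorem raiseF_phys (F : DForm (𝓡∂ 4) M 2) {x : M} (hx : 0 < C.Ω x)
    (β : TangentSpace (𝓡∂ 4) x →L[ℝ] ℝ) :
    raiseF C.physG F x β = (C.Ω x ^ 4) • raiseF C.g F x β := by
  have h := raiseP_conformal (C.g_isInvertible x) (pow_ne_zero 2 hx.ne') (formAt F x) β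
  rw [← pow_mul] at h
  exact h

theorem sqF_phys (F : DForm (𝓡∂ 4) M 2) {x : M} (hx : 0 < C.Ω x) :
    sqF C.physG F x = C.Ω x ^ 4 * sqF C.g F x := by
  have h := sqP_conformal (C.g_isInvertible x) (pow_ne_zero 2 hx.ne') (formAt F x)
  rw [← pow_mul] at h
  exact h

theorem currentForm_phys {j j' : VField (𝓡∂ 4) M} {x : M} (hx : 0 < C.Ω x)
    (h : j x = (C.Ω x ^ 4) • j' x) :
    currentForm C.vol j' x = currentForm C.physVol j x := by
  change (formAt C.vol x).curryLeft (vecAt j' x) =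
    ((C.Ω x ^ 4)⁻¹ • formAt C.vol x).curryLeft (vecAt j x)
  have h' : vecAt j x = (C.Ω x ^ 4) • vecAt j' x := h
  have h4 : C.Ω x ^ 4 ≠ 0 := pow_ne_zero 4 hx.ne'
  rw [h', ContinuousAlternatingMap.curryLeft_smul, map_smul, smul_apply, smul_smul,
    mul_inv_cancel₀ h4, one_smul]

variable (A : DForm (𝓡∂ 4) M 1) (X : VField (𝓡∂ 4) M) (lam : M → ℝ)

theorem canonicalVec_phys {x : M} (hx : 0 < C.Ω x) :
    canonicalVec C.physG A X lam x = (C.Ω x ^ 4) • canonicalVec C.g A X lam x := by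
  rw [canonicalVec, canonicalVec, C.raiseF_phys _ hx, C.raiseF_phys _ hx, ← smul_sub, smul_comm]

theorem noetherVec_phys {x : M} (hx : 0 < C.Ω x) :
    noetherVec C.physG A X lam x = (C.Ω x ^ 4) • noetherVec C.g A X lam x := by
  rw [noetherVec, noetherVec, C.raiseF_phys _ hx, C.sqF_phys _ hx, smul_add, smul_comm, mul_left_comm, mul_smul]

theorem stressVec_phys {x : M} (hx : 0 < C.Ω x) :
    stressVec C.physG A X x = (C.Ω x ^ 4) • stressVec C.g A X x := by
  rw [stressVec, stressVec, C.raiseF_phys _ hx, C.sqF_phys _ hx, mul_left_comm, mul_smul, ← smul_sub,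
    smul_comm]

theorem boundaryN_phys {x : M} (hx : 0 < C.Ω x) :
    boundaryN C.physG C.physVol A X lam x = boundaryN C.g C.vol A X lam x := by
  have h : hodge C.physG C.physVol (fieldStrength A) x = hodge C.g C.vol (fieldStrength A) x :=
    C.formAt_hodge_phys _ hx
  rw [boundaryN, boundaryN, h]

theorem boundaryC_phys {x : M} (hx : 0 < C.Ω x) :
    boundaryC C.physG C.physVol A X lam x = boundaryC C.g C.vol A X lam x := by
  have h : hodge C.physG C.physVol (fieldStrength A) x = hodge C.g C.vol (fieldStrength A) x :=
    C.formAt_hodge_phys _ hx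
  have h4 : C.Ω x ^ 4 ≠ 0 := pow_ne_zero 4 hx.ne'
  have h2 : contract (raiseF C.physG (fieldStrength A) x (covector (A x)))
      (contract (X x) (C.physVol x)) =
      contract (raiseF C.g (fieldStrength A) x (covector (A x))) (contract (X x) (C.vol x)) := by
    rw [C.raiseF_phys _ hx]
    change (((C.Ω x ^ 4)⁻¹ • formAt C.vol x).curryLeft (vecAt X x)).curryLeft
      ((C.Ω x ^ 4) • raiseP _ _ _) = ((formAt C.vol x).curryLeft (vecAt X x)).curryLeft (raiseP _ _ _)
    rw [ContinuousAlternatingMap.curryLeft_smul, map_smul, smul_apply,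
      ContinuousAlternatingMap.curryLeft_smul, smul_apply, smul_smul, mul_inv_cancel₀ h4, one_smul]
  rw [boundaryC, boundaryC, h, h2]

variable [IsManifold (𝓡∂ 4) ∞ M]

variable {C} in
theorem IsSmoothExtension.unique {k : ℕ} {η ζ p : DForm (𝓡∂ 4) M k}
    (hη : C.IsSmoothExtension η p) (hζ : C.IsSmoothExtension ζ p) : η = ζ := funext fun x =>
  hη.1.eq_of_frequently hζ.1 ((C.frequently_Ω_pos x).mono fun q hq =>
    (hη.2 q hq).trans (hζ.2 q hq).symm)

variable {A X lam} (hA : SmoothForm (𝓡∂ 4) A) (hX : SmoothVField (𝓡∂ 4) X)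
  (hlam : ContMDiff (𝓡∂ 4) 𝓘(ℝ, ℝ) ∞ lam)

include hA in
theorem smooth_hodge : SmoothForm (𝓡∂ 4) (hodge C.g C.vol (fieldStrength A)) :=
  SmoothForm.hodge C.g_lorentzian C.g_smooth C.vol_smooth hA.extD

/-- The smooth extensions of the physical currents, given by the unphysical fields. -/
def unphysicalCurrents : C.Currents A X lam where
  JC := currentForm C.vol (canonicalVec C.g A X lam)
  JN := currentForm C.vol (noetherVec C.g A X lam)
  JT := currentForm C.vol (stressVec C.g A X)
  QC := boundaryC C.g C.vol A X lam
  QN := boundaryN C.g C.vol A X lam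
  isExt_JC := ⟨smooth_canonicalForm C.g_lorentzian C.g_smooth C.vol_smooth hA hX hlam,
    fun _ hx => C.currentForm_phys hx (C.canonicalVec_phys A X lam hx)⟩
  isExt_JN := ⟨smooth_noetherForm C.g_lorentzian C.g_smooth C.vol_smooth hA hX hlam,
    fun _ hx => C.currentForm_phys hx (C.noetherVec_phys A X lam hx)⟩
  isExt_JT := ⟨smooth_stressForm C.g_lorentzian C.g_smooth C.vol_smooth hA hX,
    fun _ hx => C.currentForm_phys hx (C.stressVec_phys A X hx)⟩
  isExt_QC := ⟨smooth_boundaryC C.g_lorentzian C.g_smooth C.vol_smooth hA hX hlam,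
    fun _ hx => (C.boundaryC_phys A X lam hx).symm⟩
  isExt_QN := ⟨smooth_boundaryN C.g_lorentzian C.g_smooth C.vol_smooth hA hX hlam,
    fun _ hx => (C.boundaryN_phys A X lam hx).symm⟩

variable {C} in
theorem currents_eq (𝒥 : C.Currents A X lam) : 𝒥 = C.unphysicalCurrents hA hX hlam := by
  have h1 := 𝒥.isExt_JC.unique (C.unphysicalCurrents hA hX hlam).isExt_JC
  have h2 := 𝒥.isExt_JN.unique (C.unphysicalCurrents hA hX hlam).isExt_JN
  have h3 := 𝒥.isExt_JT.unique (C.unphysicalCurrents hA hX hlam).isExt_JT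
  have h4 := 𝒥.isExt_QC.unique (C.unphysicalCurrents hA hX hlam).isExt_QC
  have h5 := 𝒥.isExt_QN.unique (C.unphysicalCurrents hA hX hlam).isExt_QN
  cases 𝒥
  simp only at h1 h2 h3 h4 h5
  subst h1 h2 h3 h4 h5
  rfl

variable {C} in
/-- The Maxwell equations `d⋆F = 0` extend to null infinity. -/
theorem IsMaxwellPotential.extD_hodge (h : C.IsMaxwellPotential A) {x : M}
    (hx : x ∈ (𝓡∂ 4).boundary M) :
    extD (𝓡∂ 4) (hodge C.g C.vol (fieldStrength A)) x = 0 := by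
  have hs := (C.smooth_hodge h.1).extD
  have h0 : SmoothForm (𝓡∂ 4) (0 : DForm (𝓡∂ 4) M 3) := by
    convert! hs.const_smul 0 using 2 with y
    simp
  refine hs.eq_of_frequently h0 (((C.frequently_Ω_pos x).and_eventually (h.2.2 x hx)).mono
    fun y hy => ?_)
  have h1 := hy.2 hy.1
  rw [MaxwellAt] at h1
  refine Eq.trans ?_ h1
  refine extD_congr_of_eventuallyEq ?_
  have hc : ContinuousAt C.Ω y := C.Ω_smooth.continuous.continuousAt
  filter_upwards [hc.eventually (lt_mem_nhds hy.1)] with q hq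
  exact (C.formAt_hodge_phys _ hq).symm

end Completion


section ScriAlgebra

/-- The metric `G`, the volume form `ε`, the covectors `ν = dΩ` and `μ = du` and the auxiliary
normal `l` at a point of null infinity. -/
structure ScriPoint (G : E4 →L[ℝ] E4 →L[ℝ] ℝ) (ε : E4 [⋀^Fin 4]→L[ℝ] ℝ) (ν μ : E4 →L[ℝ] ℝ)
    (l : E4) : Prop where
  symm : ∀ v w, G v w = G w v
  inv : G.IsInvertible
  vol : ∀ v : Fin 4 → E4, ε v ^ 2 = -(Matrix.of fun i j => G (v i) (v j)).det
  vol_ne : ∃ b : Module.Basis (Fin 4) ℝ E4, ε b ≠ 0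
  null : ν (G.inverse ν) = 0
  clock : μ (G.inverse ν) = 1
  l_null : G l l = 0
  l_normal : G l (G.inverse ν) = -1
  l_orth : ∀ v, ν v = 0 → μ v = 0 → G l v = 0

/-- The contraction `q^{ab} α_a β_b` at a point. -/
def qP (G : E4 →L[ℝ] E4 →L[ℝ] ℝ) (n l : E4) (α β : E4 →L[ℝ] ℝ) : ℝ :=
  α (G.inverse β) + α n * β l + α l * β n

/-- The covector `F_{ab} n^b` at a point. -/
def elecP (F : E4 [⋀^Fin 2]→L[ℝ] ℝ) (n : E4) : E4 →L[ℝ] ℝ := flatCov (-F.curryLeft n)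

theorem two_form_swap (F : E4 [⋀^Fin 2]→L[ℝ] ℝ) (a b : E4) : F ![a, b] = -F ![b, a] := by
  have h := F.toAlternatingMap.map_swap ![a, b] (show (0 : Fin 2) ≠ 1 by decide)
  have h2 : (![a, b] ∘ Equiv.swap (0 : Fin 2) 1) = ![b, a] := by
    ext1 i; fin_cases i <;> rfl
  rw [h2] at h
  exact (neg_eq_iff_eq_neg.2 h).symm

theorem elecP_apply (F : E4 [⋀^Fin 2]→L[ℝ] ℝ) (n w : E4) : elecP F n w = F ![w, n] := by
  rw [two_form_swap, elecP, flatCov_neg]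
  simp [flatCov_apply]

theorem elecP_self (F : E4 [⋀^Fin 2]→L[ℝ] ℝ) (n : E4) : elecP F n n = 0 := by
  have := two_form_swap F n n
  rw [elecP_apply]
  linarith

theorem four_form_swap (ε : E4 [⋀^Fin 4]→L[ℝ] ℝ) (a b c d : E4) :
    ε ![a, b, c, d] = -ε ![b, a, c, d] := by
  have h := ε.toAlternatingMap.map_swap ![a, b, c, d] (show (0 : Fin 4) ≠ 1 by decide)
  have h2 : (![a, b, c, d] ∘ Equiv.swap (0 : Fin 4) 1) = ![b, a, c, d] := by
    ext1 i; fin_cases i <;> rfl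
  rw [h2] at h
  exact (neg_eq_iff_eq_neg.2 h).symm

/-- A `4`-form vanishes on vectors of a hyperplane. -/
theorem four_form_hyperplane (ε : E4 [⋀^Fin 4]→L[ℝ] ℝ) {ν : E4 →L[ℝ] ℝ} (hν : ν ≠ 0)
    {v : Fin 4 → E4} (hv : ∀ i, ν (v i) = 0) : ε v = 0 := by
  refine ε.toAlternatingMap.map_linearDependent v fun hli => hν ?_
  have hs := hli.span_eq_top_of_card_eq_finrank (by simp)
  have : (ν : E4 →ₗ[ℝ] ℝ) = 0 := by
    rw [← LinearMap.ker_eq_top, eq_top_iff, ← hs, Submodule.span_le]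
    rintro _ ⟨i, rfl⟩
    exact hv i
  ext w
  exact congrArg (fun L : E4 →ₗ[ℝ] ℝ => L w) this

/-- In dimension four the product of a covector and a `4`-form vanishes. -/
theorem four_form_insert (ε : E4 [⋀^Fin 4]→L[ℝ] ℝ) (β : E4 →L[ℝ] ℝ) (a b c d e : E4) :
    β a * ε ![b, c, d, e] - β b * ε ![a, c, d, e] + β c * ε ![a, b, d, e]
      - β d * ε ![a, b, c, e] + β e * ε ![a, b, c, d] = 0 := by
  have h : ContinuousAlternatingMap.alternatizeUncurryFin (β.smulRight ε) ![a, b, c, d, e] = 0 := by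
    refine (ContinuousAlternatingMap.alternatizeUncurryFin
      (β.smulRight ε)).toAlternatingMap.map_linearDependent _ fun hli => ?_
    have := hli.fintype_card_le_finrank
    simp at this
  have h0 : (0 : Fin 5).removeNth ![a, b, c, d, e] = ![b, c, d, e] := by
    ext1 i; fin_cases i <;> rfl
  have h1 : (1 : Fin 5).removeNth ![a, b, c, d, e] = ![a, c, d, e] := by
    ext1 i; fin_cases i <;> rfl
  have h2 : (2 : Fin 5).removeNth ![a, b, c, d, e] = ![a, b, d, e] := by
    ext1 i; fin_cases i <;> rfl
  have h3 : (3 : Fin 5).removeNth ![a, b, c, d, e] = ![a, b, c, e] := by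
    ext1 i; fin_cases i <;> rfl
  have h4 : (4 : Fin 5).removeNth ![a, b, c, d, e] = ![a, b, c, d] := by
    ext1 i; fin_cases i <;> rfl
  rw [ContinuousAlternatingMap.alternatizeUncurryFin_apply, Fin.sum_univ_five, h0, h1, h2, h3, h4] at h
  have h5 : (-1 : ℤ) ^ 0 • (β a * ε ![b, c, d, e]) + (-1 : ℤ) ^ 1 • (β b * ε ![a, c, d, e]) +
    (-1 : ℤ) ^ 2 • (β c * ε ![a, b, d, e]) + (-1 : ℤ) ^ 3 • (β d * ε ![a, b, c, e]) +
    (-1 : ℤ) ^ 4 • (β e * ε ![a, b, c, d]) = 0 := h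
  norm_num at h5
  linarith

theorem curryLeft2_apply (ε : E4 [⋀^Fin 4]→L[ℝ] ℝ) (a b : E4) (v : Fin 2 → E4) :
    (ε.curryLeft a).curryLeft b v = ε ![a, b, v 0, v 1] := by
  simp only [ContinuousAlternatingMap.curryLeft_apply_apply]
  refine congrArg ε (funext fun i => ?_)
  fin_cases i <;> rfl

theorem curryLeft_apply3 (ε : E4 [⋀^Fin 4]→L[ℝ] ℝ) (a : E4) (v : Fin 3 → E4) :
    ε.curryLeft a v = ε ![a, v 0, v 1, v 2] := by
  simp only [ContinuousAlternatingMap.curryLeft_apply_apply]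
  refine congrArg ε (funext fun i => ?_)
  fin_cases i <;> rfl

/-- The product of a covector and the dual of a two-form: `β ∧ ⋆F = (F^{ab} β_b) ⌟ ε`. -/
theorem wedge_hodgeP {G : E4 →L[ℝ] E4 →L[ℝ] ℝ} (hG : G.IsInvertible) (hs : ∀ v w, G v w = G w v)
    (ε : E4 [⋀^Fin 4]→L[ℝ] ℝ) (F : E4 [⋀^Fin 2]→L[ℝ] ℝ) (β : E4 →L[ℝ] ℝ) (a b c : E4) :
    β a * hodgeP G ε F ![b, c] - β b * hodgeP G ε F ![a, c] + β c * hodgeP G ε F ![a, b] =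
      ε ![raiseP G F β, a, b, c] := by
  set u : Fin 4 → E4 := fun i => G.inverse (flatCov (F.curryLeft (G.inverse (stdCov i)))) with hu
  have hh (v w : E4) : hodgeP G ε F ![v, w] = 1 / 2 * ∑ i, ε ![stdVec i, u i, v, w] := by
    simp only [hodgeP, ContinuousAlternatingMap.smul_apply, ContinuousAlternatingMap.sum_apply,
      curryLeft2_apply, smul_eq_mul]
    rfl
  have hsymi (α γ : E4 →L[ℝ] ℝ) : α (G.inverse γ) = γ (G.inverse α) := by
    conv_lhs => rw [← hG.self_apply_inverse α]
    conv_rhs => rw [← hG.self_apply_inverse γ]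
    exact hs _ _
  have hinj (v w : E4) (h : ∀ i, stdCov i v = stdCov i w) : v = w := by
    rw [← sum_stdCov_smul v, ← sum_stdCov_smul w]
    simp only [h]
  have hu' (γ : E4 →L[ℝ] ℝ) (i : Fin 4) : γ (u i) = F ![G.inverse (stdCov i), G.inverse γ] := by
    rw [hu]
    change γ (G.inverse _) = _
    rw [hsymi, flatCov_apply]
    rfl
  have hr (γ : E4 →L[ℝ] ℝ) : γ (raiseP G F β) = F ![G.inverse γ, G.inverse β] := by
    rw [raiseP, hsymi, flatCov_neg]
    change -(flatCov (F.curryLeft (G.inverse β))) (G.inverse γ) = _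
    rw [flatCov_apply, two_form_swap]
    rfl
  have hF2 (v : E4) (w : E4) : F ![v, w] = flatCov (F.curryLeft v) w := by
    rw [flatCov_apply]; rfl
  have s1 : ∑ i, β (u i) • stdVec i = raiseP G F β := by
    refine hinj _ _ fun j => ?_
    rw [hr, map_sum, Finset.sum_eq_single j]
    · rw [map_smul, hu']
      simp [stdCov, stdVec]
    · intro i _ hij
      simp [stdCov, stdVec, hij.symm]
    · simp
  have s2 : ∑ i, β (stdVec i) • u i = -raiseP G F β := by
    refine hinj _ _ fun j => ?_
    rw [map_neg, hr, map_sum, hF2]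
    conv_rhs => rw [← sum_apply_smul_stdCov β]
    simp only [map_sum, map_smul, smul_eq_mul, hu', ← Finset.sum_neg_distrib]
    refine Finset.sum_congr rfl fun i _ => ?_
    rw [two_form_swap, hF2, mul_neg]
  have t1 : ∑ i, β (u i) * ε ![stdVec i, a, b, c] = ε ![raiseP G F β, a, b, c] := by
    rw [← s1]
    have := curryLeft_apply3 ε (∑ i, β (u i) • stdVec i) ![a, b, c]
    rw [map_sum] at this
    refine Eq.trans ?_ this
    simp only [map_smul, ContinuousAlternatingMap.sum_apply, ContinuousAlternatingMap.smul_apply,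
      curryLeft_apply3, smul_eq_mul]
    rfl
  have t2 : ∑ i, β (stdVec i) * ε ![u i, a, b, c] = -ε ![raiseP G F β, a, b, c] := by
    have h0 := curryLeft_apply3 ε (∑ i, β (stdVec i) • u i) ![a, b, c]
    rw [map_sum] at h0
    have h1 := curryLeft_apply3 ε (raiseP G F β) ![a, b, c]
    have h2 : ε.curryLeft (-raiseP G F β) ![a, b, c] = -ε ![raiseP G F β, a, b, c] := by
      rw [map_neg]; exact congrArg Neg.neg h1
    rw [← h2, ← s2, map_sum]
    simp only [map_smul, ContinuousAlternatingMap.sum_apply, ContinuousAlternatingMap.smul_apply,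
      curryLeft_apply3, smul_eq_mul]
    rfl
  have key : ∑ i, (β (stdVec i) * ε ![u i, a, b, c] - β (u i) * ε ![stdVec i, a, b, c]
      + β a * ε ![stdVec i, u i, b, c] - β b * ε ![stdVec i, u i, a, c]
      + β c * ε ![stdVec i, u i, a, b]) = 0 :=
    Finset.sum_eq_zero fun i _ => four_form_insert ε β (stdVec i) (u i) a b c
  simp only [Finset.sum_add_distrib, Finset.sum_sub_distrib, t1, t2, ← Finset.mul_sum] at key
  rw [hh, hh, hh]
  linarith


theorem qP_eq_of_normal {G : E4 →L[ℝ] E4 →L[ℝ] ℝ} {n l : E4} {α β : E4 →L[ℝ] ℝ} (hα : α n = 0)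
    (hβ : β n = 0) : qP G n l α β = α (G.inverse β) := by
  rw [qP, hα, hβ]; ring

namespace ScriPoint

variable {G : E4 →L[ℝ] E4 →L[ℝ] ℝ} {ε : E4 [⋀^Fin 4]→L[ℝ] ℝ} {ν μ : E4 →L[ℝ] ℝ} {l : E4}
  (P : ScriPoint G ε ν μ l)
include P

theorem G_n (w : E4) : G (G.inverse ν) w = ν w := by rw [P.inv.self_apply_inverse]

theorem sharp_symm (α γ : E4 →L[ℝ] ℝ) : α (G.inverse γ) = γ (G.inverse α) := by
  conv_lhs => rw [← P.inv.self_apply_inverse α]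
  conv_rhs => rw [← P.inv.self_apply_inverse γ]
  exact P.symm _ _

theorem ν_l : ν l = -1 := by rw [← P.G_n, P.symm, P.l_normal]

theorem ν_ne : ν ≠ 0 := fun h => by simpa [h] using P.ν_l

theorem vol_tangent {a b c d : E4} (ha : ν a = 0) (hb : ν b = 0) (hc : ν c = 0) (hd : ν d = 0) :
    ε ![a, b, c, d] = 0 :=
  four_form_hyperplane ε P.ν_ne fun i => by fin_cases i <;> assumption

/-- On null infinity `v ⌟ ε = -(v^a n_a) l ⌟ ε`. -/
theorem vol_normal (v : E4) {a b c : E4} (ha : ν a = 0) (hb : ν b = 0) (hc : ν c = 0) :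
    ε ![v, a, b, c] = -ν v * ε ![l, a, b, c] := by
  have h := four_form_insert ε ν v l a b c
  rw [ha, hb, hc, P.ν_l] at h
  linarith

theorem ν_raiseP (F : E4 [⋀^Fin 2]→L[ℝ] ℝ) (β : E4 →L[ℝ] ℝ) :
    ν (raiseP G F β) = -elecP F (G.inverse ν) (G.inverse β) := by
  rw [raiseP, P.sharp_symm, elecP_apply, flatCov_neg]
  simp [flatCov_apply]

/-- `(F^{ab} β_b) ⌟ ε` on null infinity is `g^{ab} E_a β_b` times the volume element. -/
theorem vol_raiseP (F : E4 [⋀^Fin 2]→L[ℝ] ℝ) (β : E4 →L[ℝ] ℝ) {a b c : E4}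
    (ha : ν a = 0) (hb : ν b = 0) (hc : ν c = 0) :
    ε ![raiseP G F β, a, b, c] =
      elecP F (G.inverse ν) (G.inverse β) * ε ![l, a, b, c] := by
  rw [P.vol_normal _ ha hb hc, P.ν_raiseP, neg_neg]

theorem qP_symm (α β : E4 →L[ℝ] ℝ) : qP G (G.inverse ν) l α β = qP G (G.inverse ν) l β α := by
  rw [qP, qP, P.sharp_symm]; ring

/-- The contraction with `q^{ab}` only involves the restrictions to null infinity. -/
theorem qP_congr {α α' β β' : E4 →L[ℝ] ℝ} (hα : ∀ v, ν v = 0 → α v = α' v)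
    (hβ : ∀ v, ν v = 0 → β v = β' v) :
    qP G (G.inverse ν) l α β = qP G (G.inverse ν) l α' β' := by
  have key (α α' β : E4 →L[ℝ] ℝ) (h : ∀ v, ν v = 0 → α v = α' v) :
      qP G (G.inverse ν) l α β = qP G (G.inverse ν) l α' β := by
    have e (α : E4 →L[ℝ] ℝ) : qP G (G.inverse ν) l α β =
        α (G.inverse β + β l • G.inverse ν + β (G.inverse ν) • l) := by
      simp only [qP, map_add, map_smul, smul_eq_mul]; ring
    rw [e, e]
    refine h _ ?_
    rw [map_add, map_add, map_smul, map_smul, P.null, P.ν_l, P.sharp_symm, smul_eq_mul, smul_eq_mul]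
    ring
  rw [key α α' β hα, P.qP_symm, key β β' α' hβ, P.qP_symm]

/-- On the cross-sections `⋆F` is `2 Re φ₁` times the area element. -/
theorem hodgeP_cross (F : E4 [⋀^Fin 2]→L[ℝ] ℝ) {a b : E4} (ha : ν a = 0) (hb : ν b = 0)
    (ha' : μ a = 0) (hb' : μ b = 0) :
    hodgeP G ε F ![a, b] = -F ![l, G.inverse ν] * ε ![l, G.inverse ν, a, b] := by
  have h := wedge_hodgeP P.inv P.symm ε F (-G l) (G.inverse ν) a b
  have hl : G.inverse (-G l) = -l := by rw [map_neg, P.inv.inverse_apply_self]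
  rw [P.vol_raiseP F _ P.null ha hb, hl, map_neg, elecP_apply] at h
  simp only [neg_apply, P.l_normal, P.l_orth a ha ha', P.l_orth b hb hb'] at h
  linarith

/-- The raised contraction of the Noether boundary form with a tangent vector. -/
theorem vol_raiseP_cross (F : E4 [⋀^Fin 2]→L[ℝ] ℝ) (β : E4 →L[ℝ] ℝ) {X a b : E4}
    (hX : ν X = 0) (ha : ν a = 0) (hb : ν b = 0) (ha' : μ a = 0) (hb' : μ b = 0) :
    ε ![X, raiseP G F β, a, b] = -(μ X * elecP F (G.inverse ν) (G.inverse β)) *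
      ε ![l, G.inverse ν, a, b] := by
  rw [four_form_swap, P.vol_raiseP F β hX ha hb]
  have h := four_form_insert ε μ (G.inverse ν) l X a b
  rw [ha', hb', P.clock, P.vol_tangent P.null hX ha hb, four_form_swap ε (G.inverse ν) l] at h
  linear_combination (-elecP F (G.inverse ν) (G.inverse β)) * h

end ScriPoint

end ScriAlgebra

section ConformalKilling

/-- The Lie derivative of a form at a point, in terms of the derivative `dη` of the form along the
vector field and the derivative `D` of the vector field. -/
def lieP {k : ℕ} (D : E4 →L[ℝ] E4) (dη η : E4 [⋀^Fin k]→L[ℝ] ℝ) (v : Fin k → E4) : ℝ :=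
  dη v + ∑ i, η (Function.update v i (D (v i)))

/-- The Lie derivative of a bilinear form at a point. -/
def lieG (D : E4 →L[ℝ] E4) (dG G : E4 →L[ℝ] E4 →L[ℝ] ℝ) (v w : E4) : ℝ :=
  dG v w + G (D v) w + G v (D w)

theorem lieP_curryLeft {k : ℕ} (D : E4 →L[ℝ] E4) (dη η : E4 [⋀^Fin (k + 1)]→L[ℝ] ℝ) (V dV : E4)
    (v : Fin k → E4) :
    lieP D (dη.curryLeft V + η.curryLeft dV) (η.curryLeft V) v =
      lieP D dη η (Matrix.vecCons V v) + η (Matrix.vecCons (dV - D V) v) := by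
  have h1 : η (Matrix.vecCons (dV - D V) v) = η (Matrix.vecCons dV v) - η (Matrix.vecCons (D V) v) := by
    have e (u : E4) : η (Matrix.vecCons u v) = η.curryLeft u v := rfl
    rw [e, e, e, map_sub]
    rfl
  have h2 (u : E4) : Function.update (Matrix.vecCons V v) 0 u = Matrix.vecCons u v :=
    Fin.update_cons_zero (α := fun _ => E4) V v u
  have h3 (i : Fin k) (u : E4) : (η.curryLeft V) (Function.update v i u) =
      η (Function.update (Matrix.vecCons V v) i.succ u) := by
    rw [ContinuousAlternatingMap.curryLeft_apply_apply]
    exact congrArg η (Fin.cons_update (α := fun _ => E4) V v i u)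
  have h4 : (dη.curryLeft V + η.curryLeft dV) v =
      dη (Matrix.vecCons V v) + η (Matrix.vecCons dV v) := rfl
  simp only [lieP, h3, h4]
  rw [Fin.sum_univ_succ, h1, Matrix.cons_val_zero, h2]
  simp only [Matrix.cons_val_succ]
  ring

theorem differentiable_det : Differentiable ℝ fun m : Fin 4 → Fin 4 → ℝ => (Matrix.of m).det := by
  simp only [Matrix.det_apply', Matrix.of_apply]
  fun_prop

/-- The derivative of the determinant of the Gram matrix of an adapted basis. -/
theorem fderiv_det_adapted (a b c p q r s k : ℝ) :
    fderiv ℝ (fun m : Fin 4 → Fin 4 → ℝ => (Matrix.of m).det)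
      ![![0, -1, 0, 0], ![-1, 0, 0, 0], ![0, 0, a, b], ![0, 0, b, c] ]
      ![![0, p, 0, 0], ![p, q, r, s], ![0, r, k * a, k * b], ![0, s, k * b, k * c] ] =
      2 * (p - k) * (a * c - b ^ 2) := by
  set m : Fin 4 → Fin 4 → ℝ := ![![0, -1, 0, 0], ![-1, 0, 0, 0], ![0, 0, a, b], ![0, 0, b, c] ]
  set m' : Fin 4 → Fin 4 → ℝ :=
    ![![0, p, 0, 0], ![p, q, r, s], ![0, r, k * a, k * b], ![0, s, k * b, k * c] ]
  have h1 : HasDerivAt (fun t : ℝ => m + t • m') m' 0 := by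
    simpa using ((hasDerivAt_id (0 : ℝ)).smul_const m').const_add m
  have h2 := (differentiable_det (m + (0 : ℝ) • m')).hasFDerivAt.comp_hasDerivAt (0 : ℝ) h1
  rw [zero_smul, add_zero] at h2
  have h3 : HasDerivAt (fun t : ℝ => -(-1 + t * p) ^ 2 * (1 + t * k) ^ 2 * (a * c - b ^ 2))
      (2 * (p - k) * (a * c - b ^ 2)) 0 := by
    have e1 : HasDerivAt (fun t : ℝ => -1 + t * p) p 0 := by
      simpa using ((hasDerivAt_id (0 : ℝ)).mul_const p).const_add (-1)
    have e2 : HasDerivAt (fun t : ℝ => 1 + t * k) k 0 := by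
      simpa using ((hasDerivAt_id (0 : ℝ)).mul_const k).const_add 1
    have e3 := (((e1.pow 2).neg).mul (e2.pow 2)).mul_const (a * c - b ^ 2)
    convert! e3 using 1
    simp only [Pi.neg_apply, Pi.pow_apply]
    push_cast
    ring
  refine h2.unique (h3.congr_of_eventuallyEq (Eventually.of_forall fun t => ?_))
  simp only [Function.comp_apply, m, m']
  simp [Matrix.det_succ_row_zero, Fin.sum_univ_succ, Fin.succAbove, Matrix.submatrix]
  ring


/-- Two forms of top degree, of which one does not vanish on `b`, are proportional. -/
theorem top_form_eq {ε Λ : E4 [⋀^Fin 4]→L[ℝ] ℝ} {b : Fin 4 → E4} (hb : ε b ≠ 0) {c : ℝ}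
    (h : Λ b = c * ε b) (v : Fin 4 → E4) : Λ v = c * ε v := by
  have hli : LinearIndependent ℝ b := by
    by_contra hn
    exact hb (ε.toAlternatingMap.map_linearDependent b hn)
  let e := basisOfLinearIndependentOfCardEqFinrank hli (by simp)
  have he : (e : Fin 4 → E4) = b := by simp [e]
  have h1 := congrArg (fun f : E4 [⋀^Fin 4]→ₗ[ℝ] ℝ => f v) (Λ.toAlternatingMap.eq_smul_basis_det e)
  have h2 := congrArg (fun f : E4 [⋀^Fin 4]→ₗ[ℝ] ℝ => f v) (ε.toAlternatingMap.eq_smul_basis_det e)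
  rw [he] at h1 h2
  change Λ v = Λ b * e.det v at h1
  change ε v = ε b * e.det v at h2
  rw [h1, h2, h]
  ring

namespace ScriPoint

variable {G : E4 →L[ℝ] E4 →L[ℝ] ℝ} {ε : E4 [⋀^Fin 4]→L[ℝ] ℝ} {ν μ : E4 →L[ℝ] ℝ} {l : E4}
  (P : ScriPoint G ε ν μ l)
include P

theorem exists_vol_l_ne : ∃ a b c : E4, ε ![l, a, b, c] ≠ 0 := by
  by_contra! hn
  obtain ⟨b, hb⟩ := P.vol_ne
  have h := four_form_insert ε ν l (b 0) (b 1) (b 2) (b 3)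
  have hb' : (b : Fin 4 → E4) = ![b 0, b 1, b 2, b 3] := by
    ext1 i; fin_cases i <;> rfl
  rw [hn, hn, hn, hn, P.ν_l, ← hb'] at h
  exact hb (by linarith)

theorem exists_vol_ne : ∃ a b : E4, ε ![G.inverse ν, l, a, b] ≠ 0 := by
  by_contra! hn
  obtain ⟨a, b, c, h0⟩ := P.exists_vol_l_ne
  have h := four_form_insert ε μ (G.inverse ν) l a b c
  rw [hn, hn, hn, P.clock] at h
  have h' := four_form_insert ε ν (G.inverse ν) l a b c
  rw [hn, hn, hn, P.null, P.ν_l] at h'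
  have e : ε ![G.inverse ν, a, b, c] = 0 := by linarith
  rw [e] at h
  exact h0 (by linarith)

/-- There is a basis adapted to the cross-section. -/
theorem exists_adapted : ∃ a b : E4, ν a = 0 ∧ μ a = 0 ∧ ν b = 0 ∧ μ b = 0 ∧
    ε ![G.inverse ν, l, a, b] ≠ 0 := by
  obtain ⟨a, b, h⟩ := P.exists_vol_ne
  let p (v : E4) : E4 := v + ν v • l - (μ v + ν v * μ l) • G.inverse ν
  have hp1 (v : E4) : ν (p v) = 0 := by simp [p, P.ν_l, P.null]
  have hp2 (v : E4) : μ (p v) = 0 := by simp [p, P.clock]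
  refine ⟨p a, p b, hp1 a, hp2 a, hp1 b, hp2 b, ?_⟩
  set χ := (ε.curryLeft (G.inverse ν)).curryLeft l
  have hχ (v w : E4) : χ ![v, w] = ε ![G.inverse ν, l, v, w] := curryLeft2_apply _ _ _ _
  have hl (w : E4) : χ ![l, w] = 0 := by
    rw [hχ]
    exact ε.toAlternatingMap.map_eq_zero_of_eq _ (i := 1) (j := 2) rfl (by decide)
  have hn (w : E4) : χ ![G.inverse ν, w] = 0 := by
    rw [hχ]
    exact ε.toAlternatingMap.map_eq_zero_of_eq _ (i := 0) (j := 2) rfl (by decide)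
  have key (v w : E4) : χ ![p v, w] = χ ![v, w] := by
    have e (v : E4) : χ ![v, w] = flatCov (χ.curryLeft v) w := by rw [flatCov_apply]; rfl
    have e2 : flatCov (χ.curryLeft (p v)) w = flatCov (χ.curryLeft v) w
        + ν v * flatCov (χ.curryLeft l) w
        - (μ v + ν v * μ l) * flatCov (χ.curryLeft (G.inverse ν)) w := by
      simp only [p, map_add, map_sub, map_smul]
      rfl
    rw [e, e2, ← e, ← e, ← e, hl, hn]
    ring
  rw [← hχ, key, two_form_swap, key, two_form_swap, neg_neg, hχ]
  exact h

/-- The Lie derivative of the volume form along a vector field that is conformal Killing on the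
directions tangent to null infinity. -/
theorem lie_vol {D : E4 →L[ℝ] E4} {dG : E4 →L[ℝ] E4 →L[ℝ] ℝ} {dε Λ : E4 [⋀^Fin 4]→L[ℝ] ℝ}
    (hΛ : ∀ v, Λ v = lieP D dε ε v) (hs : ∀ v w, dG v w = dG w v)
    (hd : ∀ v : Fin 4 → E4, 2 * ε v * dε v = -fderiv ℝ (fun m : Fin 4 → Fin 4 → ℝ =>
      (Matrix.of m).det) (fun i j => G (v i) (v j)) fun i j => dG (v i) (v j)) {α : ℝ}
    (hT : ∀ v w, ν v = 0 → ν w = 0 → lieG D dG G v w = 2 * α * G v w) (v : Fin 4 → E4) :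
    lieP D dε ε v = (2 * α - lieG D dG G l (G.inverse ν)) * ε v := by
  obtain ⟨m, m', h1, h2, h3, h4, hne⟩ := P.exists_adapted
  rw [← hΛ]
  refine top_form_eq hne ?_ v
  set n := G.inverse ν
  set b := ![n, l, m, m']
  have hsymm (v w : E4) : lieG D dG G v w = lieG D dG G w v := by
    rw [lieG, lieG, hs, P.symm (D v), P.symm v]; ring
  have hgram (v w : E4) (i j : Fin 4) :
      HasDerivAt (fun t : ℝ => G (v + t • D v) (w + t • D w)) (G (D v) w + G v (D w)) 0 := by
    have e : (fun t : ℝ => G (v + t • D v) (w + t • D w)) = fun t : ℝ =>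
        G v w + t * (G (D v) w + G v (D w)) + t ^ 2 * G (D v) (D w) := by
      ext t
      simp only [map_add, map_smul, add_apply, smul_apply, smul_eq_mul]
      ring
    rw [e]
    have := (((hasDerivAt_id (0 : ℝ)).mul_const (G (D v) w + G v (D w))).const_add (G v w)).add
      (((hasDerivAt_id (0 : ℝ)).pow 2).mul_const (G (D v) (D w)))
    convert! this using 1
    simp
  have hlin : 2 * ε b * ∑ i, ε (Function.update b i (D (b i))) =
      -fderiv ℝ (fun m : Fin 4 → Fin 4 → ℝ => (Matrix.of m).det) (fun i j => G (b i) (b j))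
        fun i j => G (D (b i)) (b j) + G (b i) (D (b j)) := by
    have c1 : HasDerivAt (fun t : ℝ => b + t • fun i => D (b i)) (fun i => D (b i)) 0 := by
      simpa using ((hasDerivAt_id (0 : ℝ)).smul_const (fun i => D (b i))).const_add b
    have c2 : HasFDerivAt (fun v : Fin 4 → E4 => ε v)
        (ε.toContinuousMultilinearMap.linearDeriv (b + (0 : ℝ) • fun i => D (b i)))
        (b + (0 : ℝ) • fun i => D (b i)) := ε.toContinuousMultilinearMap.hasFDerivAt _
    have c3 := (c2.comp_hasDerivAt (0 : ℝ) c1).pow 2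
    have c4 : HasDerivAt (fun t : ℝ => fun i j => G (b i + t • D (b i)) (b j + t • D (b j)))
        (fun i j => G (D (b i)) (b j) + G (b i) (D (b j))) 0 :=
      hasDerivAt_pi.2 fun i => hasDerivAt_pi.2 fun j => hgram (b i) (b j) i j
    have c5 := ((differentiable_det (fun i j => G (b i + (0 : ℝ) • D (b i))
      (b j + (0 : ℝ) • D (b j)))).hasFDerivAt.comp_hasDerivAt (0 : ℝ) c4).neg
    have c6 := c3.unique (c5.congr_of_eventuallyEq (Eventually.of_forall fun t => P.vol _))
    simp only [zero_smul, add_zero] at c6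
    rw [ContinuousMultilinearMap.linearDeriv_apply] at c6
    rw [← c6]
    simp
  have htot := congrArg₂ (· + ·) (hd b) hlin
  rw [← neg_add, ← map_add, ← mul_add] at htot
  have hm1 : (fun i j => G (b i) (b j)) =
      ![![0, -1, 0, 0], ![-1, 0, 0, 0], ![0, 0, G m m, G m m'], ![0, 0, G m m', G m' m'] ] := by
    have n1 : G n n = 0 := by rw [P.G_n, P.null]
    have n2 : G n l = -1 := by rw [P.G_n, P.ν_l]
    have n3 : G n m = 0 := by rw [P.G_n, h1]
    have n4 : G n m' = 0 := by rw [P.G_n, h3]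
    have n5 := P.l_orth m h1 h2
    have n6 := P.l_orth m' h3 h4
    ext i j
    fin_cases i <;> fin_cases j <;>
      simp [b, n1, n2, n3, n4, n5, n6, P.l_null, P.symm l n, P.symm m n, P.symm m' n, P.symm m l,
        P.symm m' l, P.symm m' m]
  have hm2 : ((fun i j => dG (b i) (b j)) + fun i j => G (D (b i)) (b j) + G (b i) (D (b j))) =
      ![![0, lieG D dG G l n, 0, 0],
        ![lieG D dG G l n, lieG D dG G l l, lieG D dG G l m, lieG D dG G l m'],
        ![0, lieG D dG G l m, 2 * α * G m m, 2 * α * G m m'],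
        ![0, lieG D dG G l m', 2 * α * G m m', 2 * α * G m' m'] ] := by
    have hadd : ((fun i j => dG (b i) (b j)) + fun i j => G (D (b i)) (b j) + G (b i) (D (b j))) =
        fun i j => lieG D dG G (b i) (b j) := by
      ext i j
      simp only [Pi.add_apply, lieG, add_assoc]
    have n1 : lieG D dG G n n = 0 := by rw [hT n n P.null P.null, P.G_n, P.null, mul_zero]
    have n3 : lieG D dG G n m = 0 := by rw [hT n m P.null h1, P.G_n, h1, mul_zero]
    have n4 : lieG D dG G n m' = 0 := by rw [hT n m' P.null h3, P.G_n, h3, mul_zero]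
    have n5 := hT m m h1 h1
    have n6 := hT m m' h1 h3
    have n7 := hT m' m' h3 h3
    rw [hadd]
    ext i j
    fin_cases i <;> fin_cases j <;>
      simp [b, n1, n3, n4, n5, n6, n7, hsymm n l, hsymm m n, hsymm m' n, hsymm m l,
        hsymm m' l, hsymm m' m]
  have hvol := P.vol b
  have hdet : (Matrix.of fun i j => G (b i) (b j)).det = -(G m m * G m' m' - G m m' ^ 2) := by
    rw [hm1]
    simp [Matrix.det_succ_row_zero, Fin.sum_univ_succ, Fin.succAbove, Matrix.submatrix]
    ring
  rw [hm1, hm2, fderiv_det_adapted] at htot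
  rw [hdet, neg_neg] at hvol
  rw [← hvol] at htot
  rw [hΛ, lieP]
  refine mul_left_cancel₀ (mul_ne_zero two_ne_zero hne) ?_
  linear_combination htot

/-- The Lie derivative of the current `(F^{ab} A_b) ⌟ ε`, pulled back to null infinity. -/
theorem lie_current {D : E4 →L[ℝ] E4} {dG : E4 →L[ℝ] E4 →L[ℝ] ℝ} {dε : E4 [⋀^Fin 4]→L[ℝ] ℝ}
    {F dF LF : E4 [⋀^Fin 2]→L[ℝ] ℝ} {A dA LA : E4 →L[ℝ] ℝ} {dw dV : E4} {α : ℝ}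
    (hT : ∀ v w, ν v = 0 → ν w = 0 → lieG D dG G v w = 2 * α * G v w)
    (hs : ∀ v w, dG v w = dG w v)
    (hε : ∀ v, lieP D dε ε v = (2 * α - lieG D dG G l (G.inverse ν)) * ε v)
    (hw : ∀ z, dG (G.inverse A) z + G dw z = dA z)
    (hV : ∀ z, dG (raiseP G F A) z + G dV z = -(dF ![G.inverse A, z] + F ![dw, z]))
    (hLA : ∀ z, LA z = dA z + A (D z)) (hLF : ∀ v, LF v = lieP D dF F v)
    (hA : A (G.inverse ν) = 0) {a b c : E4} (ha : ν a = 0) (hb : ν b = 0) (hc : ν c = 0) :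
    lieP D (dε.curryLeft (raiseP G F A) + ε.curryLeft dV) (ε.curryLeft (raiseP G F A)) ![a, b, c] =
      ε ![raiseP G F LA + raiseP G LF A, a, b, c] := by
  set n := G.inverse ν with hn
  set w := G.inverse A with hwdef
  set V := raiseP G F A with hVdef
  have hsymm (v w : E4) : lieG D dG G v w = lieG D dG G w v := by
    rw [lieG, lieG, hs, P.symm (D v), P.symm v]; ring
  have hGV (z : E4) : G V z = -F ![w, z] := by
    rw [hVdef, raiseP, P.inv.self_apply_inverse, flatCov_neg, neg_apply, flatCov_apply]
    rfl
  have hGw (z : E4) : G w z = A z := by rw [hwdef, P.inv.self_apply_inverse]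
  have e1 : lieP D (dε.curryLeft V + ε.curryLeft dV) (ε.curryLeft V) ![a, b, c] =
    lieP D dε ε ![V, a, b, c] + ε ![dV - D V, a, b, c] := lieP_curryLeft D dε ε V dV ![a, b, c]
  have hνG (z : E4) : ν z = G z n := by rw [P.symm, P.G_n]
  have hVn : ν V = -elecP F n w := P.ν_raiseP F A
  have hKw (z : E4) : G (dw - D w) z = LA z - lieG D dG G w z := by
    have h1 := hw z
    have h2 := hGw (D z)
    rw [hLA, lieG, map_sub, sub_apply]
    linarith
  have hKV (z : E4) : G (dV - D V) z = -lieG D dG G V z - LF ![w, z] - F ![dw - D w, z] := by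
    have h1 := hV z
    have h2 := hGV (D z)
    have h3 : LF ![w, z] = dF ![w, z] + F ![D w, z] + F ![w, D z] := by
      have u0 (u : E4) : Function.update ![w, z] 0 u = ![u, z] := by
        ext1 i; fin_cases i <;> rfl
      have u1 (u : E4) : Function.update ![w, z] 1 u = ![w, u] := by
        ext1 i; fin_cases i <;> rfl
      rw [hLF, lieP, Fin.sum_univ_two, u0, u1]
      simp only [Matrix.cons_val_zero, Matrix.cons_val_one]
      ring
    have h4 : F ![dw - D w, z] = F ![dw, z] - F ![D w, z] := by
      have e (v : E4) : F ![v, z] = flatCov (F.curryLeft v) z := by rw [flatCov_apply]; rfl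
      rw [e, e, e, map_sub]
      rfl
    rw [h3, h4, lieG, map_sub, sub_apply]
    linarith
  set e := G.inverse (elecP F n) with he
  have hGe (z : E4) : G e z = elecP F n z := by rw [he, P.inv.self_apply_inverse]
  have hνe : ν e = 0 := by rw [he, P.sharp_symm, elecP_self]
  have hνw : ν w = 0 := by rw [hwdef, P.sharp_symm, hA]
  have hFK : F ![dw - D w, n] = elecP F n (G.inverse LA) - 2 * α * elecP F n w := by
    rw [← elecP_apply, ← hGe, P.symm, hKw, hT w e hνw hνe, P.symm w e, hGe, P.sharp_symm]
  have hhV : lieG D dG G V n = elecP F n w * lieG D dG G l n := by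
    have h1 := hT (V - elecP F n w • l) n (by rw [map_sub, map_smul, hVn, P.ν_l, smul_eq_mul]; ring)
      P.null
    rw [← hνG, map_sub, map_smul, hVn, P.ν_l] at h1
    have h2 : lieG D dG G (V - elecP F n w • l) n =
        lieG D dG G V n - elecP F n w * lieG D dG G l n := by
      simp only [lieG, map_sub, map_smul, sub_apply, smul_apply, smul_eq_mul]
      ring
    rw [h2, smul_eq_mul] at h1
    linear_combination h1
  rw [e1, hε, P.vol_normal V ha hb hc, P.vol_normal (dV - D V) ha hb hc,
    P.vol_normal (_ + _) ha hb hc, map_add, P.ν_raiseP, P.ν_raiseP, hνG (dV - D V), hKV, hhV, hFK,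
    P.ν_raiseP, ← elecP_apply LF n w]
  ring

end ScriPoint

end ConformalKilling

section Derivatives

variable {E : Type*} [NormedAddCommGroup E] [NormedSpace ℝ E]
  {H : Type*} [TopologicalSpace H] {I : ModelWithCorners ℝ E H}
  {M : Type*} [TopologicalSpace M] [ChartedSpace H M]

/-- The derivative of a vector field at `x` in the chart at `x`. -/
def vecDeriv (X : VField I M) (x : M) : E →L[ℝ] E :=
  fderivWithin ℝ (chartVField I X x) (range I) (extChartAt I x x)

/-- The derivative of a form at `x` in the chart at `x`. -/
def formDeriv {k : ℕ} (η : DForm I M k) (x : M) : E →L[ℝ] E [⋀^Fin k]→L[ℝ] ℝ :=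
  fderivWithin ℝ (chartForm I η x) (range I) (extChartAt I x x)

/-- The derivative of a bilinear field at `x` in the chart at `x`. -/
def bilinDeriv (g : BilinField I M) (x : M) : E →L[ℝ] E →L[ℝ] E →L[ℝ] ℝ :=
  fderivWithin ℝ (chartBilin I g x) (range I) (extChartAt I x x)

theorem uniqueDiffWithinAt_range (x : M) :
    UniqueDiffWithinAt ℝ (range I) (extChartAt I x x) := uniqueDiffWithinAt_extChartAt_target x |>.mono
      (extChartAt_target_subset_range x)

theorem SmoothForm.differentiableWithinAt {k : ℕ} {η : DForm I M k} (h : SmoothForm I η) (x : M) :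
    DifferentiableWithinAt ℝ (chartForm I η x) (range I) (extChartAt I x x) :=
  (h.contDiffWithinAt (mem_extChartAt_target x)).differentiableWithinAt (by simp)

theorem SmoothVField.differentiableWithinAt {X : VField I M} (h : SmoothVField I X) (x : M) :
    DifferentiableWithinAt ℝ (chartVField I X x) (range I) (extChartAt I x x) :=
  (h.contDiffWithinAt (mem_extChartAt_target x)).differentiableWithinAt (by simp)

theorem SmoothBilin.differentiableWithinAt {g : BilinField I M} (h : SmoothBilin I g) (x : M) :
    DifferentiableWithinAt ℝ (chartBilin I g x) (range I) (extChartAt I x x) :=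
  (h.contDiffWithinAt (mem_extChartAt_target x)).differentiableWithinAt (by simp)

variable [IsManifold I ∞ M]

theorem formAt_extD_add {k : ℕ} {η ζ : DForm I M k} (hη : SmoothForm I η) (hζ : SmoothForm I ζ)
    (x : M) : formAt (I := I) (extD I fun y => η y + ζ y) x = formAt (extD I η) x + formAt (extD I ζ) x := by
  simp only [formAt_extD]
  exact extDerivWithin_fun_add (uniqueDiffWithinAt_range x) (hη.differentiableWithinAt x)
    (hζ.differentiableWithinAt x)

theorem formAt_extD_const_smul {k : ℕ} (c : ℝ) (η : DForm I M k)
    (x : M) : formAt (extD I (fun y => c • η y : DForm I M k)) x = c • formAt (extD I η) x := by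
  simp only [formAt_extD]
  exact extDerivWithin_fun_smul c (chartForm I η x) (uniqueDiffWithinAt_range (I := I) x)

/-- The Leibniz rule `d(fη) = df ∧ η + f dη`. -/
theorem formAt_extD_fsmul {k : ℕ} {f : M → ℝ} (hf : ContMDiff I 𝓘(ℝ, ℝ) ∞ f) {η : DForm I M k}
    (hη : SmoothForm I η) (x : M) (v : Fin (k + 1) → E) :
    formAt (I := I) (extD I fun y => f y • η y) x v =
      (∑ i : Fin (k + 1), (-1 : ℝ) ^ (i : ℕ) * (dAt I f x (v i) * formAt η x (i.removeNth v))) +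
        f x * formAt (extD I η) x v := by
  have hf' : DifferentiableWithinAt ℝ (f ∘ (extChartAt I x).symm) (range I) (extChartAt I x x) :=
    (contDiffWithinAt_chart_fun hf (mem_extChartAt_target x)).differentiableWithinAt (by simp)
  have hfx : (f ∘ (extChartAt I x).symm) (extChartAt I x x) = f x := by simp
  simp only [formAt_extD]
  rw [dAt_eq ((hf x).mdifferentiableAt (by simp))]
  have h : fderivWithin ℝ (chartForm I (fun y => f y • η y) x) (range I) (extChartAt I x x) =
      f x • formDeriv η x + (fderivWithin ℝ (f ∘ (extChartAt I x).symm) (range I)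
        (extChartAt I x x)).smulRight (formAt η x) := by
    have := fderivWithin_smul (uniqueDiffWithinAt_range x) hf' (hη.differentiableWithinAt x)
    rw [hfx, chartForm_self] at this
    exact this
  simp only [extDerivWithin, h, ContinuousAlternatingMap.alternatizeUncurryFin_apply]
  rw [Finset.mul_sum, ← Finset.sum_add_distrib]
  refine Finset.sum_congr rfl fun i _ => ?_
  simp only [add_apply, smul_apply, ContinuousLinearMap.smulRight_apply,
    ContinuousAlternatingMap.add_apply, ContinuousAlternatingMap.smul_apply, formDeriv, smul_eq_mul]
  rw [zsmul_eq_mul]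
  push_cast
  ring

theorem chartForm_contract_eventuallyEq {k : ℕ} (X : VField I M) (η : DForm I M (k + 1)) (x : M) :
    chartForm I (fun y => contract (X y) (η y)) x =ᶠ[𝓝[range I] (extChartAt I x x)]
      fun y => (chartForm I η x y).curryLeft (chartVField I X x y) := by
  filter_upwards [extChartAt_target_mem_nhdsWithin (I := I) x] with y hy
  exact chartForm_contract X η hy

theorem formDeriv_contract {k : ℕ} {X : VField I M} (hX : SmoothVField I X)
    {η : DForm I M (k + 1)} (hη : SmoothForm I η) (x : M) (u : E) :
    formDeriv (fun y => contract (X y) (η y)) x u =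
      (formDeriv η x u).curryLeft (vecAt X x) + (formAt η x).curryLeft (vecDeriv X x u) := by
  rw [formDeriv, (chartForm_contract_eventuallyEq X η x).fderivWithin_eq
    (chartForm_contract X η (mem_extChartAt_target x)),
    fderivWithin_contract_apply (hη.differentiableWithinAt x) (hX.differentiableWithinAt x)
    (uniqueDiffWithinAt_range x), chartForm_self, chartVField_self]
  rfl

/-- Cartan's formula. -/
theorem formAt_lieForm {k : ℕ} {X : VField I M} (hX : SmoothVField I X)
    {η : DForm I M (k + 1)} (hη : SmoothForm I η) (x : M) (v : Fin (k + 1) → E) :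
    formAt (lieForm X η) x v = formDeriv η x (vecAt X x) v +
      ∑ i, formAt η x (Function.update v i (vecDeriv X x (v i))) := by
  have h := cartan_formula (hη.differentiableWithinAt x) (hX.differentiableWithinAt x)
    (uniqueDiffWithinAt_range x) v
  rw [chartForm_self, chartVField_self] at h
  refine Eq.trans ?_ h
  change (formAt (extD I η) x).curryLeft (vecAt X x) v +
    formAt (extD I fun y => contract (X y) (η y)) x v = _
  rw [formAt_extD, formAt_extD, (chartForm_contract_eventuallyEq X η x).extDerivWithin_eq
    (chartForm_contract X η (mem_extChartAt_target x))]

theorem bilinAt_lieBilin (X : VField I M) (g : BilinField I M) (x : M) (v w : E) :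
    bilinAt (lieBilin X g) x v w = bilinDeriv g x (vecAt X x) v w
      + bilinAt g x (vecDeriv X x v) w + bilinAt g x v (vecDeriv X x w) := by
  have h : bilinAt (lieBilin X g) x v w =
      bilinDeriv g x (chartVField I X x (extChartAt I x x)) (chartD I x x v) (chartD I x x w)
        + chartBilin I g x (extChartAt I x x) (vecDeriv X x (chartD I x x v)) (chartD I x x w)
        + chartBilin I g x (extChartAt I x x) (chartD I x x v) (vecDeriv X x (chartD I x x w)) := rfl
  rw [h, chartD_self, chartBilin_self, chartVField_self]
  rfl

theorem bilinAt_nablaLow (X : VField I M) (g : BilinField I M) (x : M) (v w : E) :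
    bilinAt (nablaLow g X) x v w = bilinAt g x (vecDeriv X x v) w
      + 1 / 2 * (bilinDeriv g x v (vecAt X x) w + bilinDeriv g x (vecAt X x) v w
        - bilinDeriv g x w (vecAt X x) v) := by
  have h : bilinAt (nablaLow g X) x v w =
      chartBilin I g x (extChartAt I x x) (vecDeriv X x (chartD I x x v)) (chartD I x x w)
      + 1 / 2 * (bilinDeriv g x (chartD I x x v) (chartVField I X x (extChartAt I x x)) (chartD I x x w)
        + bilinDeriv g x (chartVField I X x (extChartAt I x x)) (chartD I x x v) (chartD I x x w)
        - bilinDeriv g x (chartD I x x w) (chartVField I X x (extChartAt I x x)) (chartD I x x v)) := rfl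
  rw [h, chartD_self, chartBilin_self, chartVField_self]
  rfl

theorem vecAt_mlieBracket (X Y : VField I M) (x : M) :
    vecAt (VectorField.mlieBracket I X Y) x = vecDeriv Y x (vecAt X x) - vecDeriv X x (vecAt Y x) := by
  have h : vecAt (VectorField.mlieBracket I X Y) x = (chartD I x x).inverse
      (VectorField.lieBracketWithin ℝ (chartVField I X x) (chartVField I Y x)
        ((extChartAt I x).symm ⁻¹' univ ∩ range I) (extChartAt I x x)) := rfl
  rw [h, chartD_self, ContinuousLinearMap.inverse_id, preimage_univ, univ_inter,
    VectorField.lieBracketWithin, chartVField_self, chartVField_self]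
  rfl

theorem vecDeriv_sub_fsmul {X Y : VField I M} (hX : SmoothVField I X) (hY : SmoothVField I Y)
    {f : M → ℝ} (hf : ContMDiff I 𝓘(ℝ, ℝ) ∞ f) (x : M) (u : E) :
    vecDeriv (fun y => X y - f y • Y y) x u =
      vecDeriv X x u - f x • vecDeriv Y x u - dAt I f x u • vecAt Y x := by
  have hf' : DifferentiableWithinAt ℝ (f ∘ (extChartAt I x).symm) (range I) (extChartAt I x x) :=
    (contDiffWithinAt_chart_fun hf (mem_extChartAt_target x)).differentiableWithinAt (by simp)
  have hfx : (f ∘ (extChartAt I x).symm) (extChartAt I x x) = f x := by simp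
  have e : chartVField I (fun y => X y - f y • Y y) x = fun y =>
      chartVField I X x y - (f ∘ (extChartAt I x).symm) y • chartVField I Y x y := by
    funext y
    rw [← chartVField_fsmul]
    simp only [chartVField_eq, ← map_sub]
    rfl
  have h2 := fderivWithin_smul (uniqueDiffWithinAt_range x) hf' (hY.differentiableWithinAt x)
  have h1 := fderivWithin_fun_sub (uniqueDiffWithinAt_range x) (hX.differentiableWithinAt x)
    (hf'.smul (hY.differentiableWithinAt x))
  rw [vecDeriv, e, dAt_eq ((hf x).mdifferentiableAt (by simp))]
  refine (congrArg (fun L : E →L[ℝ] E => L u) h1).trans ?_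
  have h3 := congrArg (fun L : E →L[ℝ] E => L u) h2
  simp only [sub_apply]
  have h4 : (fderivWithin ℝ ((f ∘ (extChartAt I x).symm) • chartVField I Y x) (range I)
      (extChartAt I x x)) u = f x • vecDeriv Y x u +
        fderivWithin ℝ (f ∘ (extChartAt I x).symm) (range I) (extChartAt I x x) u • vecAt Y x := by
    rw [← hfx, ← chartVField_self]
    exact h3
  rw [sub_sub]
  exact congrArg (vecDeriv X x u - ·) h4

/-- The exterior derivative of the function `X^a A_a`. -/
theorem formAt_extD_contract {A : DForm I M 1} {X : VField I M}
    (h : ContMDiff I 𝓘(ℝ, ℝ) ∞ fun x => covector (A x) (X x)) (x : M) :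
    formAt (I := I) (extD I fun y => contract (X y) (A y)) x =
      ContinuousAlternatingMap.ofSubsingleton ℝ E ℝ (0 : Fin 1)
        (dAt I (fun y => covector (A y) (X y)) x) := by
  rw [formAt_extD, dAt_eq ((h x).mdifferentiableAt (by simp)),
    ← extDerivWithin_constOfIsEmpty _ (uniqueDiffWithinAt_range x)]
  refine congrArg (fun ζ => extDerivWithin ζ (range I) (extChartAt I x x)) ?_
  funext y
  ext v
  change formAt A ((extChartAt I x).symm y) (Matrix.vecCons (vecAt X ((extChartAt I x).symm y))
    fun i => symmD I x y (v i)) = flatCov (formAt A ((extChartAt I x).symm y))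
      (vecAt X ((extChartAt I x).symm y))
  rw [flatCov_apply]
  exact congrArg _ (congrArg _ (Subsingleton.elim _ _))

end Derivatives

section ScriTraces

namespace ScriPoint

variable {G : E4 →L[ℝ] E4 →L[ℝ] ℝ} {ε : E4 [⋀^Fin 4]→L[ℝ] ℝ} {ν μ : E4 →L[ℝ] ℝ} {l : E4}
  (P : ScriPoint G ε ν μ l)
include P

theorem sum_outer (α β : E4 →L[ℝ] ℝ) :
    ∑ i, α (stdVec i) * β (G.inverse (stdCov i)) = α (G.inverse β) := by
  simp only [P.sharp_symm β]
  rw [← sum_stdCov_smul (G.inverse β), map_sum]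
  simp only [map_smul, smul_eq_mul, sum_stdCov_smul]
  exact Finset.sum_congr rfl fun i _ => mul_comm _ _

theorem sum_swap (T : E4 →L[ℝ] E4 →L[ℝ] ℝ) :
    ∑ i, T (G.inverse (stdCov i)) (stdVec i) = ∑ i, T (stdVec i) (G.inverse (stdCov i)) := by
  have e (v w : E4) : T v w = ∑ j, stdCov j v * T (stdVec j) w := by
    conv_lhs => rw [← sum_stdCov_smul v]
    simp
  have e' (v w : E4) : T v w = ∑ j, stdCov j w * T v (stdVec j) := by
    conv_lhs => rw [← sum_stdCov_smul w]
    simp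
  calc ∑ i, T (G.inverse (stdCov i)) (stdVec i)
      = ∑ i, ∑ j, stdCov j (G.inverse (stdCov i)) * T (stdVec j) (stdVec i) :=
        Finset.sum_congr rfl fun i _ => e _ _
    _ = ∑ j, ∑ i, stdCov j (G.inverse (stdCov i)) * T (stdVec j) (stdVec i) := Finset.sum_comm
    _ = ∑ j, T (stdVec j) (G.inverse (stdCov j)) := by
        refine Finset.sum_congr rfl fun j _ => ?_
        rw [e']
        exact Finset.sum_congr rfl fun i _ => by rw [P.sharp_symm]

theorem sum_metric : ∑ i, G (stdVec i) (G.inverse (stdCov i)) = 4 := by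
  simp only [P.symm (stdVec _), P.inv.self_apply_inverse]
  simp [stdCov, stdVec]

/-- The trace with `q^{ab}` of a symmetric tensor whose pullback to null infinity vanishes. -/
theorem trace_eq_zero {k : E4 →L[ℝ] E4 →L[ℝ] ℝ} (hk : ∀ v w, k v w = k w v)
    (hT : ∀ v w, ν v = 0 → ν w = 0 → k v w = 0) :
    ∑ i, k (stdVec i) (G.inverse (stdCov i)) + 2 * k (G.inverse ν) l = 0 := by
  have e (v w : E4) : k v w = -(ν v * k l w) - k l v * ν w - k l l * ν v * ν w := by
    have h := hT (v + ν v • l) (w + ν w • l) (by simp [P.ν_l]) (by simp [P.ν_l])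
    simp only [map_add, map_smul, add_apply, smul_apply, smul_eq_mul, hk v l] at h
    linarith
  have h1 : ∑ i, k (stdVec i) (G.inverse (stdCov i)) = -(2 * k (G.inverse ν) l) := by
    rw [Finset.sum_congr rfl fun i _ => e _ _]
    simp only [Finset.sum_sub_distrib, Finset.sum_neg_distrib, P.sum_outer]
    have h2 := P.sum_outer (k l l • ν) ν
    simp only [smul_apply, smul_eq_mul] at h2
    rw [h2, P.null, P.sharp_symm ν, hk l]
    ring
  rw [h1]; ring

/-- The trace of the covariant derivative of a vector field that is conformal Killing on the
directions tangent to null infinity. -/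
theorem trace_conformal {T : E4 →L[ℝ] E4 →L[ℝ] ℝ} {α : ℝ} {φ : E4 →L[ℝ] ℝ}
    (hT : ∀ v w, ν v = 0 → ν w = 0 → T v w + T w v = 2 * α * G v w) :
    (∑ i, (T (stdVec i) (G.inverse (stdCov i)) - φ (stdVec i) * ν (G.inverse (stdCov i))))
      + (T (G.inverse ν) l - φ (G.inverse ν) * ν l) + (T l (G.inverse ν) - φ l * ν (G.inverse ν)) =
      2 * α := by
  have h := P.trace_eq_zero (k := T + T.flip - (2 * α) • G)
    (fun v w => by
      simp only [add_apply, sub_apply, smul_apply, ContinuousLinearMap.flip_apply, P.symm v w]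
      ring)
    (fun v w hv hw => by
      have := hT v w hv hw
      simp only [add_apply, sub_apply, smul_apply, ContinuousLinearMap.flip_apply, smul_eq_mul]
      linarith)
  simp only [add_apply, sub_apply, smul_apply, ContinuousLinearMap.flip_apply, smul_eq_mul,
    Finset.sum_add_distrib, Finset.sum_sub_distrib, P.sum_swap, ← Finset.mul_sum, P.sum_metric,
    P.G_n, P.ν_l] at h
  rw [Finset.sum_sub_distrib, P.sum_outer, P.ν_l, P.null]
  linarith

omit P in
/-- The stress-energy density. -/
theorem stress_density (F : E4 [⋀^Fin 2]→L[ℝ] ℝ) (X : E4) (b : ℝ) :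
    elecP F (G.inverse ν) (G.inverse (flatCov (F.curryLeft X))) =
      -(qP G (G.inverse ν) l (elecP F (G.inverse ν)) (flatCov (-F.curryLeft X)) +
        F ![l, G.inverse ν] * elecP F (G.inverse ν) (X - b • G.inverse ν)) := by
  have h : flatCov (F.curryLeft X) (G.inverse ν) = F ![X, G.inverse ν] := by
    rw [flatCov_apply]; rfl
  simp only [qP, flatCov_neg, map_neg, neg_apply, elecP_self, map_sub, map_smul]
  rw [h, elecP_apply F _ l, elecP_apply F _ X]
  simp only [smul_eq_mul]
  ring

end ScriPoint

end ScriTraces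

section Boundary

variable {M : Type*} [TopologicalSpace M] [ChartedSpace (EuclideanHalfSpace 4) M]

namespace Completion

variable (C : Completion M)

theorem vecAt_n (x : M) : vecAt C.n x = (bilinAt C.g x).inverse (dAt (𝓡∂ 4) C.Ω x) := rfl

theorem n_null {x : M} (hx : x ∈ (𝓡∂ 4).boundary M) :
    dAt (𝓡∂ 4) C.Ω x ((bilinAt C.g x).inverse (dAt (𝓡∂ 4) C.Ω x)) = 0 := by
  obtain ⟨c, hc⟩ := (C.bondi_norm x hx).bound
  have h := hc.self_of_nhds
  rw [C.Ω_boundary hx] at h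
  simp only [ne_eq, OfNat.ofNat_ne_zero, not_false_eq_true, zero_pow, norm_zero, mul_zero,
    norm_le_zero_iff] at h
  exact h

theorem smooth_n [IsManifold (𝓡∂ 4) ∞ M] : SmoothVField (𝓡∂ 4) C.n :=
  SmoothVField.sharp C.g_smooth C.g_isInvertible (SmoothForm.dFun C.Ω_smooth)

theorem exists_vol_ne (x : M) : ∃ b : Module.Basis (Fin 4) ℝ E4, formAt C.vol x b ≠ 0 := by
  obtain ⟨b, hb⟩ := C.g_lorentzian.2 x
  let b' : Module.Basis (Fin 4) ℝ E4 := b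
  refine ⟨b', fun h => ?_⟩
  have h1 := C.vol_isVolumeForm x b
  have h2 : (Matrix.of fun i j => C.g x (b i) (b j)) = Matrix.diagonal ![-1, 1, 1, 1] := by
    ext i j
    rw [Matrix.of_apply, hb]
    fin_cases i <;> fin_cases j <;> simp [Matrix.diagonal]
  rw [h2, Matrix.det_diagonal, show C.vol x b = 0 from h] at h1
  simp [Fin.prod_univ_four] at h1

namespace Foliation

variable {C} (S : C.Foliation)

theorem scriPoint {x : M} (hx : x ∈ (𝓡∂ 4).boundary M) :
    ScriPoint (bilinAt C.g x) (formAt C.vol x) (dAt (𝓡∂ 4) C.Ω x) (dAt (𝓡∂ 4) S.u x)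
      (vecAt S.l x) where
  symm := C.g_lorentzian.1 x
  inv := C.g_isInvertible x
  vol := C.vol_isVolumeForm x
  vol_ne := C.exists_vol_ne x
  null := C.n_null hx
  clock := S.u_normal x hx
  l_null := S.l_null x hx
  l_normal := S.l_normal x hx
  l_orth := S.l_orth x hx

theorem Φ_boundary (z : Scri) : S.Φ z ∈ (𝓡∂ 4).boundary M := S.Φ_range ▸ mem_range_self z

/-- The derivative of the inclusion of null infinity. -/
abbrev dΦ (z : Scri) : ℝ × EuclideanSpace ℝ (Fin 2) →L[ℝ] E4 := mapD (𝓡∂ 4) IN S.Φ z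

theorem dAt_comp {f : M → ℝ} (hf : ContMDiff (𝓡∂ 4) 𝓘(ℝ, ℝ) ∞ f) (z : Scri)
    (v : ℝ × EuclideanSpace ℝ (Fin 2)) :
    dAt IN (f ∘ S.Φ) z v = dAt (𝓡∂ 4) f (S.Φ z) (S.dΦ z v) := by
  have h := mfderiv_comp z ((hf (S.Φ z)).mdifferentiableAt (by simp))
    ((S.Φ_smooth z).mdifferentiableAt (by simp))
  exact congrArg (fun L : ℝ × EuclideanSpace ℝ (Fin 2) →L[ℝ] ℝ => L v) h

theorem dAt_tangent_of_eq_zero {f : M → ℝ} (hf : ContMDiff (𝓡∂ 4) 𝓘(ℝ, ℝ) ∞ f)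
    (h0 : ∀ x ∈ (𝓡∂ 4).boundary M, f x = 0) (z : Scri) (v : ℝ × EuclideanSpace ℝ (Fin 2)) :
    dAt (𝓡∂ 4) f (S.Φ z) (S.dΦ z v) = 0 := by
  rw [← S.dAt_comp hf]
  have : f ∘ S.Φ = fun _ => 0 := funext fun z => h0 _ (S.Φ_boundary z)
  rw [this, dAt, dFun, mfderiv_const]
  rfl

theorem dΩ_dΦ (z : Scri) (v : ℝ × EuclideanSpace ℝ (Fin 2)) :
    dAt (𝓡∂ 4) C.Ω (S.Φ z) (S.dΦ z v) = 0 :=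
  S.dAt_tangent_of_eq_zero C.Ω_smooth (fun _ hx => C.Ω_boundary hx) z v

theorem du_dΦ (z : Scri) (v : ℝ × EuclideanSpace ℝ (Fin 2)) :
    dAt (𝓡∂ 4) S.u (S.Φ z) (S.dΦ z v) = v.1 := by
  rw [← S.dAt_comp S.u_smooth]
  have : S.u ∘ S.Φ = Prod.fst := funext S.u_Φ
  rw [this, dAt, dFun]
  exact congrArg (fun L : ℝ × EuclideanSpace ℝ (Fin 2) →L[ℝ] ℝ => L v)
    (mfderiv_fst (I := 𝓘(ℝ, ℝ)) (I' := 𝓡 2) (x := z))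

/-- The vectors tangent to null infinity are those annihilated by `dΩ`. -/
theorem exists_dΦ_eq (z : Scri) {v : E4} (hv : dAt (𝓡∂ 4) C.Ω (S.Φ z) v = 0) :
    ∃ w, S.dΦ z w = v := by
  have hle : LinearMap.range (S.dΦ z : ℝ × EuclideanSpace ℝ (Fin 2) →ₗ[ℝ] E4) ≤
      LinearMap.ker (dAt (𝓡∂ 4) C.Ω (S.Φ z) : E4 →ₗ[ℝ] ℝ) := by
    rintro _ ⟨w, rfl⟩
    exact S.dΩ_dΦ z w
  have h1 : Module.finrank ℝ (LinearMap.range (S.dΦ z : ℝ × EuclideanSpace ℝ (Fin 2) →ₗ[ℝ] E4)) = 3 := by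
    have hinj : Function.Injective (S.dΦ z : ℝ × EuclideanSpace ℝ (Fin 2) →ₗ[ℝ] E4) := S.Φ_immersion z
    rw [LinearMap.finrank_range_of_inj hinj]
    simp
  have h2 : Module.finrank ℝ (LinearMap.ker (dAt (𝓡∂ 4) C.Ω (S.Φ z) : E4 →ₗ[ℝ] ℝ)) ≤ 3 := by
    have h3 := LinearMap.finrank_range_add_finrank_ker (dAt (𝓡∂ 4) C.Ω (S.Φ z) : E4 →ₗ[ℝ] ℝ)
    have h4 : LinearMap.range (dAt (𝓡∂ 4) C.Ω (S.Φ z) : E4 →ₗ[ℝ] ℝ) = ⊤ := by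
      rw [LinearMap.range_eq_top]
      refine LinearMap.surjective fun h => C.dΩ_ne_zero _ (S.Φ_boundary z) ?_
      ext w
      exact congrArg (fun L : E4 →ₗ[ℝ] ℝ => L w) h
    rw [h4] at h3
    simp at h3
    omega
  have h5 := Submodule.eq_of_le_of_finrank_le hle (by rw [h1]; exact h2)
  have : v ∈ LinearMap.range (S.dΦ z : ℝ × EuclideanSpace ℝ (Fin 2) →ₗ[ℝ] E4) := by rw [h5]; exact hv
  exact this

theorem exists_Φ_eq {x : M} (hx : x ∈ (𝓡∂ 4).boundary M) : ∃ z, S.Φ z = x :=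
  (S.Φ_range ▸ hx : x ∈ range S.Φ)

/-- Forms with the same values on vectors tangent to null infinity have the same pullback. -/
theorem pull_congr {k : ℕ} {η ζ : DForm (𝓡∂ 4) M k}
    (h : ∀ x ∈ (𝓡∂ 4).boundary M, ∀ v : Fin k → E4, (∀ i, dAt (𝓡∂ 4) C.Ω x (v i) = 0) →
      formAt η x v = formAt ζ x v) : S.pull η = S.pull ζ := by
  funext z
  change formAt (pullForm IN S.Φ η) z = formAt (pullForm IN S.Φ ζ) z
  ext v
  rw [formAt_pullForm_apply, formAt_pullForm_apply]
  exact h _ (S.Φ_boundary z) _ fun i => S.dΩ_dΦ z (v i)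

theorem eq_of_pull_eq {k : ℕ} {η ζ : DForm (𝓡∂ 4) M k} (h : S.pull η = S.pull ζ) {x : M}
    (hx : x ∈ (𝓡∂ 4).boundary M) {v : Fin k → E4} (hv : ∀ i, dAt (𝓡∂ 4) C.Ω x (v i) = 0) :
    formAt η x v = formAt ζ x v := by
  obtain ⟨z, rfl⟩ := S.exists_Φ_eq hx
  choose w hw using fun i => S.exists_dΦ_eq z (hv i)
  have h1 : formAt (pullForm IN S.Φ η) z w = formAt (pullForm IN S.Φ ζ) z w := by
    change formAt (S.pull η) z w = formAt (S.pull ζ) z w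
    rw [h]
  rw [formAt_pullForm_apply, formAt_pullForm_apply] at h1
  have h2 : (fun i => mapD (𝓡∂ 4) IN S.Φ z (w i)) = v := funext hw
  rwa [h2] at h1

include S in
theorem dAt_eq_zero {f : M → ℝ} (hf : ContMDiff (𝓡∂ 4) 𝓘(ℝ, ℝ) ∞ f)
    (h0 : ∀ x ∈ (𝓡∂ 4).boundary M, f x = 0) {x : M} (hx : x ∈ (𝓡∂ 4).boundary M) {v : E4}
    (hv : dAt (𝓡∂ 4) C.Ω x v = 0) : dAt (𝓡∂ 4) f x v = 0 := by
  obtain ⟨z, rfl⟩ := S.exists_Φ_eq hx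
  obtain ⟨w, rfl⟩ := S.exists_dΦ_eq z hv
  exact S.dAt_tangent_of_eq_zero hf h0 z w

end Foliation
end Completion
end Boundary

section BoundaryDerivatives

variable {M : Type*} [TopologicalSpace M] [ChartedSpace (EuclideanHalfSpace 4) M]
  [IsManifold (𝓡∂ 4) ∞ M]

theorem formAt_lieForm_eq {k : ℕ} {X : VField (𝓡∂ 4) M} (hX : SmoothVField (𝓡∂ 4) X)
    {η : DForm (𝓡∂ 4) M (k + 1)} (hη : SmoothForm (𝓡∂ 4) η) (x : M) (v : Fin (k + 1) → E4) :
    formAt (lieForm X η) x v =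
      lieP (vecDeriv X x) (formDeriv η x (vecAt X x)) (formAt η x) v := formAt_lieForm hX hη x v

theorem bilinAt_lieBilin_eq (X : VField (𝓡∂ 4) M) (g : BilinField (𝓡∂ 4) M) (x : M) (v w : E4) :
    bilinAt (lieBilin X g) x v w =
      lieG (vecDeriv X x) (bilinDeriv g x (vecAt X x)) (bilinAt g x) v w := bilinAt_lieBilin X g x v w

omit [IsManifold (𝓡∂ 4) ∞ M] in
theorem formDeriv_apply {k : ℕ} {η : DForm (𝓡∂ 4) M k} (hη : SmoothForm (𝓡∂ 4) η) (x : M) (u : E4)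
    (v : Fin k → E4) : formDeriv η x u v =
      fderivWithin ℝ (fun y => chartForm (𝓡∂ 4) η x y v) (range (𝓡∂ 4)) (extChartAt (𝓡∂ 4) x x) u :=
  (fderivWithin_continuousAlternatingMap_apply_const_apply (uniqueDiffWithinAt_range x)
    (hη.differentiableWithinAt x) v u).symm

omit [IsManifold (𝓡∂ 4) ∞ M] in
theorem formDeriv_neg {k : ℕ} (η : DForm (𝓡∂ 4) M k) (x : M) (u : E4) :
    formDeriv (fun y => -η y) x u = -formDeriv η x u := by
  have h : fderivWithin ℝ (-chartForm (𝓡∂ 4) η x) (range (𝓡∂ 4)) (extChartAt (𝓡∂ 4) x x) =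
      -formDeriv η x := fderivWithin_neg (uniqueDiffWithinAt_range (I := 𝓡∂ 4) x)
  exact congrArg (fun L : E4 →L[ℝ] E4 [⋀^Fin k]→L[ℝ] ℝ => L u) h

variable {g : BilinField (𝓡∂ 4) M} (hgs : SmoothBilin (𝓡∂ 4) g) (hg : IsLorentzian g)
include hgs

omit [IsManifold (𝓡∂ 4) ∞ M] in
theorem hasFDerivWithinAt_bilin (x : M) (v w : E4) :
    HasFDerivWithinAt (fun y => chartBilin (𝓡∂ 4) g x y v w)
      (((bilinDeriv g x).flip v).flip w) (range (𝓡∂ 4)) (extChartAt (𝓡∂ 4) x x) := by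
  have h := (hgs.differentiableWithinAt x).hasFDerivWithinAt
  have h1 := (h.clm_apply (hasFDerivWithinAt_const v _ _)).clm_apply (hasFDerivWithinAt_const w _ _)
  convert! h1 using 1
  ext u
  simp [bilinDeriv]

include hg

omit [IsManifold (𝓡∂ 4) ∞ M] in
theorem bilinDeriv_symm (x : M) (u v w : E4) : bilinDeriv g x u v w = bilinDeriv g x u w v := by
  have h1 := hasFDerivWithinAt_bilin hgs x v w
  have h2 := hasFDerivWithinAt_bilin hgs x w v
  have e : (fun y => chartBilin (𝓡∂ 4) g x y v w) = fun y => chartBilin (𝓡∂ 4) g x y w v :=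
    funext fun y => hg.1 _ _ _
  rw [e] at h1
  exact congrArg (fun L : E4 →L[ℝ] ℝ => L u) ((uniqueDiffWithinAt_range x).eq h1 h2)

omit hg in
/-- The derivative of the defining relation of a volume form. -/
theorem volDeriv {ε : DForm (𝓡∂ 4) M 4} (hε : SmoothForm (𝓡∂ 4) ε) (hv : IsVolumeForm g ε) (x : M)
    (u : E4) (v : Fin 4 → E4) :
    2 * formAt ε x v * formDeriv ε x u v =
      -fderiv ℝ (fun m : Fin 4 → Fin 4 → ℝ => (Matrix.of m).det)
        (fun i j => bilinAt g x (v i) (v j)) fun i j => bilinDeriv g x u (v i) (v j) := by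
  have h1 : HasFDerivWithinAt (fun y => chartForm (𝓡∂ 4) ε x y v)
      (fderivWithin ℝ (fun y => chartForm (𝓡∂ 4) ε x y v) (range (𝓡∂ 4)) (extChartAt (𝓡∂ 4) x x))
      (range (𝓡∂ 4)) (extChartAt (𝓡∂ 4) x x) := by
    refine DifferentiableWithinAt.hasFDerivWithinAt ?_
    exact ((contDiffOn_eval (V := fun i _ => v i) (hε x) fun _ => contDiffOn_const) _
      (mem_extChartAt_target x)).mono_of_mem_nhdsWithin (extChartAt_target_mem_nhdsWithin x)
      |>.differentiableWithinAt (by simp)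
  have h2 : HasFDerivWithinAt (fun y => fun i j => chartBilin (𝓡∂ 4) g x y (v i) (v j))
      (ContinuousLinearMap.pi fun i => ContinuousLinearMap.pi fun j =>
        ((bilinDeriv g x).flip (v i)).flip (v j)) (range (𝓡∂ 4)) (extChartAt (𝓡∂ 4) x x) :=
    hasFDerivWithinAt_pi.2 fun i => hasFDerivWithinAt_pi.2 fun j => hasFDerivWithinAt_bilin hgs x _ _
  have h3 := ((differentiable_det _).hasFDerivAt.comp_hasFDerivWithinAt _ h2).neg
  have h4 := h1.pow 2
  have h5 := (uniqueDiffWithinAt_range x).eq h4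
    (h3.congr_of_eventuallyEq (Eventually.of_forall fun y => hv _ _) (hv _ _))
  have h6 := congrArg (fun L : E4 →L[ℝ] ℝ => L u) h5
  rw [formDeriv_apply hε, ← chartForm_self, ← chartBilin_self]
  simpa using h6

/-- The derivative of `g(α♯, ·) = α`. -/
theorem sharpDeriv {β : DForm (𝓡∂ 4) M 1} (hβ : SmoothForm (𝓡∂ 4) β) (x : M) (u z : E4) :
    bilinDeriv g x u ((bilinAt g x).inverse (flatCov (formAt β x))) z
      + bilinAt g x (vecDeriv (fun y => sharp g y (covector (β y))) x u) z =
      flatCov (formDeriv β x u) z := by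
  have hW := SmoothVField.sharp hgs (bilinAt_isInvertible hg) hβ
  set W : VField (𝓡∂ 4) M := fun y => sharp g y (covector (β y))
  have hx := mem_extChartAt_target (I := 𝓡∂ 4) x
  have hWx : chartVField (𝓡∂ 4) W x (extChartAt (𝓡∂ 4) x x) =
      (bilinAt g x).inverse (flatCov (formAt β x)) := by rw [chartVField_self]; rfl
  have h1 := ((hgs.differentiableWithinAt x).hasFDerivWithinAt.clm_apply
    (hW.differentiableWithinAt x).hasFDerivWithinAt).clm_apply (hasFDerivWithinAt_const z _ _)
  have e : (fun y => chartBilin (𝓡∂ 4) g x y (chartVField (𝓡∂ 4) W x y) z) =ᶠ[𝓝[range (𝓡∂ 4)]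
      (extChartAt (𝓡∂ 4) x x)] fun y => chartForm (𝓡∂ 4) β x y ![z] := by
    filter_upwards [extChartAt_target_mem_nhdsWithin (I := 𝓡∂ 4) x] with y hy
    rw [chartVField_sharp (bilinAt_isInvertible hg) β hy,
      (chartBilin_isInvertible (bilinAt_isInvertible hg) hy).self_apply_inverse, flatCov_apply]
  have h2 := h1.fderivWithin (uniqueDiffWithinAt_range x)
  rw [e.fderivWithin_eq_of_mem (extChartAt_target_subset_range x hx)] at h2
  rw [flatCov_apply, formDeriv_apply hβ, h2, ← hWx, ← chartBilin_self]
  refine (add_comm _ _).trans ?_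
  simp only [add_apply, ContinuousLinearMap.comp_apply, ContinuousLinearMap.flip_apply, zero_apply,
    map_zero, zero_add]
  rfl

end BoundaryDerivatives

section Identities

variable {M : Type*} [TopologicalSpace M] [ChartedSpace (EuclideanHalfSpace 4) M]
  [IsManifold (𝓡∂ 4) ∞ M] {C : Completion M} (S : C.Foliation)
  {A : DForm (𝓡∂ 4) M 1} {X : VField (𝓡∂ 4) M} {lam : M → ℝ}

namespace Completion

theorem IsBMS.exists_conformal (hX : C.IsBMS X) {x : M} (hx : x ∈ (𝓡∂ 4).boundary M) :
    ∃ α : ℝ, vecDeriv C.n x (vecAt X x) - vecDeriv X x (vecAt C.n x) = -α • vecAt C.n x ∧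
      ∀ v w, dAt (𝓡∂ 4) C.Ω x v = 0 → dAt (𝓡∂ 4) C.Ω x w = 0 →
        lieG (vecDeriv X x) (bilinDeriv C.g x (vecAt X x)) (bilinAt C.g x) v w =
          2 * α * bilinAt C.g x v w := by
  obtain ⟨_, _, α, -, h⟩ := hX
  obtain ⟨-, h2, h3⟩ := h x hx
  refine ⟨α x, ?_, fun v w hv hw => ?_⟩
  · rw [← vecAt_mlieBracket]
    exact h2
  · rw [← bilinAt_lieBilin_eq]
    exact h3 v w hv hw

omit [IsManifold (𝓡∂ 4) ∞ M] in
theorem IsBMS.tangent (hX : C.IsBMS X) {x : M} (hx : x ∈ (𝓡∂ 4).boundary M) :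
    dAt (𝓡∂ 4) C.Ω x (vecAt X x) = 0 := hX.2.1 x hx

omit [IsManifold (𝓡∂ 4) ∞ M] in
theorem IsMaxwellPotential.gauge (hA : C.IsMaxwellPotential A) {x : M}
    (hx : x ∈ (𝓡∂ 4).boundary M) : flatCov (formAt A x) (vecAt C.n x) = 0 := hA.2.1 x hx

/-- The vector field `F^{ab} A_b`. -/
def raiseA (C : Completion M) (A : DForm (𝓡∂ 4) M 1) : VField (𝓡∂ 4) M :=
  fun y => raiseF C.g (fieldStrength A) y (covector (A y))

theorem smooth_raiseA (hA : SmoothForm (𝓡∂ 4) A) : SmoothVField (𝓡∂ 4) (C.raiseA A) :=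
  SmoothVField.raiseF C.g_lorentzian C.g_smooth hA.extD hA

namespace Foliation

include S in
/-- The Lie derivative of `(F^{ab} A_b) ⌟ ε` on vectors tangent to null infinity. -/
theorem lie_raiseA (hA : C.IsMaxwellPotential A) (hX : C.IsBMS X) {x : M}
    (hx : x ∈ (𝓡∂ 4).boundary M) {a b c : E4} (ha : dAt (𝓡∂ 4) C.Ω x a = 0)
    (hb : dAt (𝓡∂ 4) C.Ω x b = 0) (hc : dAt (𝓡∂ 4) C.Ω x c = 0) :
    formAt (lieForm X (currentForm C.vol (C.raiseA A))) x ![a, b, c] =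
      formAt C.vol x ![raiseP (bilinAt C.g x) (formAt (fieldStrength A) x)
        (flatCov (formAt (lieForm X A) x)) + raiseP (bilinAt C.g x)
        (formAt (lieForm X (fieldStrength A)) x) (flatCov (formAt A x)), a, b, c] := by
  have P := S.scriPoint hx
  obtain ⟨α, -, hT⟩ := hX.exists_conformal hx
  have hF : SmoothForm (𝓡∂ 4) (fieldStrength A) := hA.1.extD
  have hW := SmoothVField.sharp C.g_smooth C.g_isInvertible hA.1
  have hs := bilinDeriv_symm C.g_smooth C.g_lorentzian x (vecAt X x)
  have hLε := formAt_lieForm_eq hX.1 C.vol_smooth x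
  have hV := smooth_raiseA (C := C) hA.1
  refine (formAt_lieForm_eq hX.1 (C.vol_smooth.contract hV) x _).trans ?_
  rw [formDeriv_contract hV C.vol_smooth]
  refine P.lie_current (dF := formDeriv (fieldStrength A) x (vecAt X x))
    (dA := flatCov (formDeriv A x (vecAt X x)))
    (dw := vecDeriv (fun y => sharp C.g y (covector (A y))) x (vecAt X x)) hT hs
    (fun v => P.lie_vol hLε hs (volDeriv C.g_smooth C.vol_smooth C.vol_isVolumeForm x _)
      hT v) (sharpDeriv C.g_smooth C.g_lorentzian hA.1 x _) ?_ ?_ (formAt_lieForm_eq hX.1 hF x)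
      (hA.gauge hx) ha hb hc
  · intro z
    have h := sharpDeriv C.g_smooth C.g_lorentzian (hF.contract hW).neg x (vecAt X x) z
    refine h.trans ?_
    rw [formDeriv_neg, formDeriv_contract hW hF, flatCov_neg, neg_apply, flatCov_apply]
    rfl
  · intro z
    rw [flatCov_apply, formAt_lieForm_eq hX.1 hA.1]
    have e : Function.update ![z] 0 (vecDeriv X x z) = ![vecDeriv X x z] := by
      ext1 i; fin_cases i; rfl
    simp [lieP, flatCov_apply, e]

end Foliation
end Completion
end Identities


section PulledBackCurrents

variable {M : Type*} [TopologicalSpace M] [ChartedSpace (EuclideanHalfSpace 4) M]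

theorem formAt_currentForm (ε : DForm (𝓡∂ 4) M 4) (j : VField (𝓡∂ 4) M) (x : M) (v : Fin 3 → E4) :
    formAt (currentForm ε j) x v = formAt ε x ![vecAt j x, v 0, v 1, v 2] :=
  curryLeft_apply3 (formAt ε x) (vecAt j x) v

namespace Completion

variable (C : Completion M) (A : DForm (𝓡∂ 4) M 1) (X : VField (𝓡∂ 4) M) (lam : M → ℝ)

/-- The covector `F_{ab} n^b` at a point. -/
def elecAt (F : DForm (𝓡∂ 4) M 2) (x : M) : E4 →L[ℝ] ℝ := elecP (formAt F x) (vecAt C.n x)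

/-- The vector `g^{ab} β_b` at a point. -/
def sharpAt (β : E4 →L[ℝ] ℝ) (x : M) : E4 := (bilinAt C.g x).inverse β

theorem vecAt_noetherVec (x : M) : vecAt (noetherVec C.g A X lam) x =
    -(1 / (4 * Real.pi)) • raiseP (bilinAt C.g x) (formAt (fieldStrength A) x)
      (flatCov (formAt (deltaA A X lam) x))
      + (1 / (16 * Real.pi) * sqF C.g (fieldStrength A) x) • vecAt X x := rfl

theorem vecAt_canonicalVec (x : M) : vecAt (canonicalVec C.g A X lam) x =
    -(1 / (4 * Real.pi)) • (raiseP (bilinAt C.g x) (formAt (fieldStrength A) x)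
      (flatCov (formAt (deltaA A X lam) x)) - raiseP (bilinAt C.g x)
      (formAt (lieForm X (fieldStrength A)) x) (flatCov (formAt A x))) := rfl

theorem vecAt_stressVec (x : M) : vecAt (stressVec C.g A X) x =
    (1 / (4 * Real.pi)) • (raiseP (bilinAt C.g x) (formAt (fieldStrength A) x)
      (flatCov ((formAt (fieldStrength A) x).curryLeft (vecAt X x)))
      - (1 / 4 * sqF C.g (fieldStrength A) x) • vecAt X x) := rfl

namespace Foliation

variable {C} (S : C.Foliation) {A X lam} {x : M} (hx : x ∈ (𝓡∂ 4).boundary M) {v : Fin 3 → E4}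
  (hv : ∀ i, dAt (𝓡∂ 4) C.Ω x (v i) = 0)

/-- The volume element of null infinity on three tangent vectors. -/
def vol3At (x : M) (v : Fin 3 → E4) : ℝ := formAt C.vol x ![vecAt S.l x, v 0, v 1, v 2]

include S hx

theorem ν_raise (F : DForm (𝓡∂ 4) M 2) (β : E4 →L[ℝ] ℝ) :
    dAt (𝓡∂ 4) C.Ω x (raiseP (bilinAt C.g x) (formAt F x) β) = -C.elecAt F x (C.sharpAt β x) :=
  (S.scriPoint hx).ν_raiseP _ _

include hv

theorem vol_eq (w : E4) : formAt C.vol x ![w, v 0, v 1, v 2] =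
    -dAt (𝓡∂ 4) C.Ω x w * S.vol3At x v := (S.scriPoint hx).vol_normal w (hv 0) (hv 1) (hv 2)

theorem noether_tangent (hX : C.IsBMS X) :
    formAt (currentForm C.vol (noetherVec C.g A X lam)) x v =
      -(1 / (4 * Real.pi)) * C.elecAt (fieldStrength A) x
        (C.sharpAt (flatCov (formAt (deltaA A X lam) x)) x) * S.vol3At x v := by
  rw [formAt_currentForm, S.vol_eq hx hv, C.vecAt_noetherVec, map_add, map_smul, map_smul,
    S.ν_raise hx, hX.tangent hx, smul_eq_mul, smul_eq_mul]
  ring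

theorem canonical_tangent :
    formAt (currentForm C.vol (canonicalVec C.g A X lam)) x v =
      -(1 / (4 * Real.pi)) * (C.elecAt (fieldStrength A) x
        (C.sharpAt (flatCov (formAt (deltaA A X lam) x)) x) - C.elecAt (lieForm X (fieldStrength A)) x
        (C.sharpAt (flatCov (formAt A x)) x)) * S.vol3At x v := by
  rw [formAt_currentForm, S.vol_eq hx hv, C.vecAt_canonicalVec, map_smul, map_sub,
    S.ν_raise hx, S.ν_raise hx, smul_eq_mul]
  ring

theorem stress_tangent (hX : C.IsBMS X) :
    formAt (currentForm C.vol (stressVec C.g A X)) x v =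
      1 / (4 * Real.pi) * C.elecAt (fieldStrength A) x
        (C.sharpAt (flatCov ((formAt (fieldStrength A) x).curryLeft (vecAt X x))) x)
        * S.vol3At x v := by
  rw [formAt_currentForm, S.vol_eq hx hv, C.vecAt_stressVec, map_smul, map_sub, map_smul,
    S.ν_raise hx, hX.tangent hx, smul_eq_mul, smul_eq_mul]
  ring

variable [IsManifold (𝓡∂ 4) ∞ M]

/-- `d(f ⋆F) = df ∧ ⋆F` on null infinity. -/
theorem extD_smul_hodge_tangent (hA : C.IsMaxwellPotential A) {f : M → ℝ}
    (hf : ContMDiff (𝓡∂ 4) 𝓘(ℝ, ℝ) ∞ f) :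
    formAt (extD (𝓡∂ 4) fun y => f y • hodge C.g C.vol (fieldStrength A) y) x v =
      C.elecAt (fieldStrength A) x (C.sharpAt (dAt (𝓡∂ 4) f x) x) * S.vol3At x v := by
  have P := S.scriPoint hx
  have h0 : formAt (extD (𝓡∂ 4) (hodge C.g C.vol (fieldStrength A))) x = 0 := hA.extD_hodge hx
  have e0 : (0 : Fin 3).removeNth v = ![v 1, v 2] := by ext1 i; fin_cases i <;> rfl
  have e1 : (1 : Fin 3).removeNth v = ![v 0, v 2] := by ext1 i; fin_cases i <;> rfl
  have e2 : (2 : Fin 3).removeNth v = ![v 0, v 1] := by ext1 i; fin_cases i <;> rfl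
  rw [formAt_extD_fsmul hf (C.smooth_hodge hA.1), h0, Fin.sum_univ_three, e0, e1, e2, formAt_hodge]
  have h1 := wedge_hodgeP P.inv P.symm (formAt C.vol x) (formAt (fieldStrength A) x)
    (dAt (𝓡∂ 4) f x) (v 0) (v 1) (v 2)
  have h2 := P.vol_raiseP (formAt (fieldStrength A) x) (dAt (𝓡∂ 4) f x) (hv 0) (hv 1) (hv 2)
  refine Eq.trans ?_ (h1.trans h2)
  simp
  ring

end Foliation

variable {C A X lam}

theorem flatCov_deltaA' (x : M) :
    flatCov (formAt (deltaA A X lam) x) = flatCov (formAt (lieForm X A) x) + dAt (𝓡∂ 4) lam x := rfl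

theorem sharpAt_add (α β : E4 →L[ℝ] ℝ) (x : M) :
    C.sharpAt (α + β) x = C.sharpAt α x + C.sharpAt β x := map_add _ _ _

theorem boundaryN_eq : boundaryN C.g C.vol A X lam = fun x => -(1 / (4 * Real.pi)) •
    ((covector (A x) (X x) + lam x) • hodge C.g C.vol (fieldStrength A) x) := by
  funext x
  rw [boundaryN, smul_smul, smul_smul]
  congr 1
  ring

theorem boundaryC_eq : boundaryC C.g C.vol A X lam = fun x => (1 / (4 * Real.pi)) •
    (contract (X x) (currentForm C.vol (C.raiseA A) x)
      + lam x • hodge C.g C.vol (fieldStrength A) x) := by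
  funext x
  have h : contract (raiseF C.g (fieldStrength A) x (covector (A x))) (contract (X x) (C.vol x)) =
      -contract (X x) (currentForm C.vol (C.raiseA A) x) := by
    change ((formAt C.vol x).curryLeft (vecAt X x)).curryLeft (vecAt (C.raiseA A) x) =
      -((formAt C.vol x).curryLeft (vecAt (C.raiseA A) x)).curryLeft (vecAt X x)
    ext w
    rw [ContinuousAlternatingMap.neg_apply, curryLeft2_apply, curryLeft2_apply, four_form_swap]
  rw [boundaryC, h, smul_neg, smul_comm (lam x) (2 : ℝ), ← neg_add', ← smul_add, smul_neg, neg_smul,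
    neg_neg, smul_smul]
  congr 1
  ring

variable [IsManifold (𝓡∂ 4) ∞ M]

/-- `δA = X ⌟ F + d(X^a A_a + λ)`. -/
theorem flatCov_deltaA (hA : SmoothForm (𝓡∂ 4) A) (hX : SmoothVField (𝓡∂ 4) X)
    (hlam : ContMDiff (𝓡∂ 4) 𝓘(ℝ, ℝ) ∞ lam) (x : M) :
    flatCov (formAt (deltaA A X lam) x) =
      flatCov ((formAt (fieldStrength A) x).curryLeft (vecAt X x))
        + dAt (𝓡∂ 4) (fun y => covector (A y) (X y) + lam y) x := by
  have h1 := contMDiff_covector_apply hA hX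
  have h2 := formAt_extD_contract h1 x
  have h3 : dAt (𝓡∂ 4) (fun y => covector (A y) (X y) + lam y) x =
      dAt (𝓡∂ 4) (fun y => covector (A y) (X y)) x + dAt (𝓡∂ 4) lam x :=
    mfderiv_add ((h1 x).mdifferentiableAt (by simp)) ((hlam x).mdifferentiableAt (by simp))
  have h4 : formAt (deltaA A X lam) x = (formAt (fieldStrength A) x).curryLeft (vecAt X x)
      + formAt (extD (𝓡∂ 4) fun y => contract (X y) (A y)) x
      + ContinuousAlternatingMap.ofSubsingleton ℝ E4 ℝ (0 : Fin 1) (dAt (𝓡∂ 4) lam x) := rfl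
  rw [h4, h2, h3, flatCov_add, flatCov_add, add_assoc]
  rfl

namespace Foliation

variable (S : C.Foliation) {x : M} (hx : x ∈ (𝓡∂ 4).boundary M) {v : Fin 3 → E4}
  (hv : ∀ i, dAt (𝓡∂ 4) C.Ω x (v i) = 0) (hA : C.IsMaxwellPotential A) (hX : C.IsBMS X)
  (hlam : ContMDiff (𝓡∂ 4) 𝓘(ℝ, ℝ) ∞ lam)
include S hx hv hA hX hlam

theorem extD_boundaryN_tangent :
    formAt (extD (𝓡∂ 4) (boundaryN C.g C.vol A X lam)) x v = -(1 / (4 * Real.pi)) *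
      C.elecAt (fieldStrength A) x
        (C.sharpAt (dAt (𝓡∂ 4) (fun y => covector (A y) (X y) + lam y) x) x) * S.vol3At x v := by
  rw [boundaryN_eq, formAt_extD_const_smul, ContinuousAlternatingMap.smul_apply,
    S.extD_smul_hodge_tangent hx hv hA (f := fun y => covector (A y) (X y) + lam y)
      ((contMDiff_covector_apply hA.1 hX.1).add hlam), smul_eq_mul,
    mul_assoc]

theorem extD_boundaryC_tangent :
    formAt (extD (𝓡∂ 4) (boundaryC C.g C.vol A X lam)) x v = 1 / (4 * Real.pi) *
      (C.elecAt (fieldStrength A) x (C.sharpAt (flatCov (formAt (deltaA A X lam) x)) x)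
        + C.elecAt (lieForm X (fieldStrength A)) x (C.sharpAt (flatCov (formAt A x)) x))
        * S.vol3At x v := by
  have hV : SmoothForm (𝓡∂ 4) (currentForm C.vol (C.raiseA A)) :=
    C.vol_smooth.contract (smooth_raiseA hA.1)
  have h1 := S.lie_raiseA hA hX hx (hv 0) (hv 1) (hv 2)
  rw [S.vol_eq hx hv, map_add, S.ν_raise hx, S.ν_raise hx] at h1
  have hv' : ![v 0, v 1, v 2] = v := by ext1 i; fin_cases i <;> rfl
  rw [hv'] at h1
  have h2 : formAt (lieForm X (currentForm C.vol (C.raiseA A))) x v =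
      (formAt (extD (𝓡∂ 4) (currentForm C.vol (C.raiseA A))) x).curryLeft (vecAt X x) v +
      formAt (extD (𝓡∂ 4) fun y => contract (X y) (currentForm C.vol (C.raiseA A) y)) x v := rfl
  have h3 : (formAt (extD (𝓡∂ 4) (currentForm C.vol (C.raiseA A))) x).curryLeft (vecAt X x) v = 0 := by
    rw [curryLeft_apply3]
    refine four_form_hyperplane _ (S.scriPoint hx).ν_ne fun i => ?_
    fin_cases i
    exacts [hX.tangent hx, hv 0, hv 1, hv 2]
  rw [h3, zero_add] at h2
  rw [boundaryC_eq, formAt_extD_const_smul, formAt_extD_add (hV.contract hX.1)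
    ((C.smooth_hodge hA.1).fsmul hlam), ContinuousAlternatingMap.smul_apply,
    ContinuousAlternatingMap.add_apply, S.extD_smul_hodge_tangent hx hv hA hlam, ← h2, h1,
    flatCov_deltaA', sharpAt_add, map_add, smul_eq_mul]
  ring

omit hx hv in
/-- `J_N = ½ (J_C - dQ_C)` on null infinity. -/
theorem pull_noether : S.pull (currentForm C.vol (noetherVec C.g A X lam)) =
    (1 / 2 : ℝ) • (S.pull (currentForm C.vol (canonicalVec C.g A X lam))
      - extD IN (S.pull (boundaryC C.g C.vol A X lam))) := by
  have hs := smooth_boundaryC C.g_lorentzian C.g_smooth C.vol_smooth hA.1 hX.1 hlam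
  have h1 : extD IN (S.pull (boundaryC C.g C.vol A X lam)) =
      S.pull (extD (𝓡∂ 4) (boundaryC C.g C.vol A X lam)) := extD_pullForm hs S.Φ_smooth
  rw [h1]
  refine (S.pull_congr (ζ := fun x => (1 / 2 : ℝ) • (currentForm C.vol (canonicalVec C.g A X lam) x
    - extD (𝓡∂ 4) (boundaryC C.g C.vol A X lam) x)) fun x hx v hv => ?_).trans rfl
  have h2 : formAt (fun x => (1 / 2 : ℝ) • (currentForm C.vol (canonicalVec C.g A X lam) x
    - extD (𝓡∂ 4) (boundaryC C.g C.vol A X lam) x)) x v = 1 / 2 *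
      (formAt (currentForm C.vol (canonicalVec C.g A X lam)) x v -
        formAt (extD (𝓡∂ 4) (boundaryC C.g C.vol A X lam)) x v) := rfl
  rw [h2, S.noether_tangent hx hv hX, S.canonical_tangent hx hv,
    S.extD_boundaryC_tangent hx hv hA hX hlam]
  ring

omit hx hv in
/-- `J_T = -J_N + dQ_N` on null infinity. -/
theorem pull_stress : S.pull (currentForm C.vol (stressVec C.g A X)) =
    -S.pull (currentForm C.vol (noetherVec C.g A X lam))
      + extD IN (S.pull (boundaryN C.g C.vol A X lam)) := by
  have hs := smooth_boundaryN C.g_lorentzian C.g_smooth C.vol_smooth hA.1 hX.1 hlam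
  have h1 : extD IN (S.pull (boundaryN C.g C.vol A X lam)) =
      S.pull (extD (𝓡∂ 4) (boundaryN C.g C.vol A X lam)) := extD_pullForm hs S.Φ_smooth
  rw [h1]
  refine (S.pull_congr (ζ := fun x => -currentForm C.vol (noetherVec C.g A X lam) x
    + extD (𝓡∂ 4) (boundaryN C.g C.vol A X lam) x) fun x hx v hv => ?_).trans rfl
  have h2 : formAt (fun x => -currentForm C.vol (noetherVec C.g A X lam) x
    + extD (𝓡∂ 4) (boundaryN C.g C.vol A X lam) x) x v =
      -formAt (currentForm C.vol (noetherVec C.g A X lam)) x v +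
        formAt (extD (𝓡∂ 4) (boundaryN C.g C.vol A X lam)) x v := rfl
  rw [h2, S.noether_tangent hx hv hX, S.stress_tangent hx hv hX,
    S.extD_boundaryN_tangent hx hv hA hX hlam, flatCov_deltaA hA.1 hX.1 hlam, sharpAt_add, map_add]
  ring

end Foliation
end Completion
end PulledBackCurrents

section Densities

variable {M : Type*} [TopologicalSpace M] [ChartedSpace (EuclideanHalfSpace 4) M]

namespace Completion
namespace Foliation

variable {C : Completion M} (S : C.Foliation) {A : DForm (𝓡∂ 4) M 1} {X : VField (𝓡∂ 4) M}
  {lam : M → ℝ} {x : M}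

theorem qInv_eq (α β : DForm (𝓡∂ 4) M 1) (x : M) : S.qInv (α x) (β x) =
    qP (bilinAt C.g x) (vecAt C.n x) (vecAt S.l x) (flatCov (formAt α x)) (flatCov (formAt β x)) := rfl

theorem flatCov_electric (A : DForm (𝓡∂ 4) M 1) (x : M) :
    flatCov (formAt (C.electric A) x) = C.elecAt (fieldStrength A) x := rfl

theorem qInv_of_normal {α β : DForm (𝓡∂ 4) M 1} (hα : flatCov (formAt α x) (vecAt C.n x) = 0)
    (hβ : flatCov (formAt β x) (vecAt C.n x) = 0) :
    S.qInv (α x) (β x) = flatCov (formAt α x) (C.sharpAt (flatCov (formAt β x)) x) :=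
  (S.qInv_eq α β x).trans (qP_eq_of_normal hα hβ)

theorem elecAt_n (F : DForm (𝓡∂ 4) M 2) (x : M) : C.elecAt F x (vecAt C.n x) = 0 := elecP_self _ _

theorem vol3_eq {η : DForm (𝓡∂ 4) M 3} {f : M → ℝ} (h : ∀ x ∈ (𝓡∂ 4).boundary M, ∀ v : Fin 3 → E4,
    (∀ i, dAt (𝓡∂ 4) C.Ω x (v i) = 0) → formAt η x v = f x * S.vol3At x v) :
    S.pull η = S.vol3 f := by
  refine S.pull_congr fun x hx v hv => (h x hx v hv).trans ?_
  change _ = f x * (formAt C.vol x).curryLeft (vecAt S.l x) v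
  rw [curryLeft_apply3]
  rfl

theorem densT_eq (A : DForm (𝓡∂ 4) M 1) (X : VField (𝓡∂ 4) M) (x : M) : S.densT A X x =
    -C.elecAt (fieldStrength A) x
        (C.sharpAt (flatCov ((formAt (fieldStrength A) x).curryLeft (vecAt X x))) x) := by
  have h : S.densT A X x = qP (bilinAt C.g x) (vecAt C.n x) (vecAt S.l x)
      (C.elecAt (fieldStrength A) x) (flatCov (-(formAt (fieldStrength A) x).curryLeft (vecAt X x)))
      + 2 * (1 / 2 * formAt (fieldStrength A) x ![vecAt S.l x, vecAt C.n x]) *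
        C.elecAt (fieldStrength A) x (vecAt X x - S.beta X x • vecAt C.n x) := rfl
  have h2 := ScriPoint.stress_density (G := bilinAt C.g x) (ν := dAt (𝓡∂ 4) C.Ω x) (l := vecAt S.l x)
    (formAt (fieldStrength A) x) (vecAt X x) (S.beta X x)
  rw [h]
  change _ = -elecP _ _ _
  refine Eq.trans ?_ (neg_eq_iff_eq_neg.2 h2).symm
  congr 1
  rw [← mul_assoc, mul_one_div_cancel two_ne_zero, one_mul]
  rfl

theorem pull_stress_eq (hX : C.IsBMS X) : S.pull (currentForm C.vol (stressVec C.g A X)) =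
    S.vol3 fun x => -(1 / (4 * Real.pi)) * S.densT A X x :=
  S.vol3_eq fun x hx v hv => by
    rw [S.stress_tangent hx hv hX, densT_eq]
    ring

variable [IsManifold (𝓡∂ 4) ∞ M] (hx : x ∈ (𝓡∂ 4).boundary M) (hA : C.IsMaxwellPotential A)
  (hX : C.IsBMS X) (hlam : ∀ x ∈ (𝓡∂ 4).boundary M, dFun (𝓡∂ 4) lam x (C.n x) = 0)

include S hx hA hX

theorem lieA_n : flatCov (formAt (lieForm X A) x) (vecAt C.n x) = 0 := by
  obtain ⟨α, hα, -⟩ := hX.exists_conformal hx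
  have hs := contMDiff_covector_apply hA.1 C.smooth_n
  have h0 := S.dAt_eq_zero hs hA.2.1 hx (hX.tangent hx)
  have h1 : formAt (extD (𝓡∂ 4) fun y => contract (C.n y) (A y)) x ![vecAt X x] =
      dAt (𝓡∂ 4) (fun y => covector (A y) (C.n y)) x (vecAt X x) := by
    rw [formAt_extD_contract hs]
    rfl
  have h2 : formAt (extD (𝓡∂ 4) fun y => contract (C.n y) (A y)) x ![vecAt X x] =
      formDeriv A x (vecAt X x) ![vecAt C.n x] + formAt A x ![vecDeriv C.n x (vecAt X x)] := by
    have h3 : formAt (extD (𝓡∂ 4) fun y => contract (C.n y) (A y)) x ![vecAt X x] =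
        formDeriv (fun y => contract (C.n y) (A y)) x (vecAt X x) ![] := by
      rw [formAt_extD, extDerivWithin, ContinuousAlternatingMap.alternatizeUncurryFin_apply]
      refine (Fin.sum_univ_one _).trans ((one_smul ℤ _).trans ?_)
      exact congrArg (formDeriv (fun y => contract (C.n y) (A y)) x (vecAt X x))
        (Subsingleton.elim _ _)
    rw [h3, formDeriv_contract C.smooth_n hA.1]
    rfl
  have e : Function.update ![vecAt C.n x] 0 (vecDeriv X x (vecAt C.n x)) =
      ![vecDeriv X x (vecAt C.n x)] := by
    ext1 i; fin_cases i; rfl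
  have hgauge := hA.gauge hx
  have hα' := congrArg (flatCov (formAt A x)) hα
  rw [map_smul, hgauge, smul_zero, map_sub, flatCov_apply, flatCov_apply] at hα'
  rw [h1, h0] at h2
  rw [flatCov_apply, formAt_lieForm_eq hX.1 hA.1, lieP, Fin.sum_univ_one]
  change _ + formAt A x (Function.update ![vecAt C.n x] 0 (vecDeriv X x (vecAt C.n x))) = 0
  rw [e]
  linarith

include hlam in
theorem deltaA_n : flatCov (formAt (deltaA A X lam) x) (vecAt C.n x) = 0 := by
  rw [flatCov_deltaA', add_apply, S.lieA_n hx hA hX, zero_add]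
  exact hlam x hx

include hlam in
theorem densN_eq : S.densN A X lam x = C.elecAt (fieldStrength A) x
    (C.sharpAt (flatCov (formAt (deltaA A X lam) x)) x) :=
  S.qInv_of_normal (elecAt_n _ x) (S.deltaA_n hx hA hX hlam)

omit S hx in
/-- `L_X E_a = -α E_a + (L_X F)_{ab} n^b`. -/
theorem lie_electric {α : ℝ}
    (hα : vecDeriv C.n x (vecAt X x) - vecDeriv X x (vecAt C.n x) = -α • vecAt C.n x) :
    flatCov (formAt (lieForm X (C.electric A)) x) =
      -α • C.elecAt (fieldStrength A) x + C.elecAt (lieForm X (fieldStrength A)) x := by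
  have hF : SmoothForm (𝓡∂ 4) (fieldStrength A) := hA.1.extD
  have hE : SmoothForm (𝓡∂ 4) (C.electric A) := (hF.contract C.smooth_n).neg
  ext w
  rw [flatCov_apply, formAt_lieForm_eq hX.1 hE]
  have h1 : formDeriv (C.electric A) x (vecAt X x) =
      -((formDeriv (fieldStrength A) x (vecAt X x)).curryLeft (vecAt C.n x)
        + (formAt (fieldStrength A) x).curryLeft (vecDeriv C.n x (vecAt X x))) :=
    (formDeriv_neg _ x _).trans (congrArg Neg.neg (formDeriv_contract C.smooth_n hF x _))
  have h2 : formAt (C.electric A) x = -(formAt (fieldStrength A) x).curryLeft (vecAt C.n x) := rfl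
  have h3 (D : E4 →L[ℝ] E4) (dη η : E4 [⋀^Fin 1]→L[ℝ] ℝ) (v : Fin 1 → E4) :
      lieP D (-dη) (-η) v = -lieP D dη η v := by
    simp only [lieP, ContinuousAlternatingMap.neg_apply, Finset.sum_neg_distrib]
    ring
  rw [h1, h2, h3, lieP_curryLeft, hα, ← formAt_lieForm_eq hX.1 hF]
  simp only [elecAt, add_apply, smul_apply, elecP_apply, smul_eq_mul]
  rw [two_form_swap _ w, two_form_swap _ w]
  have h4 : formAt (fieldStrength A) x (Matrix.vecCons (-α • vecAt C.n x) ![w]) =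
      -α * formAt (fieldStrength A) x ![vecAt C.n x, w] :=
    (formAt (fieldStrength A) x).toAlternatingMap.map_vecCons_smul _ _ _
  rw [h4]
  ring

omit hA in
/-- On null infinity `𝒟_a Y^a = 2α`. -/
theorem divY_eq {α : ℝ} (hT : ∀ v w, dAt (𝓡∂ 4) C.Ω x v = 0 → dAt (𝓡∂ 4) C.Ω x w = 0 →
        lieG (vecDeriv X x) (bilinDeriv C.g x (vecAt X x)) (bilinAt C.g x) v w =
          2 * α * bilinAt C.g x v w) : S.divY X x = 2 * α := by
  have P := S.scriPoint hx
  have hβ : ContMDiff (𝓡∂ 4) 𝓘(ℝ, ℝ) ∞ (S.beta X) :=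
    contMDiff_covector_apply (SmoothForm.dFun S.u_smooth) hX.1
  have hn : bilinAt (nablaLow C.g C.n) x = 0 := C.bondi x hx
  have hsymm := bilinDeriv_symm C.g_smooth C.g_lorentzian x
  have hY : vecDeriv (S.Y X) x = fun u => vecDeriv X x u - S.beta X x • vecDeriv C.n x u -
      dAt (𝓡∂ 4) (S.beta X) x u • vecAt C.n x :=
    funext fun u => vecDeriv_sub_fsmul hX.1 C.smooth_n hβ x u
  have hYx : vecAt (S.Y X) x = vecAt X x - S.beta X x • vecAt C.n x := rfl
  have key (v w : E4) : bilinAt (nablaLow C.g (S.Y X)) x v w = bilinAt (nablaLow C.g X) x v w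
      - dAt (𝓡∂ 4) (S.beta X) x v * dAt (𝓡∂ 4) C.Ω x w := by
    have h1 : bilinAt (nablaLow C.g C.n) x v w = 0 := by rw [hn]; rfl
    have h2 : bilinAt C.g x (vecAt C.n x) w = dAt (𝓡∂ 4) C.Ω x w := P.G_n w
    rw [bilinAt_nablaLow] at h1
    rw [bilinAt_nablaLow, bilinAt_nablaLow, congrFun hY, hYx, ← h2]
    simp only [map_sub, map_smul, sub_apply, smul_apply, smul_eq_mul]
    linear_combination -S.beta X x * h1
  have h := P.trace_conformal (T := bilinAt (nablaLow C.g X) x) (φ := dAt (𝓡∂ 4) (S.beta X) x)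
    (fun v w hv hw => by
      rw [← hT v w hv hw, bilinAt_nablaLow, bilinAt_nablaLow, lieG, hsymm v _ w, hsymm w _ v,
        hsymm (vecAt X x) w v, P.symm v (vecDeriv X x w), hsymm v w, hsymm w v]
      ring)
  refine Eq.trans ?_ h
  change (∑ i : Fin 4, bilinAt (nablaLow C.g (S.Y X)) x (stdVec i)
    ((bilinAt C.g x).inverse (stdCov i))) + bilinAt (nablaLow C.g (S.Y X)) x (vecAt C.n x) (vecAt S.l x)
    + bilinAt (nablaLow C.g (S.Y X)) x (vecAt S.l x) (vecAt C.n x) = _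
  simp only [key]
  rfl

include hlam in
theorem densC_eq : S.densC A X lam x = C.elecAt (fieldStrength A) x
    (C.sharpAt (flatCov (formAt (deltaA A X lam) x)) x)
      - C.elecAt (lieForm X (fieldStrength A)) x (C.sharpAt (flatCov (formAt A x)) x) := by
  have P := S.scriPoint hx
  obtain ⟨α, hα, hT⟩ := hX.exists_conformal hx
  have hE := lie_electric hA hX hα
  have hEn : flatCov (formAt (lieForm X (C.electric A)) x) (vecAt C.n x) = 0 := by
    rw [hE, add_apply, smul_apply, elecAt_n, elecAt_n, smul_zero, add_zero]
  have h1 := S.densN_eq hx hA hX hlam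
  rw [densN] at h1
  rw [densC, h1, S.qInv_of_normal (hA.gauge hx) hEn, S.divY_eq hx hX hT,
    S.qInv_of_normal (α := C.electric A) (elecAt_n (fieldStrength A) x) (hA.gauge hx), hE, flatCov_electric]
  have h2 (γ : E4 →L[ℝ] ℝ) : flatCov (formAt A x) (C.sharpAt γ x) =
    γ (C.sharpAt (flatCov (formAt A x)) x) := P.sharp_symm _ _
  rw [h2, add_apply, smul_apply, smul_eq_mul]
  ring

omit hx in
include hlam in
theorem pull_canonical_eq : S.pull (currentForm C.vol (canonicalVec C.g A X lam)) =
    S.vol3 fun x => -(1 / (4 * Real.pi)) * S.densC A X lam x :=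
  S.vol3_eq fun x hx v hv => by
    rw [S.canonical_tangent hx hv, S.densC_eq hx hA hX hlam]

omit hx in
include hlam in
theorem pull_noether_eq : S.pull (currentForm C.vol (noetherVec C.g A X lam)) =
    S.vol3 fun x => -(1 / (4 * Real.pi)) * S.densN A X lam x :=
  S.vol3_eq fun x hx v hv => by
    rw [S.noether_tangent hx hv hX, S.densN_eq hx hA hX hlam]

omit hx hX in
include hlam in
/-- `d(λ ⋆F) = q^{ab} E_a 𝒟_b λ ε₃` on null infinity. -/
theorem pull_extD_coulomb (hlam' : ContMDiff (𝓡∂ 4) 𝓘(ℝ, ℝ) ∞ lam) :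
    S.pull (extD (𝓡∂ 4) fun y => lam y • hodge C.g C.vol (fieldStrength A) y) =
      S.vol3 fun x => S.qInv (C.electric A x) (oneForm (dFun (𝓡∂ 4) lam x)) :=
  S.vol3_eq fun x hx v hv => by
    rw [S.extD_smul_hodge_tangent hx hv hA hlam']
    exact congrArg (· * S.vol3At x v) (S.qInv_of_normal (α := C.electric A)
      (β := fun x => oneForm (dFun (𝓡∂ 4) lam x)) (elecAt_n _ x) (hlam x hx)).symm

end Foliation
end Completion
end Densities

section RadiativePart

variable {M : Type*} [TopologicalSpace M] [ChartedSpace (EuclideanHalfSpace 4) M]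

namespace Completion
namespace Foliation

variable {C : Completion M} (S : C.Foliation) {A A₂ : DForm (𝓡∂ 4) M 1} {X : VField (𝓡∂ 4) M}
  {lam : M → ℝ} {x : M}

theorem vol3_congr {f g : M → ℝ} (h : ∀ x ∈ (𝓡∂ 4).boundary M, f x = g x) :
    S.vol3 f = S.vol3 g :=
  S.vol3_eq fun x hx v _ => by
    rw [← h x hx, vol3At, ← curryLeft_apply3]
    rfl

theorem vol3_const_mul (c : ℝ) (f : M → ℝ) : S.vol3 (fun x => c * f x) = c • S.vol3 f := by
  funext z
  change formAt (S.vol3 fun x => c * f x) z = c • formAt (S.vol3 f) z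
  ext v
  exact mul_assoc c (f (S.Φ z)) _

theorem vol3_sub (f g : M → ℝ) : S.vol3 (fun x => f x - g x) = S.vol3 f - S.vol3 g := by
  funext z
  change formAt (S.vol3 fun x => f x - g x) z = formAt (S.vol3 f) z - formAt (S.vol3 g) z
  ext v
  exact sub_mul (f (S.Φ z)) (g (S.Φ z)) _

theorem vol2_const_mul (c : ℝ) (f : M → ℝ) : S.vol2 (fun x => c * f x) = c • S.vol2 f := by
  funext z
  change formAt (S.vol2 fun x => c * f x) z = c • formAt (S.vol2 f) z
  ext v
  exact mul_assoc c (f (S.Φ z)) _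

section Tangent

variable (hx : x ∈ (𝓡∂ 4).boundary M)
include S hx

theorem elecAt_congr {F F₂ : DForm (𝓡∂ 4) M 2} (h : S.pull F₂ = S.pull F) {w : E4}
    (hw : dAt (𝓡∂ 4) C.Ω x w = 0) : C.elecAt F₂ x w = C.elecAt F x w := by
  rw [elecAt, elecAt, elecP_apply, elecP_apply]
  refine S.eq_of_pull_eq h hx fun i => ?_
  fin_cases i
  exacts [hw, C.n_null hx]

theorem elecAt_sharp_congr {F F₂ : DForm (𝓡∂ 4) M 2} (h : S.pull F₂ = S.pull F)
    {β β₂ : DForm (𝓡∂ 4) M 1} (hβ : S.pull β₂ = S.pull β)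
    (h1 : flatCov (formAt β x) (vecAt C.n x) = 0) :
    C.elecAt F₂ x (C.sharpAt (flatCov (formAt β₂ x)) x) =
      C.elecAt F x (C.sharpAt (flatCov (formAt β x)) x) := by
  have P := S.scriPoint hx
  have hβ' (w : E4) (hw : dAt (𝓡∂ 4) C.Ω x w = 0) :
      flatCov (formAt β₂ x) w = flatCov (formAt β x) w := by
    rw [flatCov_apply, flatCov_apply]
    exact S.eq_of_pull_eq hβ hx fun i => by fin_cases i; exact hw
  have h2 : flatCov (formAt β₂ x) (vecAt C.n x) = 0 := (hβ' _ (C.n_null hx)).trans h1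
  have e1 := qP_eq_of_normal (G := bilinAt C.g x) (l := vecAt S.l x) (elecAt_n F x) h1
  have e2 := qP_eq_of_normal (G := bilinAt C.g x) (l := vecAt S.l x) (elecAt_n F₂ x) h2
  rw [sharpAt, sharpAt, ← e1, ← e2]
  exact P.qP_congr (fun w hw => S.elecAt_congr hx h hw) hβ'

end Tangent

theorem pull_contract {k : ℕ} {η η₂ : DForm (𝓡∂ 4) M (k + 1)} (h : S.pull η₂ = S.pull η)
    (hX : C.IsBMS X) : S.pull (fun y => contract (X y) (η₂ y)) =
      S.pull fun y => contract (X y) (η y) :=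
  S.pull_congr fun x hx v hv => by
    rw [formAt_contract, formAt_contract, ContinuousAlternatingMap.curryLeft_apply_apply,
      ContinuousAlternatingMap.curryLeft_apply_apply]
    exact S.eq_of_pull_eq h hx (Fin.cases (hX.tangent hx) hv)

theorem pull_add {k : ℕ} (η ζ : DForm (𝓡∂ 4) M k) :
    S.pull (fun y => η y + ζ y) = S.pull η + S.pull ζ := rfl

variable [IsManifold (𝓡∂ 4) ∞ M]

theorem pull_extD {k : ℕ} {η : DForm (𝓡∂ 4) M k} (hη : SmoothForm (𝓡∂ 4) η) :
    S.pull (extD (𝓡∂ 4) η) = extD IN (S.pull η) := (extD_pullForm hη S.Φ_smooth).symm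

theorem pull_lieForm {k : ℕ} {η η₂ : DForm (𝓡∂ 4) M (k + 1)} (hη : SmoothForm (𝓡∂ 4) η)
    (hη₂ : SmoothForm (𝓡∂ 4) η₂) (h : S.pull η₂ = S.pull η) (hX : C.IsBMS X) :
    S.pull (lieForm X η₂) = S.pull (lieForm X η) := by
  have h1 : S.pull (extD (𝓡∂ 4) η₂) = S.pull (extD (𝓡∂ 4) η) := by
    rw [S.pull_extD hη₂, S.pull_extD hη, h]
  have h2 := S.pull_contract h hX
  refine (S.pull_add (fun y => contract (X y) (extD (𝓡∂ 4) η₂ y))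
    (extD (𝓡∂ 4) fun y => contract (X y) (η₂ y))).trans ?_
  rw [S.pull_contract h1 hX, S.pull_extD (hη₂.contract hX.1), h2, ← S.pull_extD (hη.contract hX.1)]
  rfl

section Comparison

variable (hA : C.IsMaxwellPotential A) (hA₂ : C.IsMaxwellPotential A₂) (h : S.pull A₂ = S.pull A)
  (hX : C.IsBMS X) (hlam : ∀ x ∈ (𝓡∂ 4).boundary M, dFun (𝓡∂ 4) lam x (C.n x) = 0)
include hA hA₂ h

theorem pull_fieldStrength : S.pull (fieldStrength A₂) = S.pull (fieldStrength A) := by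
  rw [fieldStrength, fieldStrength, S.pull_extD hA₂.1, S.pull_extD hA.1, h]

include hX

theorem pull_deltaA : S.pull (deltaA A₂ X lam) = S.pull (deltaA A X lam) := by
  refine (S.pull_add (lieForm X A₂) _).trans ?_
  rw [S.pull_lieForm hA.1 hA₂.1 h hX]
  rfl

include hlam

theorem pull_canonical_congr : S.pull (currentForm C.vol (canonicalVec C.g A₂ X lam)) =
    S.pull (currentForm C.vol (canonicalVec C.g A X lam)) :=
  S.pull_congr fun x hx v hv => by
    have hF := S.pull_fieldStrength hA hA₂ h
    have hLF : S.pull (lieForm X (fieldStrength A₂)) = S.pull (lieForm X (fieldStrength A)) :=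
      S.pull_lieForm hA.1.extD hA₂.1.extD hF hX
    rw [S.canonical_tangent hx hv, S.canonical_tangent hx hv,
      S.elecAt_sharp_congr hx hF (S.pull_deltaA hA hA₂ h hX) (S.deltaA_n hx hA hX hlam),
      S.elecAt_sharp_congr hx hLF h (hA.gauge hx)]

theorem pull_noether_congr : S.pull (currentForm C.vol (noetherVec C.g A₂ X lam)) =
    S.pull (currentForm C.vol (noetherVec C.g A X lam)) :=
  S.pull_congr fun x hx v hv => by
    have hF := S.pull_fieldStrength hA hA₂ h
    rw [S.noether_tangent hx hv hX, S.noether_tangent hx hv hX,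
      S.elecAt_sharp_congr hx hF (S.pull_deltaA hA hA₂ h hX) (S.deltaA_n hx hA hX hlam)]

omit hlam in
theorem pull_stress_sub : S.pull (currentForm C.vol (stressVec C.g A₂ X)) -
    S.pull (currentForm C.vol (stressVec C.g A X)) =
      S.vol3 fun x => -(1 / (2 * Real.pi)) *
        ((S.rePhi1 A₂ x - S.rePhi1 A x) * covector (C.electric A x) (S.Y X x)) := by
  rw [S.pull_stress_eq hX, S.pull_stress_eq hX, ← S.vol3_sub]
  refine S.vol3_congr fun x hx => ?_
  have P := S.scriPoint hx
  have hF := S.pull_fieldStrength hA hA₂ h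
  have hY : dAt (𝓡∂ 4) C.Ω x (vecAt X x - S.beta X x • vecAt C.n x) = 0 := by
    rw [map_sub, map_smul, hX.tangent hx, vecAt_n, C.n_null hx, smul_zero, sub_zero]
  have h1 : covector (C.electric A₂ x) (S.Y X x) = covector (C.electric A x) (S.Y X x) :=
    S.elecAt_congr hx hF hY
  have h2 : S.qInv (C.electric A₂ x) (-contract (X x) (fieldStrength A₂ x)) =
      S.qInv (C.electric A x) (-contract (X x) (fieldStrength A x)) := by
    refine P.qP_congr (fun w hw => S.elecAt_congr hx hF hw) fun w hw => ?_
    refine congrArg Neg.neg (?_ : formAt (fieldStrength A₂) x (Matrix.vecCons (vecAt X x) fun _ => w) =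
      formAt (fieldStrength A) x (Matrix.vecCons (vecAt X x) fun _ => w))
    exact S.eq_of_pull_eq hF hx (Fin.cases (hX.tangent hx) fun _ => hw)
  rw [densT, densT, h1, h2]
  have hpi : Real.pi ≠ 0 := Real.pi_ne_zero
  field_simp
  ring

end Comparison

end Foliation
end Completion
end RadiativePart

section BoundaryTerms

variable {M : Type*} [TopologicalSpace M] [ChartedSpace (EuclideanHalfSpace 4) M]

namespace Completion
namespace Foliation

variable {C : Completion M} (S : C.Foliation) {A : DForm (𝓡∂ 4) M 1} {X : VField (𝓡∂ 4) M}
  {lam : M → ℝ}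

/-- Forms that agree on the tangent vectors of the cross-sections. -/
def CrossEq (η ζ : DForm IN Scri 2) : Prop :=
  ∀ (z : Scri) (v w : ℝ × EuclideanSpace ℝ (Fin 2)), v.1 = 0 → w.1 = 0 →
    formAt η z ![v, w] = formAt ζ z ![v, w]

theorem crossEq_of {η : DForm (𝓡∂ 4) M 2} {f : M → ℝ} (h : ∀ x ∈ (𝓡∂ 4).boundary M, ∀ a b : E4,
    dAt (𝓡∂ 4) C.Ω x a = 0 → dAt (𝓡∂ 4) C.Ω x b = 0 → dAt (𝓡∂ 4) S.u x a = 0 →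
    dAt (𝓡∂ 4) S.u x b = 0 →
    formAt η x ![a, b] = f x * -formAt C.vol x ![vecAt S.l x, vecAt C.n x, a, b]) :
    CrossEq (S.pull η) (S.vol2 f) := by
  intro z v w hv hw
  have e : (fun i => S.dΦ z (![v, w] i)) = ![S.dΦ z v, S.dΦ z w] := by
    ext1 i; fin_cases i <;> rfl
  have h1 := h _ (S.Φ_boundary z) (S.dΦ z v) (S.dΦ z w) (S.dΩ_dΦ z v) (S.dΩ_dΦ z w)
    (by rw [S.du_dΦ, hv]) (by rw [S.du_dΦ, hw])
  refine (congrArg (formAt η (S.Φ z)) e).trans (h1.trans (congrArg (fun r => f (S.Φ z) * -r) ?_))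
  exact (curryLeft2_apply (formAt C.vol (S.Φ z)) (vecAt S.l (S.Φ z)) (vecAt C.n (S.Φ z))
    (fun i => S.dΦ z (![v, w] i))).symm

theorem hodge_cross {x : M} (hx : x ∈ (𝓡∂ 4).boundary M) {a b : E4}
    (ha : dAt (𝓡∂ 4) C.Ω x a = 0) (hb : dAt (𝓡∂ 4) C.Ω x b = 0) (ha' : dAt (𝓡∂ 4) S.u x a = 0)
    (hb' : dAt (𝓡∂ 4) S.u x b = 0) : formAt (hodge C.g C.vol (fieldStrength A)) x ![a, b] =
      2 * S.rePhi1 A x * -formAt C.vol x ![vecAt S.l x, vecAt C.n x, a, b] := by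
  have h := (S.scriPoint hx).hodgeP_cross (formAt (fieldStrength A) x) ha hb ha' hb'
  have h2 : S.rePhi1 A x = 1 / 2 * formAt (fieldStrength A) x ![vecAt S.l x, vecAt C.n x] := rfl
  refine h.trans ?_
  rw [h2, C.vecAt_n]
  ring

theorem crossEq_coulomb : CrossEq (S.pull fun y => lam y • hodge C.g C.vol (fieldStrength A) y)
    (S.vol2 fun x => 2 * lam x * S.rePhi1 A x) :=
  S.crossEq_of fun x hx a b ha hb ha' hb' => by
    have h := S.hodge_cross (A := A) hx ha hb ha' hb'
    refine (congrArg (lam x * ·) h).trans ?_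
    ring

theorem crossEq_boundaryN (hA : C.IsMaxwellPotential A) :
    CrossEq (S.pull (boundaryN C.g C.vol A X lam)) (S.vol2 fun x => -(1 / (2 * Real.pi)) *
      (S.rePhi1 A x * (covector (A x) (S.Y X x) + lam x))) :=
  S.crossEq_of fun x hx a b ha hb ha' hb' => by
    have h := S.hodge_cross (A := A) hx ha hb ha' hb'
    have hY : covector (A x) (S.Y X x) = covector (A x) (X x) := by
      have h1 : covector (A x) (S.Y X x) =
        flatCov (formAt A x) (vecAt X x - S.beta X x • vecAt C.n x) := rfl
      rw [h1, map_sub, map_smul, hA.gauge hx, smul_zero, sub_zero]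
      rfl
    rw [boundaryN_eq, hY]
    refine (congrArg (fun r => -(1 / (4 * Real.pi)) * ((covector (A x) (X x) + lam x) * r)) h).trans ?_
    have hpi : Real.pi ≠ 0 := Real.pi_ne_zero
    field_simp
    ring

theorem crossEq_boundaryC (hA : C.IsMaxwellPotential A) (hX : C.IsBMS X) :
    CrossEq (S.pull (boundaryC C.g C.vol A X lam)) (S.vol2 fun x => -(1 / (4 * Real.pi)) *
      (S.beta X x * S.qInv (C.electric A x) (A x) - 2 * lam x * S.rePhi1 A x)) :=
  S.crossEq_of fun x hx a b ha hb ha' hb' => by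
    have h := S.hodge_cross (A := A) hx ha hb ha' hb'
    have h1 := (S.scriPoint hx).vol_raiseP_cross (formAt (fieldStrength A) x) (flatCov (formAt A x))
      (hX.tangent hx) ha hb ha' hb'
    have h2 := S.qInv_of_normal (α := C.electric A) (elecAt_n (fieldStrength A) x) (hA.gauge hx)
    have h3 : formAt (boundaryC C.g C.vol A X lam) x ![a, b] = -(1 / (8 * Real.pi)) *
      (2 * ((formAt C.vol x).curryLeft (vecAt X x)).curryLeft (raiseP (bilinAt C.g x)
        (formAt (fieldStrength A) x) (flatCov (formAt A x))) ![a, b]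
        - lam x * (2 * formAt (hodge C.g C.vol (fieldStrength A)) x ![a, b])) := rfl
    rw [h3, h, curryLeft2_apply, h2]
    simp only [Matrix.cons_val_zero, Matrix.cons_val_one]
    rw [h1]
    change -(1 / (8 * Real.pi)) * (2 * (-(S.beta X x * flatCov (formAt (C.electric A) x)
      (C.sharpAt (flatCov (formAt A x)) x)) * formAt C.vol x ![vecAt S.l x, vecAt C.n x, a, b]) - _) = _
    have hpi : Real.pi ≠ 0 := Real.pi_ne_zero
    field_simp
    ring

end Foliation
end Completion
end BoundaryTerms

section FlatStokes

/-- The parameter space of `(t, θ, φ)`. -/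
abbrev W3 := ℝ × ℝ × ℝ

theorem continuous_inner_integral {f : W3 → ℝ} (hf : Continuous f) (c d : ℝ) :
    Continuous fun p : ℝ × ℝ => ∫ φ in c..d, f (p.1, p.2, φ) :=
  intervalIntegral.continuous_parametric_intervalIntegral_of_continuous'
    (f := fun (p : ℝ × ℝ) φ => f (p.1, p.2, φ)) (by fun_prop) c d

theorem continuous_outer_integral {g : ℝ × ℝ → ℝ} (hg : Continuous g) (c d : ℝ) :
    Continuous fun t : ℝ => ∫ θ in c..d, g (t, θ) :=
  intervalIntegral.continuous_parametric_intervalIntegral_of_continuous'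
    (f := fun (t : ℝ) θ => g (t, θ)) (by fun_prop) c d

theorem integral_swap {g : ℝ × ℝ → ℝ} (hg : Continuous g) (a b c d : ℝ) :
    ∫ x in a..b, ∫ y in c..d, g (x, y) = ∫ y in c..d, ∫ x in a..b, g (x, y) := by
  refine MeasureTheory.intervalIntegral_intervalIntegral_swap (F := fun x y => g (x, y)) ?_
  exact (hg.continuousOn.integrableOn_compact (isCompact_uIcc.prod isCompact_uIcc)).mono_set
    (prod_mono uIoc_subset_uIcc uIoc_subset_uIcc)

variable {a b c : W3 → ℝ}

theorem continuous_fderiv_apply' (ha : ContDiff ℝ ∞ a) (v : W3) :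
    Continuous fun y => fderiv ℝ a y v :=
  (ha.continuous_fderiv (by simp)).clm_apply continuous_const

theorem integral_fderiv_line (ha : ContDiff ℝ ∞ a) (p v : W3) (s₁ s₂ : ℝ) :
    ∫ s in s₁..s₂, fderiv ℝ a (p + s • v) v = a (p + s₂ • v) - a (p + s₁ • v) := by
  have h (s : ℝ) : HasDerivAt (fun s : ℝ => a (p + s • v)) (fderiv ℝ a (p + s • v) v) s := by
    have h1 : HasDerivAt (fun s : ℝ => p + s • v) v s := by
      simpa using ((hasDerivAt_id s).smul_const v).const_add p
    exact ((ha.differentiable (by simp)) _).hasFDerivAt.comp_hasDerivAt s h1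
  refine intervalIntegral.integral_eq_sub_of_hasDerivAt (fun s _ => h s) ?_
  refine Continuous.intervalIntegrable ?_ _ _
  exact (continuous_fderiv_apply' ha v).comp (by fun_prop)

theorem triple_integral_dt (ha : ContDiff ℝ ∞ a) (t₁ t₂ θ₁ θ₂ φ₁ φ₂ : ℝ) :
    ∫ t in t₁..t₂, ∫ θ in θ₁..θ₂, ∫ φ in φ₁..φ₂, fderiv ℝ a (t, θ, φ) (1, 0, 0) =
      (∫ θ in θ₁..θ₂, ∫ φ in φ₁..φ₂, a (t₂, θ, φ)) - ∫ θ in θ₁..θ₂, ∫ φ in φ₁..φ₂, a (t₁, θ, φ) := by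
  have hf := continuous_fderiv_apply' ha (1, 0, 0)
  have hac := ha.continuous
  rw [integral_swap (continuous_inner_integral hf φ₁ φ₂)]
  have h1 (θ : ℝ) : ∫ t in t₁..t₂, ∫ φ in φ₁..φ₂, fderiv ℝ a (t, θ, φ) (1, 0, 0) =
      (∫ φ in φ₁..φ₂, a (t₂, θ, φ)) - ∫ φ in φ₁..φ₂, a (t₁, θ, φ) := by
    rw [integral_swap (g := fun p : ℝ × ℝ => fderiv ℝ a (p.1, θ, p.2) (1, 0, 0))
      (hf.comp (by fun_prop)), ← intervalIntegral.integral_sub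
      (Continuous.intervalIntegrable (by fun_prop) _ _)
      (Continuous.intervalIntegrable (by fun_prop) _ _)]
    refine intervalIntegral.integral_congr fun φ _ => ?_
    simpa using integral_fderiv_line ha (0, θ, φ) (1, 0, 0) t₁ t₂
  simp only [h1]
  exact intervalIntegral.integral_sub
    (((continuous_inner_integral hac φ₁ φ₂).comp (Continuous.prodMk_right t₂)).intervalIntegrable _ _)
    (((continuous_inner_integral hac φ₁ φ₂).comp (Continuous.prodMk_right t₁)).intervalIntegrable _ _)

theorem triple_integral_dθ (hb : ContDiff ℝ ∞ b) (t₁ t₂ θ₁ θ₂ φ₁ φ₂ : ℝ)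
    (h : ∀ t φ, b (t, θ₁, φ) = b (t, θ₂, φ)) :
    ∫ t in t₁..t₂, ∫ θ in θ₁..θ₂, ∫ φ in φ₁..φ₂, fderiv ℝ b (t, θ, φ) (0, 1, 0) = 0 := by
  have hf := continuous_fderiv_apply' hb (0, 1, 0)
  refine (intervalIntegral.integral_congr (g := fun _ => 0) fun t _ => ?_).trans (by simp)
  beta_reduce
  rw [integral_swap (g := fun p : ℝ × ℝ => fderiv ℝ b (t, p.1, p.2) (0, 1, 0))
    (hf.comp (by fun_prop))]
  refine (intervalIntegral.integral_congr (g := fun _ => 0) fun φ _ => ?_).trans (by simp)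
  have := integral_fderiv_line hb (t, 0, φ) (0, 1, 0) θ₁ θ₂
  simpa [h] using this

theorem triple_integral_dφ (hc : ContDiff ℝ ∞ c) (t₁ t₂ θ₁ θ₂ φ₁ φ₂ : ℝ)
    (h : ∀ t θ, c (t, θ, φ₁) = c (t, θ, φ₂)) :
    ∫ t in t₁..t₂, ∫ θ in θ₁..θ₂, ∫ φ in φ₁..φ₂, fderiv ℝ c (t, θ, φ) (0, 0, 1) = 0 := by
  have h1 (t θ : ℝ) : ∫ φ in φ₁..φ₂, fderiv ℝ c (t, θ, φ) (0, 0, 1) = 0 := by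
    have := integral_fderiv_line hc (t, θ, 0) (0, 0, 1) φ₁ φ₂
    simpa [h] using this
  simp [h1]

theorem triple_integral_add {f g : W3 → ℝ} (hf : Continuous f) (hg : Continuous g)
    (t₁ t₂ θ₁ θ₂ φ₁ φ₂ : ℝ) :
    ∫ t in t₁..t₂, ∫ θ in θ₁..θ₂, ∫ φ in φ₁..φ₂, (f (t, θ, φ) + g (t, θ, φ)) =
      (∫ t in t₁..t₂, ∫ θ in θ₁..θ₂, ∫ φ in φ₁..φ₂, f (t, θ, φ)) +
        ∫ t in t₁..t₂, ∫ θ in θ₁..θ₂, ∫ φ in φ₁..φ₂, g (t, θ, φ) := by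
  have hf1 := continuous_inner_integral hf φ₁ φ₂
  have hg1 := continuous_inner_integral hg φ₁ φ₂
  refine (intervalIntegral.integral_congr fun t _ => ?_).trans (intervalIntegral.integral_add
    ((continuous_outer_integral hf1 θ₁ θ₂).intervalIntegrable _ _)
    ((continuous_outer_integral hg1 θ₁ θ₂).intervalIntegrable _ _))
  refine (intervalIntegral.integral_congr fun θ _ => ?_).trans (intervalIntegral.integral_add
    ((hf1.comp (Continuous.prodMk_right t)).intervalIntegrable _ _)
    ((hg1.comp (Continuous.prodMk_right t)).intervalIntegrable _ _))
  exact intervalIntegral.integral_add (Continuous.intervalIntegrable (by fun_prop) _ _)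
    (Continuous.intervalIntegrable (by fun_prop) _ _)

/-- Stokes' theorem for a two-form with components `a = η(∂_θ, ∂_φ)`, `b = η(∂_t, ∂_φ)` and
`c = η(∂_t, ∂_θ)`. -/
theorem triple_integral_extDeriv (ha : ContDiff ℝ ∞ a) (hb : ContDiff ℝ ∞ b) (hc : ContDiff ℝ ∞ c)
    (t₁ t₂ θ₁ θ₂ φ₁ φ₂ : ℝ) (hθ : ∀ t φ, b (t, θ₁, φ) = b (t, θ₂, φ))
    (hφ : ∀ t θ, c (t, θ, φ₁) = c (t, θ, φ₂)) :
    ∫ t in t₁..t₂, ∫ θ in θ₁..θ₂, ∫ φ in φ₁..φ₂, (fderiv ℝ a (t, θ, φ) (1, 0, 0) -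
        fderiv ℝ b (t, θ, φ) (0, 1, 0) + fderiv ℝ c (t, θ, φ) (0, 0, 1)) =
      (∫ θ in θ₁..θ₂, ∫ φ in φ₁..φ₂, a (t₂, θ, φ)) - ∫ θ in θ₁..θ₂, ∫ φ in φ₁..φ₂, a (t₁, θ, φ) := by
  have h1 := continuous_fderiv_apply' ha (1, 0, 0)
  have h2 := continuous_fderiv_apply' hb (0, 1, 0)
  have h3 := continuous_fderiv_apply' hc (0, 0, 1)
  have h2' : Continuous fun y => -fderiv ℝ b y (0, 1, 0) := h2.neg
  have h12 : Continuous fun y => fderiv ℝ a y (1, 0, 0) + -fderiv ℝ b y (0, 1, 0) := h1.add h2'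
  simp only [sub_eq_add_neg (fderiv ℝ a _ _)]
  rw [triple_integral_add h12 h3, triple_integral_dφ hc _ _ _ _ _ _ hφ, add_zero,
    triple_integral_add h1 h2', triple_integral_dt ha]
  simp only [intervalIntegral.integral_neg]
  rw [triple_integral_dθ hb _ _ _ _ _ _ hθ, neg_zero, add_zero]

end FlatStokes

section VectorSpaceForms

variable {E : Type*} [NormedAddCommGroup E] [NormedSpace ℝ E]

theorem symmD_model (x y : E) : symmD 𝓘(ℝ, E) x y = ContinuousLinearMap.id ℝ E := by
  have h : UniqueMDiffWithinAt 𝓘(ℝ, E) (range 𝓘(ℝ, E)) y := by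
    rw [ModelWithCorners.range_eq_univ]
    exact uniqueMDiffWithinAt_univ 𝓘(ℝ, E)
  exact mfderivWithin_id h

theorem chartForm_model {k : ℕ} (p : DForm 𝓘(ℝ, E) E k) (x : E) :
    chartForm 𝓘(ℝ, E) p x = formAt p := by
  funext y
  ext v
  rw [chartForm_apply, symmD_model]
  rfl

theorem formAt_extD_model {k : ℕ} (p : DForm 𝓘(ℝ, E) E k) (x : E) :
    formAt (extD 𝓘(ℝ, E) p) x = extDeriv (formAt p) x := by
  rw [formAt_extD, chartForm_model, ModelWithCorners.range_eq_univ, extDerivWithin_univ]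
  rfl

theorem SmoothForm.contDiff {k : ℕ} {p : DForm 𝓘(ℝ, E) E k} (hp : SmoothForm 𝓘(ℝ, E) p) :
    ContDiff ℝ ∞ (formAt p) := by
  have h := hp 0
  rw [chartForm_model, extChartAt_model_space_eq_id] at h
  exact contDiffOn_univ.1 h

end VectorSpaceForms

section SphericalCoordinates

/-- Coordinates on `ℝ × S²`. -/
def sphMap (y : W3) : Scri := (y.1, sph y.2.1 y.2.2)

theorem contMDiff_sphMap : ContMDiff 𝓘(ℝ, W3) IN ∞ sphMap := by
  refine ContMDiff.prodMk (contDiff_fst.contMDiff) ?_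
  have h : ContMDiff 𝓘(ℝ, W3) 𝓘(ℝ, EuclideanSpace ℝ (Fin 3)) ∞ fun y : W3 =>
      (sph y.2.1 y.2.2 : EuclideanSpace ℝ (Fin 3)) := by
    refine ContDiff.contMDiff (contDiff_euclidean.2 fun i => ?_)
    fin_cases i
    · change ContDiff ℝ ∞ fun y : W3 => Real.sin y.2.1 * Real.cos y.2.2
      fun_prop
    · change ContDiff ℝ ∞ fun y : W3 => Real.sin y.2.1 * Real.sin y.2.2
      fun_prop
    · change ContDiff ℝ ∞ fun y : W3 => Real.cos y.2.1
      fun_prop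
  have := Fact.mk (@finrank_euclideanSpace_fin ℝ _ (2 + 1))
  exact h.codRestrict_sphere (n := 2) fun y => (sph y.2.1 y.2.2).2

theorem mapD_curve {γ : ℝ → W3} {s : ℝ} {v : W3} (hγ : HasDerivAt γ v s) :
    mapD IN 𝓘(ℝ, ℝ) (sphMap ∘ γ) s 1 = mapD IN 𝓘(ℝ, W3) sphMap (γ s) v := by
  have h := mfderiv_comp s ((contMDiff_sphMap (γ s)).mdifferentiableAt (by simp))
    hγ.hasFDerivAt.hasMFDerivAt.mdifferentiableAt
  have h2 := congrArg (fun L : ℝ →L[ℝ] ℝ × EuclideanSpace ℝ (Fin 2) => L 1) h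
  refine h2.trans ?_
  change mapD IN 𝓘(ℝ, W3) sphMap (γ s) (mapD 𝓘(ℝ, W3) 𝓘(ℝ, ℝ) γ s 1) = _
  congr 1
  rw [mapD, mfderiv_eq_fderiv, hγ.hasFDerivAt.fderiv]
  simp

theorem partialU_eq (t θ φ : ℝ) : partialU t θ φ =
    (mapD IN 𝓘(ℝ, W3) sphMap (t, θ, φ) (1, 0, 0) : ℝ × EuclideanSpace ℝ (Fin 2)) :=
  mapD_curve (γ := fun s => (s, θ, φ))
    ((hasDerivAt_id t).prodMk ((hasDerivAt_const t θ).prodMk (hasDerivAt_const t φ)))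

theorem partialTheta_eq (t θ φ : ℝ) : partialTheta t θ φ =
    (mapD IN 𝓘(ℝ, W3) sphMap (t, θ, φ) (0, 1, 0) : ℝ × EuclideanSpace ℝ (Fin 2)) :=
  mapD_curve (γ := fun s => (t, s, φ))
    ((hasDerivAt_const θ t).prodMk ((hasDerivAt_id θ).prodMk (hasDerivAt_const θ φ)))

theorem partialPhi_eq (t θ φ : ℝ) : partialPhi t θ φ =
    (mapD IN 𝓘(ℝ, W3) sphMap (t, θ, φ) (0, 0, 1) : ℝ × EuclideanSpace ℝ (Fin 2)) :=
  mapD_curve (γ := fun s => (t, θ, s))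
    ((hasDerivAt_const φ t).prodMk ((hasDerivAt_const φ θ).prodMk (hasDerivAt_id φ)))

theorem mapD_sphMap_fst (y v : W3) : (mapD IN 𝓘(ℝ, W3) sphMap y v).1 = v.1 := by
  have h := mfderiv_comp (I'' := 𝓘(ℝ, ℝ)) y (g := Prod.fst)
    (mdifferentiableAt_fst (I := 𝓘(ℝ, ℝ)) (I' := 𝓡 2))
    ((contMDiff_sphMap y).mdifferentiableAt (by simp))
  have h2 := congrArg (fun L : W3 →L[ℝ] ℝ => L v) h
  have h3 : mfderiv IN 𝓘(ℝ, ℝ) Prod.fst (sphMap y) =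
      ContinuousLinearMap.fst ℝ ℝ (EuclideanSpace ℝ (Fin 2)) :=
    mfderiv_fst (I := 𝓘(ℝ, ℝ)) (I' := 𝓡 2) (x := sphMap y)
  have h4 : mfderiv 𝓘(ℝ, W3) 𝓘(ℝ, ℝ) (Prod.fst ∘ sphMap) y =
      ContinuousLinearMap.fst ℝ ℝ (ℝ × ℝ) := by
    rw [mfderiv_eq_fderiv]
    exact fderiv_fst
  rw [h4] at h2
  refine Eq.trans ?_ h2.symm
  change _ = mfderiv IN 𝓘(ℝ, ℝ) Prod.fst (sphMap y) (mapD IN 𝓘(ℝ, W3) sphMap y v)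
  rw [h3]
  rfl

end SphericalCoordinates


section Stokes

theorem sph_two_pi (θ : ℝ) : sph θ (2 * Real.pi) = sph θ 0 := by simp [sph]

theorem sph_pole {θ : ℝ} (h : Real.sin θ = 0) (φ : ℝ) : sph θ φ = sph θ 0 := by simp [sph, h]

theorem partialPhi_pole {θ : ℝ} (h : Real.sin θ = 0) (t φ : ℝ) :
    partialPhi t θ φ = (0 : ℝ × EuclideanSpace ℝ (Fin 2)) := by
  have e : (fun s : ℝ => ((t, sph θ s) : Scri)) = fun _ => (t, sph θ 0) :=
    funext fun s => by rw [sph_pole h]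
  refine (congrArg (fun f : ℝ → Scri => mapD IN 𝓘(ℝ, ℝ) f φ 1) e).trans ?_
  rw [mapD, mfderiv_const]
  rfl

/-- The components of a two-form on `ℝ × S²` in spherical coordinates. -/
def sphComp (q : DForm IN Scri 2) (v w y : W3) : ℝ :=
  formAt q (sphMap y) ![mapD IN 𝓘(ℝ, W3) sphMap y v, mapD IN 𝓘(ℝ, W3) sphMap y w]

theorem formAt_pullForm_sphMap (q : DForm IN Scri 2) (v w y : W3) :
    formAt (pullForm 𝓘(ℝ, W3) sphMap q) y ![v, w] = sphComp q v w y := by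
  rw [formAt_pullForm_apply]
  refine congrArg _ (funext fun i => ?_)
  fin_cases i <;> rfl

variable {q : DForm IN Scri 2}

theorem contDiff_sphComp (hq : SmoothForm IN q) (v w : W3) : ContDiff ℝ ∞ (sphComp q v w) := by
  have h := (hq.pullForm contMDiff_sphMap).contDiff
  have h2 : sphComp q v w = fun y => formAt (pullForm 𝓘(ℝ, W3) sphMap q) y ![v, w] :=
    funext fun y => (formAt_pullForm_sphMap q v w y).symm
  rw [h2]
  exact (ContinuousAlternatingMap.apply ℝ W3 ℝ ![v, w]).contDiff.comp h

theorem extD_sphMap (hq : SmoothForm IN q) (y u v w : W3) :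
    formAt (extD IN q) (sphMap y) ![mapD IN 𝓘(ℝ, W3) sphMap y u, mapD IN 𝓘(ℝ, W3) sphMap y v,
        mapD IN 𝓘(ℝ, W3) sphMap y w] =
      fderiv ℝ (sphComp q v w) y u - fderiv ℝ (sphComp q u w) y v +
        fderiv ℝ (sphComp q u v) y w := by
  have h := (hq.pullForm contMDiff_sphMap).contDiff
  have h1 : formAt (extD IN q) (sphMap y) ![mapD IN 𝓘(ℝ, W3) sphMap y u,
      mapD IN 𝓘(ℝ, W3) sphMap y v, mapD IN 𝓘(ℝ, W3) sphMap y w] =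
      formAt (pullForm 𝓘(ℝ, W3) sphMap (extD IN q)) y ![u, v, w] := by
    rw [formAt_pullForm_apply]
    refine congrArg _ (funext fun i => ?_)
    fin_cases i <;> rfl
  rw [h1, ← extD_pullForm hq contMDiff_sphMap, formAt_extD_model,
    extDeriv_apply (h.differentiable (by simp) y)]
  have e0 : (fun y => formAt (pullForm 𝓘(ℝ, W3) sphMap q) y
      ((0 : Fin 3).removeNth ![u, v, w])) = sphComp q v w := funext fun y => by
    rw [← formAt_pullForm_sphMap]
    exact congrArg _ (by ext1 i; fin_cases i <;> rfl)
  have e1 : (fun y => formAt (pullForm 𝓘(ℝ, W3) sphMap q) y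
      ((1 : Fin 3).removeNth ![u, v, w])) = sphComp q u w := funext fun y => by
    rw [← formAt_pullForm_sphMap]
    exact congrArg _ (by ext1 i; fin_cases i <;> rfl)
  have e2 : (fun y => formAt (pullForm 𝓘(ℝ, W3) sphMap q) y
      ((2 : Fin 3).removeNth ![u, v, w])) = sphComp q u v := funext fun y => by
    rw [← formAt_pullForm_sphMap]
    exact congrArg _ (by ext1 i; fin_cases i <;> rfl)
  rw [Fin.sum_univ_three, e0, e1, e2]
  simp
  ring

theorem crossInt_eq (t : ℝ) (q : DForm IN Scri 2) :
    crossInt t q = ∫ θ in (0 : ℝ)..Real.pi, ∫ φ in (0 : ℝ)..(2 * Real.pi),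
      sphComp q (0, 1, 0) (0, 0, 1) (t, θ, φ) := by
  refine intervalIntegral.integral_congr fun θ _ => intervalIntegral.integral_congr fun φ _ => ?_
  change formAt q (sphMap (t, θ, φ)) ![partialTheta t θ φ, partialPhi t θ φ] = _
  rw [partialTheta_eq, partialPhi_eq]
  rfl

/-- The component of a three-form on `ℝ × S²` in spherical coordinates. -/
def sphDens (J : DForm IN Scri 3) (y : W3) : ℝ :=
  formAt J (sphMap y) ![mapD IN 𝓘(ℝ, W3) sphMap y (1, 0, 0), mapD IN 𝓘(ℝ, W3) sphMap y (0, 1, 0),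
    mapD IN 𝓘(ℝ, W3) sphMap y (0, 0, 1)]

theorem scriInt_eq (t₁ t₂ : ℝ) (J : DForm IN Scri 3) :
    scriInt t₁ t₂ J = -∫ t in t₁..t₂, ∫ θ in (0 : ℝ)..Real.pi, ∫ φ in (0 : ℝ)..(2 * Real.pi),
      sphDens J (t, θ, φ) := by
  refine congrArg Neg.neg (intervalIntegral.integral_congr fun t _ =>
    intervalIntegral.integral_congr fun θ _ => intervalIntegral.integral_congr fun φ _ => ?_)
  change formAt J (sphMap (t, θ, φ)) ![partialU t θ φ, partialTheta t θ φ, partialPhi t θ φ] = _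
  rw [partialU_eq, partialTheta_eq, partialPhi_eq]
  rfl

theorem continuous_sphDens {J : DForm IN Scri 3} (hJ : SmoothForm IN J) :
    Continuous (sphDens J) := by
  have h := (hJ.pullForm contMDiff_sphMap).contDiff.continuous
  have h2 : sphDens J = fun y => formAt (pullForm 𝓘(ℝ, W3) sphMap J) y
      ![(1, 0, 0), (0, 1, 0), (0, 0, 1)] := funext fun y => by
    rw [formAt_pullForm_apply]
    refine congrArg _ (funext fun i => ?_)
    fin_cases i <;> rfl
  rw [h2]
  exact (ContinuousAlternatingMap.apply ℝ W3 ℝ _).continuous.comp h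

/-- Stokes' theorem on the region `t₁ ≤ u ≤ t₂` of `ℝ × S²`. -/
theorem scriInt_extD (hq : SmoothForm IN q) (t₁ t₂ : ℝ) :
    scriInt t₁ t₂ (extD IN q) = -(crossInt t₂ q - crossInt t₁ q) := by
  rw [scriInt_eq, crossInt_eq, crossInt_eq]
  have h (t θ φ : ℝ) := extD_sphMap hq (t, θ, φ) (1, 0, 0) (0, 1, 0) (0, 0, 1)
  simp only [sphDens, h]
  rw [triple_integral_extDeriv (contDiff_sphComp hq _ _) (contDiff_sphComp hq _ _)
    (contDiff_sphComp hq _ _)]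
  · have h0 {θ : ℝ} (hθ : Real.sin θ = 0) (t φ : ℝ) :
        sphComp q (1, 0, 0) (0, 0, 1) (t, θ, φ) = 0 := by
      rw [sphComp, ← partialPhi_eq, partialPhi_pole hθ]
      exact (formAt q _).map_coord_zero 1 rfl
    intro t φ
    rw [h0 Real.sin_zero, h0 Real.sin_pi]
  · intro t θ
    rw [sphComp, sphComp, ← partialU_eq, ← partialTheta_eq, ← partialU_eq, ← partialTheta_eq]
    have e : sphMap (t, θ, 2 * Real.pi) = sphMap (t, θ, 0) := by
      simp only [sphMap, sph_two_pi]
    have e1 : (partialU t θ (2 * Real.pi) : ℝ × EuclideanSpace ℝ (Fin 2)) = partialU t θ 0 :=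
      congrArg (fun f : ℝ → Scri => mapD IN 𝓘(ℝ, ℝ) f t 1)
        (funext fun s => by rw [sph_two_pi])
    have e2 : (partialTheta t θ (2 * Real.pi) : ℝ × EuclideanSpace ℝ (Fin 2)) =
        partialTheta t θ 0 :=
      congrArg (fun f : ℝ → Scri => mapD IN 𝓘(ℝ, ℝ) f θ 1)
        (funext fun s => by rw [sph_two_pi])
    rw [e, e1, e2]

theorem scriInt_add {J K : DForm IN Scri 3} (hJ : SmoothForm IN J) (hK : SmoothForm IN K)
    (t₁ t₂ : ℝ) : scriInt t₁ t₂ (J + K) = scriInt t₁ t₂ J + scriInt t₁ t₂ K := by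
  rw [scriInt_eq, scriInt_eq, scriInt_eq, ← neg_add,
    ← triple_integral_add (continuous_sphDens hJ) (continuous_sphDens hK)]
  rfl

theorem scriInt_smul (c : ℝ) (J : DForm IN Scri 3) (t₁ t₂ : ℝ) :
    scriInt t₁ t₂ (c • J) = c * scriInt t₁ t₂ J := by
  have h (y : W3) : sphDens (c • J) y = c * sphDens J y := rfl
  simp only [scriInt_eq, h, intervalIntegral.integral_const_mul, mul_neg]

theorem crossInt_smul (c : ℝ) (η : DForm IN Scri 2) (t : ℝ) :
    crossInt t (c • η) = c * crossInt t η := by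
  have h (y : W3) : sphComp (c • η) (0, 1, 0) (0, 0, 1) y =
    c * sphComp η (0, 1, 0) (0, 0, 1) y := rfl
  simp only [crossInt_eq, h, intervalIntegral.integral_const_mul]

theorem CrossEq.crossInt_eq {η ζ : DForm IN Scri 2} (h : Completion.Foliation.CrossEq η ζ) (t : ℝ) :
    crossInt t η = crossInt t ζ := by
  rw [ScriMaxwell.crossInt_eq, ScriMaxwell.crossInt_eq]
  refine intervalIntegral.integral_congr fun θ _ => intervalIntegral.integral_congr fun φ _ => ?_
  exact h _ _ _ (mapD_sphMap_fst _ _) (mapD_sphMap_fst _ _)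

end Stokes


section Fluxes

variable {M : Type*} [TopologicalSpace M] [ChartedSpace (EuclideanHalfSpace 4) M]

namespace Completion
namespace Foliation

variable {C : Completion M} (S : C.Foliation) {A : DForm (𝓡∂ 4) M 1} {X : VField (𝓡∂ 4) M}
  {lam : M → ℝ}

theorem flux_const_mul (t₁ t₂ : ℝ) (J : DForm (𝓡∂ 4) M 3) (c : ℝ) (f : M → ℝ)
    (h : S.pull J = S.vol3 fun x => c * f x) : S.flux t₁ t₂ J = c * scriInt t₁ t₂ (S.vol3 f) := by
  rw [flux, h, S.vol3_const_mul, scriInt_smul]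

theorem charge_const_mul (t : ℝ) (Q : DForm (𝓡∂ 4) M 2) (c : ℝ) (f : M → ℝ)
    (h : CrossEq (S.pull Q) (S.vol2 fun x => c * f x)) :
    S.charge t Q = c * crossInt t (S.vol2 f) := by
  rw [charge, CrossEq.crossInt_eq h, S.vol2_const_mul, crossInt_smul]

variable [IsManifold (𝓡∂ 4) ∞ M]

theorem smooth_pull {k : ℕ} {η : DForm (𝓡∂ 4) M k} (hη : SmoothForm (𝓡∂ 4) η) :
    SmoothForm IN (S.pull η) := hη.pullForm S.Φ_smooth

variable (hA : C.IsMaxwellPotential A) (hX : C.IsBMS X)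
  (hlam : ContMDiff (𝓡∂ 4) 𝓘(ℝ, ℝ) ∞ lam)
include hA hlam

/-- The Coulombic charge changes by the flux of a radiative density. -/
theorem coulomb_flux (hlam' : ∀ x ∈ (𝓡∂ 4).boundary M, dFun (𝓡∂ 4) lam x (C.n x) = 0)
    (t₁ t₂ : ℝ) : scriInt t₁ t₂ (S.vol3 fun x =>
        S.qInv (C.electric A x) (oneForm (dFun (𝓡∂ 4) lam x))) =
      -(crossInt t₂ (S.vol2 fun x => 2 * lam x * S.rePhi1 A x)
        - crossInt t₁ (S.vol2 fun x => 2 * lam x * S.rePhi1 A x)) := by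
  have hs := (C.smooth_hodge hA.1).fsmul hlam
  rw [← S.pull_extD_coulomb hA hlam' hlam, S.pull_extD hs, scriInt_extD (S.smooth_pull hs),
    CrossEq.crossInt_eq S.crossEq_coulomb, CrossEq.crossInt_eq S.crossEq_coulomb]

include hX

theorem flux_noether (t₁ t₂ : ℝ) : S.flux t₁ t₂ (currentForm C.vol (noetherVec C.g A X lam)) =
    1 / 2 * S.flux t₁ t₂ (currentForm C.vol (canonicalVec C.g A X lam)) +
      1 / 2 * (S.charge t₂ (boundaryC C.g C.vol A X lam)
        - S.charge t₁ (boundaryC C.g C.vol A X lam)) := by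
  have hJ := S.smooth_pull
    (smooth_canonicalForm C.g_lorentzian C.g_smooth C.vol_smooth hA.1 hX.1 hlam)
  have hQ := S.smooth_pull
    (smooth_boundaryC C.g_lorentzian C.g_smooth C.vol_smooth hA.1 hX.1 hlam)
  have h := scriInt_add hJ (hQ.extD.const_smul (-1)) t₁ t₂
  have h2 := scriInt_smul (-1) (extD IN (S.pull (boundaryC C.g C.vol A X lam))) t₁ t₂
  rw [scriInt_extD hQ] at h2
  rw [flux, S.pull_noether hA hX hlam, scriInt_smul, sub_eq_add_neg, ← neg_one_smul ℝ]
  refine (congrArg (1 / 2 * ·) (h.trans (congrArg _ h2))).trans ?_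
  rw [flux, charge, charge]
  ring

theorem flux_stress (t₁ t₂ : ℝ) : S.flux t₁ t₂ (currentForm C.vol (stressVec C.g A X)) =
    -S.flux t₁ t₂ (currentForm C.vol (noetherVec C.g A X lam)) -
      (S.charge t₂ (boundaryN C.g C.vol A X lam) - S.charge t₁ (boundaryN C.g C.vol A X lam)) := by
  have hJ := S.smooth_pull
    (smooth_noetherForm C.g_lorentzian C.g_smooth C.vol_smooth hA.1 hX.1 hlam)
  have hQ := S.smooth_pull
    (smooth_boundaryN C.g_lorentzian C.g_smooth C.vol_smooth hA.1 hX.1 hlam)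
  have h := scriInt_add (hJ.const_smul (-1)) hQ.extD t₁ t₂
  have h2 := scriInt_smul (-1) (S.pull (currentForm C.vol (noetherVec C.g A X lam))) t₁ t₂
  rw [scriInt_extD hQ] at h
  rw [flux, S.pull_stress hA hX hlam, ← neg_one_smul ℝ]
  refine (h.trans (congrArg (· + _) h2)).trans ?_
  rw [flux, charge, charge]
  ring

end Foliation
end Completion
end Fluxes

end ScriMaxwell
end

theorem mainTheorem5
    {M : Type*} [TopologicalSpace M] [ChartedSpace (EuclideanHalfSpace 4) M]
    [IsManifold (𝓡∂ 4) ∞ M]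
    (C : ScriMaxwell.Completion M) (S : C.Foliation)
    (A : ScriMaxwell.DForm (𝓡∂ 4) M 1) (hA : C.IsMaxwellPotential A)
    (X : ScriMaxwell.VField (𝓡∂ 4) M) (lam : M → ℝ) (hξ : C.IsSymmetry X lam) :
    Nonempty (C.Currents A X lam) ∧
    ∀ 𝒥 : C.Currents A X lam,
      -- the currents on null infinity differ by exact forms
      (S.pull 𝒥.JN = (1 / 2 : ℝ) • (S.pull 𝒥.JC - ScriMaxwell.extD ScriMaxwell.IN (S.pull 𝒥.QC)) ∧
        S.pull 𝒥.JT = -S.pull 𝒥.JN + ScriMaxwell.extD ScriMaxwell.IN (S.pull 𝒥.QN)) ∧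
      -- the pullbacks of the currents
      (S.pull 𝒥.JC = S.vol3 (fun x => -(1 / (4 * Real.pi)) * S.densC A X lam x) ∧
        S.pull 𝒥.JN = S.vol3 (fun x => -(1 / (4 * Real.pi)) * S.densN A X lam x) ∧
        S.pull 𝒥.JT = S.vol3 (fun x => -(1 / (4 * Real.pi)) * S.densT A X x)) ∧
      -- the fluxes of the currents
      (∀ t₁ t₂ : ℝ, t₁ ≤ t₂ →
        S.flux t₁ t₂ 𝒥.JC =
          -(1 / (4 * Real.pi)) * ScriMaxwell.scriInt t₁ t₂ (S.vol3 (S.densC A X lam)) ∧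
        S.flux t₁ t₂ 𝒥.JN =
          -(1 / (4 * Real.pi)) * ScriMaxwell.scriInt t₁ t₂ (S.vol3 (S.densN A X lam)) ∧
        S.flux t₁ t₂ 𝒥.JT =
          -(1 / (4 * Real.pi)) * ScriMaxwell.scriInt t₁ t₂ (S.vol3 (S.densT A X)) ∧
        S.flux t₁ t₂ 𝒥.JN =
          1 / 2 * S.flux t₁ t₂ 𝒥.JC + 1 / 2 * (S.charge t₂ 𝒥.QC - S.charge t₁ 𝒥.QC) ∧
        S.flux t₁ t₂ 𝒥.JT =
          -S.flux t₁ t₂ 𝒥.JN - (S.charge t₂ 𝒥.QN - S.charge t₁ 𝒥.QN)) ∧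
      -- the boundary terms
      (∀ t : ℝ,
        S.charge t 𝒥.QC = -(1 / (4 * Real.pi)) * ScriMaxwell.crossInt t (S.vol2 fun x =>
          S.beta X x * S.qInv (C.electric A x) (A x) - 2 * lam x * S.rePhi1 A x) ∧
        S.charge t 𝒥.QN = -(1 / (2 * Real.pi)) * ScriMaxwell.crossInt t (S.vol2 fun x =>
          S.rePhi1 A x * (ScriMaxwell.covector (A x) (S.Y X x) + lam x))) ∧
      -- the Coulombic contribution to `Q_C` is a radiative flux
      (∀ t₁ t₂ : ℝ, t₁ ≤ t₂ →
        1 / (4 * Real.pi) *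
            ScriMaxwell.crossInt t₂ (S.vol2 fun x => 2 * lam x * S.rePhi1 A x)
          - 1 / (4 * Real.pi) *
            ScriMaxwell.crossInt t₁ (S.vol2 fun x => 2 * lam x * S.rePhi1 A x) =
          -(1 / (4 * Real.pi)) * ScriMaxwell.scriInt t₁ t₂ (S.vol3 fun x =>
            S.qInv (C.electric A x) (ScriMaxwell.oneForm (ScriMaxwell.dFun (𝓡∂ 4) lam x)))) ∧
      -- the canonical and Noether currents on null infinity depend only on the pullback of `A`,
      -- the stress-energy current depends in addition on the Coulombic term
      (∀ A₂ : ScriMaxwell.DForm (𝓡∂ 4) M 1, C.IsMaxwellPotential A₂ → S.pull A₂ = S.pull A →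
        ∀ 𝒥₂ : C.Currents A₂ X lam,
          S.pull 𝒥₂.JC = S.pull 𝒥.JC ∧
          S.pull 𝒥₂.JN = S.pull 𝒥.JN ∧
          S.pull 𝒥₂.JT - S.pull 𝒥.JT = S.vol3 (fun x => -(1 / (2 * Real.pi)) *
            ((S.rePhi1 A₂ x - S.rePhi1 A x) *
              ScriMaxwell.covector (C.electric A x) (S.Y X x)))) := by
  obtain ⟨hX, hlam, hlam'⟩ := hξ
  refine ⟨⟨C.unphysicalCurrents hA.1 hX.1 hlam⟩, fun 𝒥 => ?_⟩
  rw [ScriMaxwell.Completion.currents_eq hA.1 hX.1 hlam 𝒥]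
  refine ⟨⟨S.pull_noether hA hX hlam, S.pull_stress hA hX hlam⟩,
    ⟨S.pull_canonical_eq hA hX hlam', S.pull_noether_eq hA hX hlam', S.pull_stress_eq hX⟩,
    fun t₁ t₂ _ => ⟨S.flux_const_mul _ _ _ _ _ (S.pull_canonical_eq hA hX hlam'),
      S.flux_const_mul _ _ _ _ _ (S.pull_noether_eq hA hX hlam'),
      S.flux_const_mul _ _ _ _ _ (S.pull_stress_eq hX),
      S.flux_noether hA hX hlam t₁ t₂, S.flux_stress hA hX hlam t₁ t₂⟩,
    fun t => ⟨S.charge_const_mul _ _ _ _ (S.crossEq_boundaryC hA hX),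
      S.charge_const_mul _ _ _ _ (S.crossEq_boundaryN hA)⟩,
    fun t₁ t₂ _ => ?_, fun A₂ hA₂ h 𝒥₂ => ?_⟩
  · rw [S.coulomb_flux hA hlam hlam' t₁ t₂]
    ring
  · rw [ScriMaxwell.Completion.currents_eq hA₂.1 hX.1 hlam 𝒥₂]
    exact ⟨S.pull_canonical_congr hA hA₂ h hX hlam', S.pull_noether_congr hA hA₂ h hX hlam',
      S.pull_stress_sub hA hA₂ h hX⟩
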